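/- **Definitions.** Let $n,k,d\in\mathbb N$. A function $f:\{0,1\}^n\to\mathbb R^d$ is *$(\epsilon,\delta)$-concentrated at $\mu\in\mathbb R^d$* if $\Pr_X[\|f(X)-\mu\|_\infty>\epsilon]\le\delta$ for uniformly random $X\in\{0,1\}^n$. A *one-query $(\epsilon',\delta')$-steward for $k$ adaptively chosen $(\epsilon,\delta)$-concentrated functions $\{0,1\}^n\to\mathbb R^d$* is a randomized algorithm $\mathsf S$ that interacts with an owner $\mathsf O$ for $k$ rounds. In round $i$, $\mathsf O$ chooses, depending only on $Y_1,\dots,Y_{i-1}$ and its own randomness (independent of the coins of $\mathsf S$), a function $f_i:\{0,1\}^n\to\mathbb R^d$ that is $(\epsilon,\delta)$-concentrated at some $\mu_i\in\mathbb R^d$; then $\mathsf S$ queries $f_i$ at a single point $X_i$, which $\mathsf O$ does not see, and, knowing only its coins and $f_1(X_1),\dots,f_i(X_i)$, gives some $Y_i\in\mathbb R^d$ to $\mathsf O$. It is required that for every owner, $\Pr[\max_i\|Y_i-\mu_i\|_\infty>\epsilon']\le\delta'$, the probability being over the randomness of $\mathsf S$ and $\mathsf O$. The randomness complexity of $\mathsf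 S$ is the number of random coins it uses. Running time is counted on a random access machine with natural-number cells (unit-cost addition and truncated subtraction, comparison, indirect addressing), exact real-number cells (unit-cost addition, subtraction, comparison, and rounding down to a multiple of another real), and coin tosses. Write $\log^+x=\max(0,\log x)$ for $x>0$, and read $\log 0$ as $0$ in the case $k=0$. **Theorem.** There are absolute constants $c_1,c_2,c_3,e$ and a single program for this machine, which receives $n,k,d,\epsilon,\gamma$ as its input, such that the following holds for all $n,k,d\in\mathbb N$ and all real $\epsilon,\delta,\gamma>0$. Run on $n,k,d,\epsilon,\gamma$, the program is a one-query $(c_1\epsilon d,\;k\delta+\gamma)$-steward for $k$ adaptively chosen $(\epsilon,\delta)$-concentrated functions $f_1,\dots,f_k:\{0,1\}^n\to\mathbb R^d$. Its randomness complexity is at most $$n+c_2\bigl(k\log(d+1)+(\log k)\log^+(1/\gamma)\bigr),$$ and its total running time over all $k$ rounds is at most $$c_3\bigl(n+k+d+\log^+(1/\epsilon)+\log^+(1/\gamma)+1\bigr)^{e}$$ for all outcomes of the coins and all responses to its queries. -/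

import Mathlib

open MeasureTheory

noncomputable section

/-! ### Concentrated functions, owners and one-query stewards -/

/-- The set `{0,1}^n`. -/
abbrev Bits (n : ℕ) : Type := Fin n → Bool

/-- The space `ℝ^d`. Its norm in Mathlib is the sup norm `‖·‖_∞`. -/
abbrev Vec (d : ℕ) : Type := Fin d → ℝ

/-- The uniform distribution on `{0,1}^n`. -/
def uniformBits (n : ℕ) : Measure (Bits n) :=
  (PMF.uniformOfFintype (Bits n)).toMeasure

/-- `f` is `(ε, δ)`-concentrated at `μ`: `Pr_X [‖f(X) - μ‖_∞ > ε] ≤ δ` for uniform `X`. -/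
def Concentrated {n d : ℕ} (ε δ : ℝ) (f : Bits n → Vec d) (μ : Vec d) : Prop :=
  (uniformBits n).real {x | ε < ‖f x - μ‖} ≤ δ

/-- A deterministic owner. From the list `[Y₁, …, Y_{i-1}]` of what the steward has returned so
far (and from nothing else), it chooses `f_i` and the point `μ_i`. -/
structure Owner (n d : ℕ) where
  func : List (Vec d) → Bits n → Vec d
  point : List (Vec d) → Vec d

/-- All functions that the owner may choose are `(ε, δ)`-concentrated at the chosen points. -/
def Owner.Admissible {n d : ℕ} (O : Owner n d) (ε δ : ℝ) : Prop :=
  ∀ Ys : List (Vec d), Concentrated ε δ (O.func Ys) (O.point Ys)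

/-- The strategy of a one-query steward with `m` random coins. In round `i`, knowing the coins and
the responses `[W₁, …, W_{i-1}]` to its earlier queries, it picks the single point `X_i` at which
`f_i` is queried; then, knowing also `W_i = f_i(X_i)`, it picks `Y_i`, the argument of `output`
being the list `[W₁, …, W_i]`. -/
structure OneQuerySteward (n d m : ℕ) where
  query : Bits m → List (Vec d) → Bits n
  output : Bits m → List (Vec d) → Vec d

namespace OneQuerySteward

variable {n d m : ℕ}

/-- The first `i` rounds of the interaction of the owner `O` with the steward `S` using the
coins `x`: the lists `[W₁, …, W_i]` of query responses and `[Y₁, …, Y_i]` of outputs. -/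
def interact (S : OneQuerySteward n d m) (O : Owner n d) (x : Bits m) :
    ℕ → List (Vec d) × List (Vec d)
  | 0 => ([], [])
  | i + 1 =>
    let Ws := (S.interact O x i).1
    let Ys := (S.interact O x i).2
    let Ws' := Ws ++ [O.func Ys (S.query x Ws)]
    (Ws', Ys ++ [S.output x Ws'])

/-- In some round of the interaction, `‖Y_i - μ_i‖_∞ > ε'`. (Rounds are numbered from `0` here.) -/
def Fails (S : OneQuerySteward n d m) (k : ℕ) (ε' : ℝ) (O : Owner n d) (x : Bits m) : Prop :=
  ∃ i < k, ε' < ‖S.output x (S.interact O x (i + 1)).1 - O.point (S.interact O x i).2‖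

/-- `S` is an `(ε', δ')`-steward for `k` adaptively chosen `(ε, δ)`-concentrated functions. The
owner may be randomized: it is a random deterministic owner, independent of the steward's coins.
The only restriction is that the failure event has a probability, i.e. is measurable. -/
def IsSteward (S : OneQuerySteward n d m) (k : ℕ) (ε δ ε' δ' : ℝ) : Prop :=
  ∀ (Ω : Type) [MeasurableSpace Ω] (P : Measure Ω) [IsProbabilityMeasure P] (O : Ω → Owner n d),
    (∀ ω, (O ω).Admissible ε δ) →
    MeasurableSet {p : Bits m × Ω | S.Fails k ε' (O p.2) p.1} →
    ((uniformBits m).prod P).real {p : Bits m × Ω | S.Fails k ε' (O p.2) p.1} ≤ δ'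

end OneQuerySteward

/-! ### The machine model

A random access machine. It has arrays of natural numbers and arrays of real numbers, each with
unboundedly many cells, and a tape of random coins. The name of an array is a constant of the
program, the index in the array is computed. The unit-cost operations on naturals are addition and
truncated subtraction; those on reals are addition, subtraction, comparison and rounding down to a
multiple of another real. There is no multiplication, and reals influence the naturals only through
comparisons. In `t` steps numbers grow by a factor of at most `2^O(t)`, and on multiples of a
common denominator all real operations return such multiples, so unit cost hides no more than a
polynomial amount of bit operations when the real data are rational. -/

/-- The memory of the machine. -/
structure MachineState where
  nat : ℕ → ℕ → ℕ
  real : ℕ → ℕ → ℝ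
  coins : List Bool

/-- Expressions for natural numbers; `cell a e` is the cell number `e` of the array `a`. -/
inductive NatExpr where
  | const (c : ℕ)
  | cell (a : ℕ) (e : NatExpr)
  | add (e₁ e₂ : NatExpr)
  | sub (e₁ e₂ : NatExpr)

/-- Expressions for real numbers. -/
inductive RealExpr where
  | zero
  | one
  | cell (a : ℕ) (e : NatExpr)
  | add (r₁ r₂ : RealExpr)
  | sub (r₁ r₂ : RealExpr)
  | roundDown (r₁ r₂ : RealExpr)

/-- Tests. -/
inductive TestExpr where
  | natLt (e₁ e₂ : NatExpr)
  | realLt (r₁ r₂ : RealExpr)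
  | not (b : TestExpr)
  | and (b₁ b₂ : TestExpr)

def NatExpr.eval (s : MachineState) : NatExpr → ℕ
  | const c => c
  | cell a e => s.nat a (e.eval s)
  | add e₁ e₂ => e₁.eval s + e₂.eval s
  | sub e₁ e₂ => e₁.eval s - e₂.eval s

/-- The number of steps that the evaluation takes. -/
def NatExpr.cost : NatExpr → ℕ
  | const _ => 1
  | cell _ e => e.cost + 1
  | add e₁ e₂ => e₁.cost + e₂.cost + 1
  | sub e₁ e₂ => e₁.cost + e₂.cost + 1

/-- `roundDown x y` is the largest integral multiple of `y` that is at most `x`, for `y > 0`. -/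
def RealExpr.eval (s : MachineState) : RealExpr → ℝ
  | zero => 0
  | one => 1
  | cell a e => s.real a (e.eval s)
  | add r₁ r₂ => r₁.eval s + r₂.eval s
  | sub r₁ r₂ => r₁.eval s - r₂.eval s
  | roundDown r₁ r₂ => (⌊r₁.eval s / r₂.eval s⌋ : ℝ) * r₂.eval s

def RealExpr.cost : RealExpr → ℕ
  | zero => 1
  | one => 1
  | cell _ e => e.cost + 1
  | add r₁ r₂ => r₁.cost + r₂.cost + 1
  | sub r₁ r₂ => r₁.cost + r₂.cost + 1
  | roundDown r₁ r₂ => r₁.cost + r₂.cost + 1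

def TestExpr.Holds (s : MachineState) : TestExpr → Prop
  | natLt e₁ e₂ => e₁.eval s < e₂.eval s
  | realLt r₁ r₂ => r₁.eval s < r₂.eval s
  | not b => ¬ b.Holds s
  | and b₁ b₂ => b₁.Holds s ∧ b₂.Holds s

def TestExpr.cost : TestExpr → ℕ
  | natLt e₁ e₂ => e₁.cost + e₂.cost + 1
  | realLt r₁ r₂ => r₁.cost + r₂.cost + 1
  | not b => b.cost + 1
  | and b₁ b₂ => b₁.cost + b₂.cost + 1

/-- Write `v` into the cell `i` of the array `a` of naturals. -/
def MachineState.setNat (s : MachineState) (a i v : ℕ) : MachineState :=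
  { s with nat := Function.update s.nat a (Function.update (s.nat a) i v) }

/-- Write `v` into the cell `i` of the array `a` of reals. -/
def MachineState.setReal (s : MachineState) (a i : ℕ) (v : ℝ) : MachineState :=
  { s with real := Function.update s.real a (Function.update (s.real a) i v) }

/-- Programs; `toss a e` writes the next random coin into the cell `e` of the array `a`. -/
inductive Prog where
  | skip
  | natSet (a : ℕ) (i e : NatExpr)
  | realSet (a : ℕ) (i : NatExpr) (r : RealExpr)
  | toss (a : ℕ) (i : NatExpr)
  | seq (c₁ c₂ : Prog)
  | cond (b : TestExpr) (c₁ c₂ : Prog)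
  | loop (b : TestExpr) (c : Prog)

/-- `Exec c s t s'`: started in `s`, the program `c` halts after `t` steps in `s'`. A program that
wants to toss a coin when the tape is used up does not halt. -/
inductive Exec : Prog → MachineState → ℕ → MachineState → Prop
  | skip (s : MachineState) : Exec .skip s 1 s
  | natSet (a : ℕ) (i e : NatExpr) (s : MachineState) :
      Exec (.natSet a i e) s (i.cost + e.cost + 1) (s.setNat a (i.eval s) (e.eval s))
  | realSet (a : ℕ) (i : NatExpr) (r : RealExpr) (s : MachineState) :
      Exec (.realSet a i r) s (i.cost + r.cost + 1) (s.setReal a (i.eval s) (r.eval s))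
  | toss (a : ℕ) (i : NatExpr) (s : MachineState) (b : Bool) (l : List Bool)
      (h : s.coins = b :: l) :
      Exec (.toss a i) s (i.cost + 1) { s.setNat a (i.eval s) b.toNat with coins := l }
  | seq {c₁ c₂ : Prog} {s s₁ s₂ : MachineState} {t₁ t₂ : ℕ}
      (h₁ : Exec c₁ s t₁ s₁) (h₂ : Exec c₂ s₁ t₂ s₂) : Exec (.seq c₁ c₂) s (t₁ + t₂) s₂
  | condTrue {b : TestExpr} {c₁ c₂ : Prog} {s s' : MachineState} {t : ℕ}
      (hb : b.Holds s) (h : Exec c₁ s t s') : Exec (.cond b c₁ c₂) s (b.cost + t) s'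
  | condFalse {b : TestExpr} {c₁ c₂ : Prog} {s s' : MachineState} {t : ℕ}
      (hb : ¬ b.Holds s) (h : Exec c₂ s t s') : Exec (.cond b c₁ c₂) s (b.cost + t) s'
  | loopDone {b : TestExpr} {c : Prog} {s : MachineState}
      (hb : ¬ b.Holds s) : Exec (.loop b c) s b.cost s
  | loopStep {b : TestExpr} {c : Prog} {s s₁ s₂ : MachineState} {t₁ t₂ : ℕ}
      (hb : b.Holds s) (h₁ : Exec c s t₁ s₁) (h₂ : Exec (.loop b c) s₁ t₂ s₂) :
      Exec (.loop b c) s (b.cost + t₁ + t₂) s₂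

/-! ### Stewards as programs -/

/-- A one-query steward as a program: `init` is run once, `ask` in every round before the query and
`reply` in every round after the query. The memory persists. -/
structure StewardProgram where
  init : Prog
  ask : Prog
  reply : Prog

/-- Initially the numbers `n, k, d` are in the array `0` of naturals, the numbers `ε, γ` in the
array `0` of reals, and all other cells are zero. -/
def initialState {m : ℕ} (n k d : ℕ) (ε γ : ℝ) (x : Bits m) : MachineState where
  nat a i := if a = 0 then [n, k, d].getD i 0 else 0
  real a i := if a = 0 then [ε, γ].getD i 0 else 0
  coins := List.ofFn x

namespace MachineState

/-- The query point is read off the array `1` of naturals. -/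
def queryPoint (s : MachineState) (n : ℕ) : Bits n :=
  fun j => decide (s.nat 1 j ≠ 0)

/-- The response to the query is written into the first `d` cells of the array `1` of reals. -/
def receive {d : ℕ} (s : MachineState) (W : Vec d) : MachineState :=
  ⟨s.nat,
    Function.update s.real 1 (fun j => if h : j < d then W ⟨j, h⟩ else s.real 1 j),
    s.coins⟩

/-- The output is read off the array `2` of reals. -/
def outputVec (s : MachineState) (d : ℕ) : Vec d :=
  fun j => s.real 2 j

end MachineState

/-- `Rounds P s Ws out t`: from the state `s` the program goes through one round for each entry of
`Ws`, these being the responses to its queries; `out` is the list of the pairs of query point and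
output; and the rounds take `t` steps in total, including `n + d` steps for each query and `d` steps
for each output. -/
inductive Rounds (P : StewardProgram) {n d : ℕ} :
    MachineState → List (Vec d) → List (Bits n × Vec d) → ℕ → Prop
  | nil (s : MachineState) : Rounds P s [] [] 0
  | cons {s s₁ s₂ : MachineState} {W : Vec d} {Ws : List (Vec d)} {out : List (Bits n × Vec d)}
      {t₁ t₂ t : ℕ}
      (h₁ : Exec P.ask s t₁ s₁) (h₂ : Exec P.reply (s₁.receive W) t₂ s₂)
      (h : Rounds P s₂ Ws out t) :
      Rounds P s (W :: Ws) ((s₁.queryPoint n, s₂.outputVec d) :: out)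
        (t₁ + (n + d) + t₂ + d + t)

/-- On the parameters `n, k, d, ε, γ`, for all coins and all responses to the queries, the program
`P` carries out the strategy `S` for `k` rounds, in at most `T` steps altogether (and tossing at
most the `m` coins of the strategy). -/
def StewardProgram.Implements (P : StewardProgram) {n d m : ℕ} (k : ℕ) (ε γ : ℝ)
    (S : OneQuerySteward n d m) (T : ℝ) : Prop :=
  ∀ (x : Bits m) (Ws : List (Vec d)), Ws.length = k →
    ∃ (s : MachineState) (t₀ t : ℕ) (out : List (Bits n × Vec d)),
      Exec P.init (initialState n k d ε γ x) t₀ s ∧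
      Rounds P s Ws out t ∧
      (∀ i < k, out[i]? = some (S.query x (Ws.take i), S.output x (Ws.take (i + 1)))) ∧
      ((t₀ + t : ℕ) : ℝ) ≤ T

end

/-! With fresh query points the steward would need `k * n` coins. Two ideas bring this down to one
point plus about `log (d + 1)` coins per round.

The first is rounding. Every response is moved by one of the `d + 1` shifts `Δ * 4ε` and then
rounded down coordinatewise to a grid of side `4(d + 1)ε`. Each coordinate can spoil at most one
shift, so some shift keeps every coordinate away from the grid (`Rounding.exists_good`). With such a
shift all points within `ε` of the response round alike, so a response near `μ` yields an output
that depends only on `μ` and the shift number (`Rounding.roundVec_eq_center`). As long as no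
response is far off, a deterministic owner therefore learns one letter of an alphabet of size `d +
1` per round, and the interaction is a walk down a decision tree with that branching whose nodes
each read one block of `n` bits (`Inw.interact_of_run_eq_some`). On independent uniform blocks the
tree fails with probability at most `k * δ`.

The second is a generator of Impagliazzo, Nisan and Wigderson that fools such trees. A seed for `2 ^
(j + 1)` blocks is a seed for `2 ^ j` blocks together with the instructions of a walk on an
expander; the halves of the output are expanded from the two ends of the walk. By the mixing lemma a
walk of length `4608 * c` has nearly independent ends, with error `2 ^ (-c)` for each pair of
events. A union over all words that the tree can return multiplies this by `(d + 1) ^ 2 ^ (j + 1)`,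
so `c j = 2 ^ (j + 1) * a + J + L` with `2 ^ a ≥ d + 1`, `2 ^ J ≥ k`, `2 ^ L ≥ 1 / γ` gives total
error at most `γ` (`Inw.sum_abs_probGen_sub_probUnif_le`, `Inw.err_le`). The sum of the `c j` over
`j < J` is of order `k log (d + 1) + J (J + L)`, and the `J ^ 2` is absorbed by `k`.

The expander has to be explicit and computable with additions alone: on `(ℤ/N)²` with `N` a power of
two, the generators are the identity, a translation and the two shears. Its spectral gap
(`Torus.sum_norm_sq_le_of_sum_eq_zero`) comes from Fourier analysis: near invariance under
translations concentrates the transform in a box around the origin, where shears act as over `ℤ²`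
and push mass apart, so that no weight vanishing at the origin can be nearly invariant.

The remainder is a program logic with time bounds, applied to a program that descends the
generator's recursion for each query and tries the shifts in turn for each output. -/

noncomputable section

/-! ### An expander on `(ℤ/N)²` -/

/-- The discrete torus `(ℤ/N)²`. -/
abbrev Torus (N : ℕ) : Type := ZMod N × ZMod N

namespace Torus

open Finset ZMod

variable {N : ℕ}

/-- The translation `(x, y) ↦ (x + 1, y)`. -/
def shift : Torus N ≃ Torus N where
  toFun v := (v.1 + 1, v.2)
  invFun v := (v.1 - 1, v.2)
  left_inv v := by simp
  right_inv v := by simp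

/-- The shear `(x, y) ↦ (x + y, y)`. -/
def shearX : Torus N ≃ Torus N where
  toFun v := (v.1 + v.2, v.2)
  invFun v := (v.1 - v.2, v.2)
  left_inv v := by simp
  right_inv v := by simp

/-- The shear `(x, y) ↦ (x, x + y)`. -/
def shearY : Torus N ≃ Torus N where
  toFun v := (v.1, v.1 + v.2)
  invFun v := (v.1, v.2 - v.1)
  left_inv v := by simp
  right_inv v := by simp

/-- The translation `(x, y) ↦ (x, y + 1)`. -/
def shiftY : Torus N ≃ Torus N where
  toFun v := (v.1, v.2 + 1)
  invFun v := (v.1, v.2 - 1)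
  left_inv v := by simp
  right_inv v := by simp

/-- The images of `E` under the two maps are disjoint subsets of `Q`. This is the expansion
mechanism: two maps that both send `E` into `Q` without overlapping force `Q` to hold about twice
the mass of `E` once `ρ` is nearly invariant. -/
lemma sum_two_images_le {α : Type*} [DecidableEq α] {ρ : α → ℝ} (hρ : ∀ z, 0 ≤ ρ z)
    {E Q : Finset α} (φ ψ : α ≃ α) (hφ : ∀ z ∈ E, φ z ∈ Q) (hψ : ∀ z ∈ E, ψ z ∈ Q)
    (hd : ∀ y ∈ E, ∀ z ∈ E, φ y ≠ ψ z) :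
    ∑ z ∈ E, ρ (φ z) + ∑ z ∈ E, ρ (ψ z) ≤ ∑ z ∈ Q, ρ z := by
  have hdis : Disjoint (E.map φ.toEmbedding) (E.map ψ.toEmbedding) := by
    rw [Finset.disjoint_left]
    intro x hx hx'
    simp only [Finset.mem_map, Equiv.coe_toEmbedding] at hx hx'
    obtain ⟨y, hy, rfl⟩ := hx
    obtain ⟨z, hz, h⟩ := hx'
    exact hd y hy z hz h.symm
  have := Finset.sum_union (f := ρ) hdis
  simp only [Finset.sum_map, Equiv.coe_toEmbedding] at this
  rw [← this]
  apply Finset.sum_le_sum_of_subset_of_nonneg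
  · intro x hx
    simp only [Finset.mem_union, Finset.mem_map, Equiv.coe_toEmbedding] at hx
    rcases hx with ⟨y, hy, rfl⟩ | ⟨y, hy, rfl⟩
    · exact hφ y hy
    · exact hψ y hy
  · intro i _ _
    exact hρ i

/-- Factor the difference of squares and apply Cauchy–Schwarz: the differences have norm at most `κ
√M` and the sums at most `2 √M`, where `M` is the total mass. So near invariance of `w` in the
square mean makes the measure `w ^ 2` nearly invariant on every set. -/
lemma sum_sq_comp_ge {α : Type*} [Fintype α] {w : α → ℝ}
    (φ : α ≃ α) {κ : ℝ} (hκ : 0 ≤ κ)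
    (h : ∑ z, (w (φ z) - w z) ^ 2 ≤ κ ^ 2 * ∑ z, w z ^ 2) (E : Finset α) :
    ∑ z ∈ E, w z ^ 2 - 2 * κ * ∑ z, w z ^ 2 ≤ ∑ z ∈ E, w (φ z) ^ 2 := by
  set M := ∑ z, w z ^ 2 with hM
  have hM0 : 0 ≤ M := Finset.sum_nonneg fun _ _ => sq_nonneg _
  have hMφ : ∑ z, w (φ z) ^ 2 = M := Equiv.sum_comp φ fun z => w z ^ 2
  have h1 : (∑ z ∈ E, (w (φ z) - w z) * (w (φ z) + w z)) ^ 2 ≤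
      (∑ z ∈ E, (w (φ z) - w z) ^ 2) * ∑ z ∈ E, (w (φ z) + w z) ^ 2 :=
    Finset.sum_mul_sq_le_sq_mul_sq _ _ _
  have h2 : ∑ z ∈ E, (w (φ z) - w z) ^ 2 ≤ κ ^ 2 * M :=
    (Finset.sum_le_univ_sum_of_nonneg fun _ => sq_nonneg _).trans h
  have h3 : ∑ z ∈ E, (w (φ z) + w z) ^ 2 ≤ 4 * M := by
    calc ∑ z ∈ E, (w (φ z) + w z) ^ 2 ≤ ∑ z, (w (φ z) + w z) ^ 2 :=
          Finset.sum_le_univ_sum_of_nonneg fun _ => sq_nonneg _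
      _ ≤ ∑ z, (2 * w (φ z) ^ 2 + 2 * w z ^ 2) :=
          Finset.sum_le_sum fun z _ => by nlinarith [sq_nonneg (w (φ z) - w z)]
      _ = 4 * M := by
          rw [Finset.sum_add_distrib, ← Finset.mul_sum, ← Finset.mul_sum, hMφ]; ring
  have h4 : (∑ z ∈ E, (w (φ z) - w z) * (w (φ z) + w z)) ^ 2 ≤ (2 * κ * M) ^ 2 := by
    refine h1.trans ((mul_le_mul h2 h3 (Finset.sum_nonneg fun _ _ => sq_nonneg _)
      (by positivity)).trans (le_of_eq (by ring)))
  have h5 := (abs_le_of_sq_le_sq' h4 (by positivity)).1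
  have h6 : ∑ z ∈ E, (w (φ z) - w z) * (w (φ z) + w z) =
      ∑ z ∈ E, w (φ z) ^ 2 - ∑ z ∈ E, w z ^ 2 := by
    rw [← Finset.sum_sub_distrib]
    exact Finset.sum_congr rfl fun _ _ => by ring
  linarith

/-- Two representatives below `N / 4` in absolute value have a sum below `N / 2`, so nothing wraps
around; inside the box the shears act as on `ℤ²`. -/
lemma valMinAbs_add_of_small [NeZero N] {x y : ZMod N} (hx : 4 * |x.valMinAbs| < N)
    (hy : 4 * |y.valMinAbs| < N) : (x + y).valMinAbs = x.valMinAbs + y.valMinAbs := by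
  rw [ZMod.valMinAbs_spec]
  refine ⟨by simp, ?_⟩
  have hx1 := neg_abs_le x.valMinAbs
  have hx2 := le_abs_self x.valMinAbs
  have hy1 := neg_abs_le y.valMinAbs
  have hy2 := le_abs_self y.valMinAbs
  constructor <;> linarith

lemma valMinAbs_sub_of_small [NeZero N] {x y : ZMod N} (hx : 4 * |x.valMinAbs| < N)
    (hy : 4 * |y.valMinAbs| < N) : (x - y).valMinAbs = x.valMinAbs - y.valMinAbs := by
  rw [ZMod.valMinAbs_spec]
  refine ⟨by simp, ?_⟩
  have hx1 := neg_abs_le x.valMinAbs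
  have hx2 := le_abs_self x.valMinAbs
  have hy1 := neg_abs_le y.valMinAbs
  have hy2 := le_abs_self y.valMinAbs
  constructor <;> linarith

/-- A weight on the torus that vanishes at the origin and is nearly invariant under both shears
has a large part of its mass outside the box of side `N / 2`. -/
lemma mass_outside_box [NeZero N] {w : Torus N → ℝ} (h0 : w 0 = 0) {κ : ℝ} (hκ : 0 ≤ κ)
    (hX : ∑ z, (w (shearX z) - w z) ^ 2 ≤ κ ^ 2 * ∑ z, w z ^ 2)
    (hY : ∑ z, (w (shearY z) - w z) ^ 2 ≤ κ ^ 2 * ∑ z, w z ^ 2)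
    (Bx By : Finset (Torus N)) (hBx : ∀ z, z ∉ Bx → 4 * |z.1.valMinAbs| < N)
    (hBy : ∀ z, z ∉ By → 4 * |z.2.valMinAbs| < N) :
    (1 - 8 * κ) * ∑ z, w z ^ 2 ≤ 4 * (∑ z ∈ Bx, w z ^ 2 + ∑ z ∈ By, w z ^ 2) := by
  classical
  have hinv (φ : Torus N ≃ Torus N) (h : ∑ z, (w (φ z) - w z) ^ 2 ≤ κ ^ 2 * ∑ z, w z ^ 2) :
      ∑ z, (w (φ.symm z) - w z) ^ 2 ≤ κ ^ 2 * ∑ z, w z ^ 2 := by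
    rw [← Equiv.sum_comp φ]
    refine le_trans (le_of_eq ?_) h
    exact Finset.sum_congr rfl fun z _ => by rw [Equiv.symm_apply_apply]; ring
  set ρ : Torus N → ℝ := fun z => w z ^ 2 with hρ
  have hρ0 (z) : 0 ≤ ρ z := sq_nonneg _
  set M := ∑ z, ρ z
  set β := ∑ z ∈ Bx, ρ z + ∑ z ∈ By, ρ z
  -- Let `E` be the part of `Q` inside the box. Two disjoint images in `Q` give `2 ρ(E) - 4 κ M ≤
  -- ρ(Q)`, while `ρ(Q) ≤ ρ(E) + β`; eliminating `ρ(E)` leaves the bound.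
  have key (Q : Finset (Torus N)) (φ ψ : Torus N ≃ Torus N)
      (hφ : ∑ z, (w (φ z) - w z) ^ 2 ≤ κ ^ 2 * M) (hψ : ∑ z, (w (ψ z) - w z) ^ 2 ≤ κ ^ 2 * M)
      (hφQ : ∀ z ∈ Q, z ∉ Bx → z ∉ By → φ z ∈ Q) (hψQ : ∀ z ∈ Q, z ∉ Bx → z ∉ By → ψ z ∈ Q)
      (hd : ∀ y ∈ Q, y ∉ Bx → y ∉ By → ∀ z ∈ Q, z ∉ Bx → z ∉ By → φ y ≠ ψ z) :
      ∑ z ∈ Q, ρ z ≤ 2 * β + 4 * κ * M := by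
    set E := Q.filter fun z => z ∉ Bx ∧ z ∉ By with hE
    have h1 := sum_two_images_le (ρ := ρ) hρ0 (E := E) (Q := Q) φ ψ
      (by simp only [hE, mem_filter]; exact fun z hz => hφQ z hz.1 hz.2.1 hz.2.2)
      (by simp only [hE, mem_filter]; exact fun z hz => hψQ z hz.1 hz.2.1 hz.2.2)
      (by simp only [hE, mem_filter]
          exact fun y hy z hz => hd y hy.1 hy.2.1 hy.2.2 z hz.1 hz.2.1 hz.2.2)
    have h2 := sum_sq_comp_ge φ hκ hφ E
    have h3 := sum_sq_comp_ge ψ hκ hψ E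
    have h4 : ∑ z ∈ Q, ρ z ≤ ∑ z ∈ E, ρ z + β := by
      calc ∑ z ∈ Q, ρ z ≤ ∑ z ∈ E ∪ (Bx ∪ By), ρ z := by
            apply Finset.sum_le_sum_of_subset_of_nonneg
            · intro z hz
              simp only [hE, mem_union, mem_filter]
              tauto
            · exact fun z _ _ => hρ0 z
        _ ≤ ∑ z ∈ E, ρ z + ∑ z ∈ Bx ∪ By, ρ z := by
            rw [← Finset.sum_union_inter]
            linarith [Finset.sum_nonneg (s := E ∩ (Bx ∪ By)) fun z _ => hρ0 z]
        _ ≤ _ := by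
            have := Finset.sum_union_inter (s₁ := Bx) (s₂ := By) (f := ρ)
            have := Finset.sum_nonneg (s := Bx ∩ By) fun z _ => hρ0 z
            simp only [β]
            linarith
    simp only [hρ] at *
    linarith
  -- On the first and third quadrants both shears increase absolute values and stay in the
  -- quadrants. Afterwards `|x| > |y|` for `shearX` and `|x| ≤ |y|` for `shearY`, whence
  -- disjointness. The half-open boundaries are chosen so that the four quadrants cover everything
  -- except the origin.
  have k1 := key (univ.filter fun z => (0 < z.1.valMinAbs ∧ 0 ≤ z.2.valMinAbs) ∨
      (z.1.valMinAbs < 0 ∧ z.2.valMinAbs ≤ 0)) shearX shearY hX hY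
    (by
      simp only [mem_filter, mem_univ, true_and, shearX, Equiv.coe_fn_mk]
      intro z hz hx hy
      rw [valMinAbs_add_of_small (hBx z hx) (hBy z hy)]
      omega)
    (by
      simp only [mem_filter, mem_univ, true_and, shearY, Equiv.coe_fn_mk]
      intro z hz hx hy
      rw [valMinAbs_add_of_small (hBx z hx) (hBy z hy)]
      omega)
    (by
      simp only [mem_filter, mem_univ, true_and, shearX, shearY, Equiv.coe_fn_mk, ne_eq,
        Prod.mk.injEq]
      intro y hy hyx hyy z hz hzx hzy h
      have e1 := congrArg ZMod.valMinAbs h.1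
      have e2 := congrArg ZMod.valMinAbs h.2
      rw [valMinAbs_add_of_small (hBx y hyx) (hBy y hyy)] at e1
      rw [valMinAbs_add_of_small (hBx z hzx) (hBy z hzy)] at e2
      omega)
  -- On the other two quadrants the signs differ, so the inverse shears play the same role.
  have k2 := key (univ.filter fun z => (z.1.valMinAbs ≤ 0 ∧ 0 < z.2.valMinAbs) ∨
      (0 ≤ z.1.valMinAbs ∧ z.2.valMinAbs < 0)) shearX.symm shearY.symm (hinv _ hX) (hinv _ hY)
    (by
      simp only [mem_filter, mem_univ, true_and, shearX, Equiv.coe_fn_symm_mk]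
      intro z hz hx hy
      rw [valMinAbs_sub_of_small (hBx z hx) (hBy z hy)]
      omega)
    (by
      simp only [mem_filter, mem_univ, true_and, shearY, Equiv.coe_fn_symm_mk]
      intro z hz hx hy
      rw [valMinAbs_sub_of_small (hBy z hy) (hBx z hx)]
      omega)
    (by
      simp only [mem_filter, mem_univ, true_and, shearX, shearY, Equiv.coe_fn_symm_mk, ne_eq,
        Prod.mk.injEq]
      intro y hy hyx hyy z hz hzx hzy h
      have e1 := congrArg ZMod.valMinAbs h.1
      have e2 := congrArg ZMod.valMinAbs h.2
      rw [valMinAbs_sub_of_small (hBx y hyx) (hBy y hyy)] at e1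
      rw [valMinAbs_sub_of_small (hBy z hzy) (hBx z hzx)] at e2
      omega)
  have hcover : M ≤ (∑ z ∈ univ.filter fun z : Torus N =>
      (0 < z.1.valMinAbs ∧ 0 ≤ z.2.valMinAbs) ∨ (z.1.valMinAbs < 0 ∧ z.2.valMinAbs ≤ 0), ρ z) +
      ∑ z ∈ univ.filter fun z : Torus N =>
      (z.1.valMinAbs ≤ 0 ∧ 0 < z.2.valMinAbs) ∨ (0 ≤ z.1.valMinAbs ∧ z.2.valMinAbs < 0), ρ z := by
    rw [Finset.sum_filter, Finset.sum_filter, ← Finset.sum_add_distrib]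
    refine Finset.sum_le_sum fun z _ => ?_
    by_cases hz : z = 0
    · have : ρ z = 0 := by simp [hρ, hz, h0]
      rw [this]; simp
    · have hne : z.1.valMinAbs ≠ 0 ∨ z.2.valMinAbs ≠ 0 := by
        by_contra hcon
        push Not at hcon
        exact hz (Prod.ext ((ZMod.valMinAbs_eq_zero _).1 hcon.1)
          ((ZMod.valMinAbs_eq_zero _).1 hcon.2))
      have := hρ0 z
      split_ifs <;> first | linarith | omega
  linarith

/-! ### Fourier analysis on the torus and the spectral gap -/

/-- The Fourier transform on the torus. -/
def fourier [NeZero N] (f : Torus N → ℂ) (z : Torus N) : ℂ :=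
  ∑ v, f v * stdAddChar (z.1 * v.1 + z.2 * v.2)

/-- Orthogonality of characters, one coordinate at a time. -/
lemma sum_stdAddChar [NeZero N] (b : Torus N) :
    ∑ z : Torus N, stdAddChar (z.1 * b.1 + z.2 * b.2) = if b = 0 then (N : ℂ) ^ 2 else 0 := by
  have h (b : ZMod N) := AddChar.sum_mulShift b (isPrimitive_stdAddChar N)
  simp_rw [Fintype.sum_prod_type, AddChar.map_add_eq_mul]
  rw [← Finset.sum_mul_sum, h, h, ZMod.card]
  simp only [Prod.ext_iff, Prod.fst_zero, Prod.snd_zero]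
  split_ifs <;> simp_all [sq]

/-- Parseval's identity, from expanding the square and orthogonality of characters. -/
lemma sum_norm_sq_fourier [NeZero N] (f : Torus N → ℂ) :
    ∑ z, ‖fourier f z‖ ^ 2 = (N : ℝ) ^ 2 * ∑ v, ‖f v‖ ^ 2 := by
  have : ∑ z, (‖fourier f z‖ ^ 2 : ℂ) = (N : ℂ) ^ 2 * ∑ v, (‖f v‖ ^ 2 : ℂ) := by
    simp_rw [← Complex.mul_conj', fourier, map_sum, map_mul, ← AddChar.map_neg_eq_conj,
      Finset.sum_mul_sum]
    rw [Finset.sum_comm]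
    have h (v w : Torus N) : ∑ z : Torus N, f v * stdAddChar (z.1 * v.1 + z.2 * v.2) *
        ((starRingEnd ℂ) (f w) * stdAddChar (-(z.1 * w.1 + z.2 * w.2))) =
        if v = w then (N : ℂ) ^ 2 * (f v * (starRingEnd ℂ) (f v)) else 0 := by
      have := sum_stdAddChar (v - w)
      simp only [sub_eq_zero] at this
      trans f v * (starRingEnd ℂ) (f w) * ∑ z : Torus N,
          stdAddChar (z.1 * (v - w).1 + z.2 * (v - w).2)
      · rw [Finset.mul_sum]
        refine Finset.sum_congr rfl fun z _ => ?_
        rw [mul_mul_mul_comm, ← AddChar.map_add_eq_mul]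
        congr 2
        simp only [Prod.fst_sub, Prod.snd_sub]
        ring
      · rw [this]
        split_ifs with h
        · subst h; ring
        · simp
    rw [Finset.mul_sum]
    refine Finset.sum_congr rfl fun v _ => ?_
    rw [Finset.sum_comm]
    simp_rw [h]
    simp
  exact_mod_cast this

lemma fourier_sub [NeZero N] (f g : Torus N → ℂ) (z : Torus N) :
    fourier (fun v => f v - g v) z = fourier f z - fourier g z := by
  simp only [fourier, sub_mul, Finset.sum_sub_distrib]

lemma fourier_shift [NeZero N] (f : Torus N → ℂ) (z : Torus N) :
    fourier (fun v => f (shift v)) z = fourier f z * stdAddChar (-z.1) := by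
  unfold fourier
  rw [← Equiv.sum_comp shift.symm, Finset.sum_mul]
  refine Finset.sum_congr rfl fun v _ => ?_
  simp only [Equiv.apply_symm_apply]
  rw [mul_assoc, ← AddChar.map_add_eq_mul]
  congr 2
  simp only [shift, Equiv.coe_fn_symm_mk]
  ring

lemma fourier_shiftY [NeZero N] (f : Torus N → ℂ) (z : Torus N) :
    fourier (fun v => f (shiftY v)) z = fourier f z * stdAddChar (-z.2) := by
  unfold fourier
  rw [← Equiv.sum_comp shiftY.symm, Finset.sum_mul]
  refine Finset.sum_congr rfl fun v _ => ?_
  simp only [Equiv.apply_symm_apply]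
  rw [mul_assoc, ← AddChar.map_add_eq_mul]
  congr 2
  simp only [shiftY, Equiv.coe_fn_symm_mk]
  ring

/-- The transform turns a linear change of variables into the inverse transpose, and transposition
exchanges the two shears. -/
lemma fourier_shearX [NeZero N] (f : Torus N → ℂ) (z : Torus N) :
    fourier (fun v => f (shearX v)) z = fourier f (shearY.symm z) := by
  unfold fourier
  rw [← Equiv.sum_comp shearX.symm]
  refine Finset.sum_congr rfl fun v _ => ?_
  simp only [Equiv.apply_symm_apply]
  congr 2
  simp only [shearX, shearY, Equiv.coe_fn_symm_mk]
  ring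

lemma fourier_shearY [NeZero N] (f : Torus N → ℂ) (z : Torus N) :
    fourier (fun v => f (shearY v)) z = fourier f (shearX.symm z) := by
  unfold fourier
  rw [← Equiv.sum_comp shearY.symm]
  refine Finset.sum_congr rfl fun v _ => ?_
  simp only [Equiv.apply_symm_apply]
  congr 2
  simp only [shearX, shearY, Equiv.coe_fn_symm_mk]
  ring

/-- The character value is `exp (iθ)` with `π / 2 ≤ |θ| ≤ π`, so `|exp (iθ) - 1| ^ 2 = 2 - 2 cos θ`
with a nonpositive cosine. -/
lemma two_le_norm_stdAddChar_sub_one_sq [NeZero N] (x : ZMod N) (hx : ¬ 4 * |x.valMinAbs| < N) :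
    2 ≤ ‖stdAddChar (-x) - 1‖ ^ 2 := by
  have hN : (0 : ℝ) < N := by exact_mod_cast NeZero.pos N
  set j : ℤ := x.valMinAbs with hj
  set θ : ℝ := 2 * Real.pi * (-j : ℤ) / N with hθ
  have hval : stdAddChar (-x) = Complex.exp (θ * Complex.I) := by
    have : (-x) = ((-j : ℤ) : ZMod N) := by rw [Int.cast_neg, hj, ZMod.coe_valMinAbs]
    rw [this, stdAddChar_coe]
    congr 1
    rw [hθ]
    push_cast
    ring
  have hle : 2 * |j| ≤ N := by
    have := x.valMinAbs_mem_Ioc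
    simp only [Set.mem_Ioc] at this
    rw [abs_eq_max_neg]
    omega
  have hle' : (2 * |(j : ℝ)| : ℝ) ≤ N := by exact_mod_cast hle
  have hge' : (N : ℝ) ≤ 4 * |(j : ℝ)| := by exact_mod_cast not_lt.1 hx
  have habs : |θ| = 2 * Real.pi * |(j : ℝ)| / N := by
    rw [hθ, abs_div, abs_mul, abs_of_pos hN, abs_of_pos (by positivity)]
    simp
  have hcos : Real.cos θ ≤ 0 := by
    rw [← Real.cos_abs, habs]
    apply Real.cos_nonpos_of_pi_div_two_le_of_le
    · rw [le_div_iff₀ hN]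
      nlinarith [Real.pi_pos]
    · rw [div_le_iff₀ hN]
      nlinarith [Real.pi_pos]
  rw [hval, Complex.exp_mul_I, ← Complex.ofReal_cos, ← Complex.ofReal_sin,
    ← Complex.normSq_eq_norm_sq, Complex.normSq_apply]
  simp only [Complex.sub_re, Complex.add_re, Complex.ofReal_re, Complex.mul_re, Complex.I_re,
    Complex.ofReal_im, Complex.I_im, Complex.one_re, Complex.sub_im, Complex.add_im,
    Complex.mul_im, Complex.one_im]
  nlinarith [Real.sin_sq_add_cos_sq θ]

/-- A function that is nearly invariant under a translation has little Fourier mass at frequencies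
where the translation's character is far from `1`. `D` bounds how far the translation moves the
transform. -/
lemma sum_norm_sq_bad_le [NeZero N] (f : Torus N → ℂ) (c : Torus N → ZMod N) (D : ℝ)
    (hD : ∑ z, ‖fourier f z * stdAddChar (-c z) - fourier f z‖ ^ 2 ≤ D) :
    ∑ z ∈ univ.filter (fun z : Torus N => ¬ 4 * |(c z).valMinAbs| < N), ‖fourier f z‖ ^ 2 ≤
      D / 2 := by
  rw [le_div_iff₀ two_pos, Finset.sum_mul]
  refine le_trans ?_ hD
  refine le_trans (Finset.sum_le_sum fun z hz => ?_)
    (Finset.sum_le_univ_sum_of_nonneg fun z => sq_nonneg _)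
  · have h2 := two_le_norm_stdAddChar_sub_one_sq (c z) (Finset.mem_filter.1 hz).2
    have : fourier f z * stdAddChar (-c z) - fourier f z =
      fourier f z * (stdAddChar (-c z) - 1) := by ring
    rw [this, norm_mul, mul_pow]
    exact mul_le_mul_of_nonneg_left h2 (sq_nonneg _)

/-- The second translation is the commutator `shearY ∘ shift ∘ shearY⁻¹ ∘ shift⁻¹`. Passing from `v`
to `shiftY v` thus takes four moves, each of energy at most `D`, and squaring a sum of four terms
costs another factor `4`. -/
lemma sum_norm_sq_shiftY_sub_le [NeZero N] (f : Torus N → ℂ) {D : ℝ}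
    (ha : ∑ v, ‖f (shift v) - f v‖ ^ 2 ≤ D) (hY : ∑ v, ‖f (shearY v) - f v‖ ^ 2 ≤ D) :
    ∑ v, ‖f (shiftY v) - f v‖ ^ 2 ≤ 16 * D := by
  have key (v : Torus N) : ‖f (shiftY v) - f v‖ ^ 2 ≤
      4 * (‖f (shearY (shearY.symm v)) - f (shearY.symm v)‖ ^ 2 +
        ‖f (shift (shearY.symm v)) - f (shearY.symm v)‖ ^ 2 +
        ‖f (shearY (shift (shearY.symm v))) - f (shift (shearY.symm v))‖ ^ 2 +
        ‖f (shift (shiftY v)) - f (shiftY v)‖ ^ 2) := by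
    have e : shearY (shift (shearY.symm v)) = shift (shiftY v) := by
      simp only [shearY, shift, shiftY, Equiv.coe_fn_mk, Equiv.coe_fn_symm_mk, Prod.mk.injEq,
        true_and]
      ring
    rw [e]
    set p := f (shearY (shearY.symm v)) - f (shearY.symm v) with hp
    set q := f (shift (shearY.symm v)) - f (shearY.symm v) with hq
    set r := f (shift (shiftY v)) - f (shift (shearY.symm v)) with hr
    set s := f (shift (shiftY v)) - f (shiftY v) with hs
    have h : f (shiftY v) - f v = q - p + r - s := by
      rw [hp, hq, hr, hs, Equiv.apply_symm_apply]; ring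
    have hn : ‖f (shiftY v) - f v‖ ≤ ‖p‖ + ‖q‖ + ‖r‖ + ‖s‖ := by
      rw [h]
      have := norm_sub_le (q - p + r) s
      have := norm_add_le (q - p) r
      have := norm_sub_le q p
      linarith
    have h0 := norm_nonneg (f (shiftY v) - f v)
    nlinarith [sq_nonneg (‖p‖ - ‖q‖), sq_nonneg (‖p‖ - ‖r‖), sq_nonneg (‖p‖ - ‖s‖),
      sq_nonneg (‖q‖ - ‖r‖), sq_nonneg (‖q‖ - ‖s‖), sq_nonneg (‖r‖ - ‖s‖)]
  refine (Finset.sum_le_sum fun v _ => key v).trans ?_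
  rw [← Finset.mul_sum, Finset.sum_add_distrib, Finset.sum_add_distrib, Finset.sum_add_distrib]
  rw [Equiv.sum_comp shearY.symm (fun v => ‖f (shearY v) - f v‖ ^ 2),
    Equiv.sum_comp shearY.symm (fun v => ‖f (shift v) - f v‖ ^ 2),
    Equiv.sum_comp shearY.symm (fun v => ‖f (shearY (shift v)) - f (shift v)‖ ^ 2),
    Equiv.sum_comp shift (fun v => ‖f (shearY v) - f v‖ ^ 2),
    Equiv.sum_comp shiftY (fun v => ‖f (shift v) - f v‖ ^ 2)]
  linarith

/-- A function of mean zero is moved by one of the three generators. -/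
lemma sum_norm_sq_le_of_sum_eq_zero [NeZero N] (f : Torus N → ℂ) (h0 : ∑ v, f v = 0) :
    ∑ v, ‖f v‖ ^ 2 ≤ 144 * (∑ v, ‖f (shift v) - f v‖ ^ 2 + ∑ v, ‖f (shearX v) - f v‖ ^ 2 +
      ∑ v, ‖f (shearY v) - f v‖ ^ 2) := by
  by_contra! hlt
  set M := ∑ v, ‖f v‖ ^ 2 with hM
  have p1 : 0 ≤ ∑ v, ‖f (shift v) - f v‖ ^ 2 := Finset.sum_nonneg fun _ _ => sq_nonneg _
  have p2 : 0 ≤ ∑ v, ‖f (shearX v) - f v‖ ^ 2 := Finset.sum_nonneg fun _ _ => sq_nonneg _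
  have p3 : 0 ≤ ∑ v, ‖f (shearY v) - f v‖ ^ 2 := Finset.sum_nonneg fun _ _ => sq_nonneg _
  have hMpos : 0 < M := by linarith
  -- The constant `144` is `1 / κ ^ 2` for the parameter `κ = 1 / 12` of the box argument.
  have ha : ∑ v, ‖f (shift v) - f v‖ ^ 2 ≤ (1 / 12) ^ 2 * M := by linarith
  have hX : ∑ v, ‖f (shearX v) - f v‖ ^ 2 ≤ (1 / 12) ^ 2 * M := by linarith
  have hY : ∑ v, ‖f (shearY v) - f v‖ ^ 2 ≤ (1 / 12) ^ 2 * M := by linarith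
  have hb := sum_norm_sq_shiftY_sub_le f ha hY
  have hN : (0 : ℝ) < (N : ℝ) ^ 2 := by
    have : (0 : ℝ) < N := by exact_mod_cast NeZero.pos N
    positivity
  have fa := sum_norm_sq_fourier fun v => f (shift v) - f v
  have fb := sum_norm_sq_fourier fun v => f (shiftY v) - f v
  have fX := sum_norm_sq_fourier fun v => f (shearX v) - f v
  have fY := sum_norm_sq_fourier fun v => f (shearY v) - f v
  have hf := sum_norm_sq_fourier f
  simp only [fourier_sub, fourier_shift, fourier_shiftY, fourier_shearX, fourier_shearY]
    at fa fb fX fY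
  have ba := sum_norm_sq_bad_le f (fun z => z.1) _ fa.le
  have bb := sum_norm_sq_bad_le f (fun z => z.2) _ fb.le
  set w : Torus N → ℝ := fun z => ‖fourier f z‖ with hw
  have hinv (φ : Torus N ≃ Torus N) (D : ℝ) (hD : D ≤ (1 / 12) ^ 2 * M)
      (h : ∑ z, ‖fourier f (φ.symm z) - fourier f z‖ ^ 2 = (N : ℝ) ^ 2 * D) :
      ∑ z, (w (φ z) - w z) ^ 2 ≤ (1 / 12) ^ 2 * ∑ z, w z ^ 2 := by
    rw [hw, hf]
    rw [← Equiv.sum_comp φ] at h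
    calc ∑ z, (‖fourier f (φ z)‖ - ‖fourier f z‖) ^ 2
        ≤ ∑ z, ‖fourier f (φ.symm (φ z)) - fourier f (φ z)‖ ^ 2 := by
          refine Finset.sum_le_sum fun z _ => ?_
          rw [Equiv.symm_apply_apply, sq_le_sq, abs_of_nonneg (norm_nonneg _), norm_sub_rev]
          exact abs_norm_sub_norm_le _ _
      _ = (N : ℝ) ^ 2 * D := h
      _ ≤ (N : ℝ) ^ 2 * ((1 / 12) ^ 2 * M) := by gcongr
      _ = _ := by ring
  have := mass_outside_box (w := w) (by simp [hw, fourier, h0]) (κ := 1 / 12) (by norm_num)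
    (hinv _ _ hY fY) (hinv _ _ hX fX)
    (univ.filter fun z : Torus N => ¬ 4 * |z.1.valMinAbs| < N)
    (univ.filter fun z : Torus N => ¬ 4 * |z.2.valMinAbs| < N)
    (by simp) (by simp)
  rw [hw, hf] at this
  have ca : (N : ℝ) ^ 2 * ∑ v, ‖f (shift v) - f v‖ ^ 2 ≤ (N : ℝ) ^ 2 * ((1 / 12) ^ 2 * M) := by
    gcongr
  have cb : (N : ℝ) ^ 2 * ∑ v, ‖f (shiftY v) - f v‖ ^ 2 ≤
      (N : ℝ) ^ 2 * (16 * ((1 / 12) ^ 2 * M)) := by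
    gcongr
  -- In units of `N ^ 2 * M`, the box argument demands `1 - 8 / 12 = 1 / 3` on the left, but the
  -- mass outside the box supplies only `4 * (1 + 16) / (2 * 144) = 17 / 72`.
  have hpos : 0 < (N : ℝ) ^ 2 * M := by positivity
  linarith

/-! ### Mixing of the random walk -/

/-- One step of the random walk on the torus. -/
def avg (f : Torus N → ℝ) (v : Torus N) : ℝ :=
  (f v + f (shift v) + f (shearX v) + f (shearY v)) / 4

lemma sum_avg [NeZero N] (f : Torus N → ℝ) : ∑ v, avg f v = ∑ v, f v := by
  simp only [avg, ← Finset.sum_div, Finset.sum_add_distrib, Equiv.sum_comp shift f,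
    Equiv.sum_comp shearX f, Equiv.sum_comp shearY f]
  ring

/-- The square of a mean of four numbers is the mean of the squares minus one sixteenth of the sum
of the squared pairwise differences. Keeping the three differences with `f v` itself and inserting
the spectral gap gives `1 / (16 * 144) = 1 / 2304`. The identity among the generators makes this
work without symmetrizing the walk. -/
lemma sum_avg_sq_le [NeZero N] (f : Torus N → ℝ) (h0 : ∑ v, f v = 0) :
    ∑ v, avg f v ^ 2 ≤ (1 - 1 / 2304) * ∑ v, f v ^ 2 := by
  have h := sum_norm_sq_le_of_sum_eq_zero (fun v => (f v : ℂ)) (by exact_mod_cast h0)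
  simp only [← Complex.ofReal_sub, Complex.norm_real, Real.norm_eq_abs, sq_abs] at h
  have h1 (v) : avg f v ^ 2 ≤ (f v ^ 2 + f (shift v) ^ 2 + f (shearX v) ^ 2 + f (shearY v) ^ 2) / 4
      - ((f (shift v) - f v) ^ 2 + (f (shearX v) - f v) ^ 2 + (f (shearY v) - f v) ^ 2) / 16 := by
    unfold avg
    nlinarith [sq_nonneg (f (shift v) - f (shearX v)), sq_nonneg (f (shift v) - f (shearY v)),
      sq_nonneg (f (shearX v) - f (shearY v))]
  have h2 := Finset.sum_le_sum fun v (_ : v ∈ univ) => h1 v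
  rw [Finset.sum_sub_distrib, ← Finset.sum_div, ← Finset.sum_div, Finset.sum_add_distrib,
    Finset.sum_add_distrib, Finset.sum_add_distrib, Finset.sum_add_distrib,
    Finset.sum_add_distrib, Equiv.sum_comp shift fun v => f v ^ 2,
    Equiv.sum_comp shearX fun v => f v ^ 2, Equiv.sum_comp shearY fun v => f v ^ 2] at h2
  linarith

lemma sum_iterate_avg_sq_le [NeZero N] (f : Torus N → ℝ) (h0 : ∑ v, f v = 0) (r : ℕ) :
    ∑ v, f v = ∑ v, (avg^[r] f) v ∧
    ∑ v, (avg^[r] f) v ^ 2 ≤ (1 - 1 / 2304) ^ r * ∑ v, f v ^ 2 := by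
  induction r with
  | zero => simp
  | succ r ih =>
    rw [Function.iterate_succ_apply', sum_avg]
    refine ⟨ih.1, (sum_avg_sq_le _ (ih.1 ▸ h0)).trans ?_⟩
    rw [pow_succ', mul_assoc]
    exact mul_le_mul_of_nonneg_left ih.2 (by norm_num)

lemma iterate_avg_sub_const (f : Torus N → ℝ) (c : ℝ) (r : ℕ) (v : Torus N) :
    (avg^[r] fun v => f v - c) v = (avg^[r] f) v - c := by
  induction r generalizing v with
  | zero => rfl
  | succ r ih =>
    simp only [Function.iterate_succ_apply', avg, ih]
    ring

lemma pow_gap_le (c : ℕ) : ((1 : ℝ) - 1 / 2304) ^ (4608 * c) ≤ ((1 / 2) ^ c) ^ 2 := by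
  have h : ((1 : ℝ) - 1 / 2304) ^ 2304 ≤ 1 / 2 := by
    -- Bernoulli's inequality gives `(1 + 1/2304) ^ 2304 ≥ 2`, and its product with the power of `1
    -- - 1/2304` is at most `1`.
    have h1 := one_add_mul_le_pow (a := (1 : ℝ) / 2304) (by norm_num) 2304
    have h2 : ((1 : ℝ) - 1 / 2304) ^ 2304 * (1 + 1 / 2304) ^ 2304 ≤ 1 := by
      rw [← mul_pow]
      exact pow_le_one₀ (by norm_num) (by norm_num)
    have h3 : (0 : ℝ) ≤ (1 - 1 / 2304) ^ 2304 := pow_nonneg (by norm_num) _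
    have h4 : (2 : ℝ) ≤ (1 + 1 / 2304) ^ 2304 := le_trans (by norm_num) h1
    generalize ((1 : ℝ) - 1 / 2304) ^ 2304 = p at *
    generalize ((1 : ℝ) + 1 / 2304) ^ 2304 = q at *
    nlinarith
  have e : 4608 * c = 2304 * (c * 2) := by ring
  rw [e, pow_mul, pow_mul]
  exact pow_le_pow_left₀ (by positivity)
    (pow_le_pow_left₀ (pow_nonneg (by norm_num) _) h c) 2

/-- The expander mixing lemma for walks of length `4608 * c`. -/
lemma mixing [NeZero N] (A B : Torus N → ℝ) (hA0 : ∀ v, 0 ≤ A v) (hA1 : ∀ v, A v ≤ 1)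
    (hB0 : ∀ v, 0 ≤ B v) (hB1 : ∀ v, B v ≤ 1) (c : ℕ) :
    |∑ v, A v * (avg^[4608 * c] B) v - (∑ v, A v) * (∑ v, B v) / (N : ℝ) ^ 2| ≤
      (N : ℝ) ^ 2 * (1 / 2) ^ c := by
  have hN : (0 : ℝ) < (N : ℝ) ^ 2 := by
    have : (0 : ℝ) < N := by exact_mod_cast NeZero.pos N
    positivity
  have hconst (x : ℝ) : ∑ _v : Torus N, x = (N : ℝ) ^ 2 * x := by
    rw [Finset.sum_const, Finset.card_univ, Fintype.card_prod, ZMod.card, nsmul_eq_mul]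
    push_cast
    ring
  have hsq (F : Torus N → ℝ) (h0 : ∀ v, 0 ≤ F v) (h1 : ∀ v, F v ≤ 1) :
      ∑ v, F v ^ 2 ≤ (N : ℝ) ^ 2 := by
    refine (Finset.sum_le_sum fun v _ => pow_le_one₀ (h0 v) (h1 v)).trans ?_
    rw [hconst, mul_one]
  set m := (∑ v, B v) / (N : ℝ) ^ 2 with hm
  have hmB : ∑ v, B v = m * (N : ℝ) ^ 2 := by
    rw [hm, div_mul_cancel₀ _ hN.ne']
  have hB : ∑ v, (B v - m) = 0 := by
    rw [Finset.sum_sub_distrib, hmB, hconst]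
    ring
  have hBsq : ∑ v, (B v - m) ^ 2 ≤ (N : ℝ) ^ 2 := by
    have : ∑ v, (B v - m) ^ 2 = ∑ v, B v ^ 2 - m ^ 2 * (N : ℝ) ^ 2 := by
      have e (v : Torus N) : (B v - m) ^ 2 = B v ^ 2 - 2 * m * (B v - m) - m ^ 2 := by ring
      simp only [e]
      rw [Finset.sum_sub_distrib, Finset.sum_sub_distrib, ← Finset.mul_sum, hB, hconst]
      ring
    have := hsq B hB0 hB1
    have : 0 ≤ m ^ 2 * (N : ℝ) ^ 2 := by positivity
    linarith
  -- Subtracting the mean of `B` removes exactly the main term, since constants are fixed by the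
  -- walk; Cauchy–Schwarz and the contraction on mean zero finish.
  have h1 : ∑ v, A v * (avg^[4608 * c] B) v - (∑ v, A v) * (∑ v, B v) / (N : ℝ) ^ 2 =
      ∑ v, A v * (avg^[4608 * c] fun v => B v - m) v := by
    simp only [iterate_avg_sub_const, mul_sub, Finset.sum_sub_distrib, ← Finset.sum_mul]
    rw [hm]
    ring
  rw [h1]
  apply abs_le_of_sq_le_sq _ (by positivity)
  refine (Finset.sum_mul_sq_le_sq_mul_sq _ _ _).trans ?_
  have h2 := (sum_iterate_avg_sq_le _ hB (4608 * c)).2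
  calc (∑ v, A v ^ 2) * ∑ v, (avg^[4608 * c] fun v => B v - m) v ^ 2
      ≤ (N : ℝ) ^ 2 * (((1 / 2) ^ c) ^ 2 * (N : ℝ) ^ 2) := by
        refine mul_le_mul (hsq A hA0 hA1) (h2.trans ?_)
          (Finset.sum_nonneg fun _ _ => sq_nonneg _) hN.le
        exact mul_le_mul (pow_gap_le c) hBsq (Finset.sum_nonneg fun _ _ => sq_nonneg _)
          (by positivity)
    _ = _ := by ring

end Torus

/-! ### Walks on pairs of natural numbers -/

namespace Inw

open Finset

/-- The step of the walk on `{0, …, N - 1}²` given by the two control bits. -/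
def walkStep (N : ℕ) : Bool → Bool → ℕ × ℕ → ℕ × ℕ
  | false, false, v => v
  | true, false, v => ((v.1 + 1) % N, v.2)
  | false, true, v => ((v.1 + v.2) % N, v.2)
  | true, true, v => (v.1, (v.1 + v.2) % N)

/-- The low `b` bits of both numbers. -/
def low (b : ℕ) (w : ℕ × ℕ) : ℕ × ℕ := (w.1 % 2 ^ b, w.2 % 2 ^ b)

/-- The walk of length `r` that starts at the low `b` bits of both numbers and is controlled by
the following `r` bits. -/
def walk (b : ℕ) (w : ℕ × ℕ) : ℕ → ℕ × ℕ
  | 0 => low b w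
  | r + 1 => walkStep (2 ^ b) (w.1.testBit (b + r)) (w.2.testBit (b + r)) (walk b w r)

open Classical in
/-- The indicator of a proposition. -/
def ind (p : Prop) : ℝ := if p then 1 else 0

lemma ind_nonneg (p : Prop) : 0 ≤ ind p := by
  unfold ind
  split_ifs <;> norm_num

lemma ind_le_one (p : Prop) : ind p ≤ 1 := by
  unfold ind
  split_ifs <;> norm_num

lemma ind_mul (p q : Prop) : ind p * ind q = ind (p ∧ q) := by
  unfold ind
  split_ifs <;> simp_all

/-- The mean over all pairs of `b`-bit numbers. -/
def mean (b : ℕ) (F : ℕ × ℕ → ℝ) : ℝ :=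
  (∑ p ∈ range (2 ^ b), ∑ q ∈ range (2 ^ b), F (p, q)) / 4 ^ b

lemma walk_lt (b : ℕ) (w : ℕ × ℕ) (r : ℕ) : (walk b w r).1 < 2 ^ b ∧ (walk b w r).2 < 2 ^ b := by
  have hpos : 0 < 2 ^ b := by positivity
  induction r with
  | zero => exact ⟨Nat.mod_lt _ hpos, Nat.mod_lt _ hpos⟩
  | succ r ih =>
    rw [walk]
    cases w.1.testBit (b + r) <;> cases w.2.testBit (b + r) <;>
      simp only [walkStep] <;> refine ⟨?_, ?_⟩ <;>
      first | exact ih.1 | exact ih.2 | exact Nat.mod_lt _ hpos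

/-- The start uses the bits below `b` and the walk the bits from `b` to `b + r - 1`; higher bits are
never read. -/
lemma walk_congr (b : ℕ) {w w' : ℕ × ℕ} (r : ℕ) (h1 : w.1 % 2 ^ (b + r) = w'.1 % 2 ^ (b + r))
    (h2 : w.2 % 2 ^ (b + r) = w'.2 % 2 ^ (b + r)) : walk b w r = walk b w' r := by
  have hmod (x y s : ℕ) (h : x % 2 ^ (b + r) = y % 2 ^ (b + r)) (hs : s ≤ b + r) :
      x % 2 ^ s = y % 2 ^ s := by
    rw [← Nat.mod_mod_of_dvd x (pow_dvd_pow 2 hs), h, Nat.mod_mod_of_dvd y (pow_dvd_pow 2 hs)]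
  have hbit (x y s : ℕ) (h : x % 2 ^ (b + r) = y % 2 ^ (b + r)) (hs : s < b + r) :
      x.testBit s = y.testBit s := by
    have := congrArg (fun z => z.testBit s) h
    simpa [Nat.testBit_mod_two_pow, hs] using this
  have key : ∀ s ≤ r, walk b w s = walk b w' s := by
    intro s hs
    induction s with
    | zero =>
      simp only [walk, low]
      rw [hmod _ _ b h1 (by omega), hmod _ _ b h2 (by omega)]
    | succ s ih =>
      simp only [walk]
      rw [ih (by omega), hbit _ _ _ h1 (by omega), hbit _ _ _ h2 (by omega)]
  exact key r le_rfl

lemma sum_range_two_pow_succ (g : ℕ → ℝ) (s : ℕ) :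
    ∑ p ∈ range (2 ^ (s + 1)), g p = ∑ p ∈ range (2 ^ s), (g p + g (2 ^ s + p)) := by
  rw [pow_succ, mul_two, Finset.sum_range_add, ← Finset.sum_add_distrib]

lemma sum_range_eq_sum_zmod {N : ℕ} [NeZero N] (F : ℕ × ℕ → ℝ) :
    ∑ p ∈ range N, ∑ q ∈ range N, F (p, q) = ∑ v : Torus N, F (v.1.val, v.2.val) := by
  have h (g : ℕ → ℝ) : ∑ p ∈ range N, g p = ∑ x : ZMod N, g x.val := by
    refine Finset.sum_nbij' (fun p => (p : ZMod N)) ZMod.val ?_ ?_ ?_ ?_ ?_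
    · simp
    · intro x _; simpa using ZMod.val_lt x
    · intro p hp; simpa using ZMod.val_cast_of_lt (by simpa using hp)
    · intro x _; simp
    · intro p hp; rw [ZMod.val_cast_of_lt (by simpa using hp)]
  rw [Fintype.sum_prod_type, h]
  exact Finset.sum_congr rfl fun x _ => h _

/-- One step of the random walk. -/
def avgStep (N : ℕ) (F : ℕ × ℕ → ℝ) (v : ℕ × ℕ) : ℝ :=
  (F v + F (walkStep N true false v) + F (walkStep N false true v) +
    F (walkStep N true true v)) / 4

lemma avgStep_val {N : ℕ} [NeZero N] (F : ℕ × ℕ → ℝ) :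
    (fun v : Torus N => avgStep N F (v.1.val, v.2.val)) =
      Torus.avg fun v => F (v.1.val, v.2.val) := by
  funext v
  have h1 : (v.1 + 1).val = (v.1.val + 1) % N := by
    rw [ZMod.val_add, ZMod.val_one_eq_one_mod, Nat.add_mod_mod]
  simp only [avgStep, Torus.avg, walkStep, Torus.shift, Torus.shearX, Torus.shearY,
    Equiv.coe_fn_mk, ZMod.val_add, h1]

/-- The start and the control bits of a uniform seed are independent, so summing over the control
bits applies the averaging operator once per step. The induction replaces `F` by its average over
the last step, whose control bits are the topmost bits of the two numbers. -/
lemma sum_walk (b r : ℕ) (A F : ℕ × ℕ → ℝ) :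
    ∑ p ∈ range (2 ^ (b + r)), ∑ q ∈ range (2 ^ (b + r)),
      A (low b (p, q)) * F (walk b (p, q) r) =
    4 ^ r * ∑ v : Torus (2 ^ b), A (v.1.val, v.2.val) *
      (Torus.avg^[r] fun v => F (v.1.val, v.2.val)) v := by
  induction r generalizing F with
  | zero =>
    simp only [walk, add_zero, pow_zero, one_mul, Function.iterate_zero, id]
    rw [← sum_range_eq_sum_zmod fun v => A v * F v]
    refine Finset.sum_congr rfl fun p hp => Finset.sum_congr rfl fun q hq => ?_
    rw [Finset.mem_range] at hp hq
    simp only [low, Nat.mod_eq_of_lt hp, Nat.mod_eq_of_lt hq]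
  | succ r ih =>
    have ih' := ih (avgStep (2 ^ b) F)
    rw [Function.iterate_succ_apply, ← avgStep_val, pow_succ, mul_right_comm, ← ih',
      -- Splitting off the top bit of both numbers yields the four choices of the last step.
      Finset.sum_mul, ← add_assoc, sum_range_two_pow_succ]
    refine Finset.sum_congr rfl fun p hp => ?_
    rw [sum_range_two_pow_succ, sum_range_two_pow_succ, ← Finset.sum_add_distrib, Finset.sum_mul]
    refine Finset.sum_congr rfl fun q hq => ?_
    rw [Finset.mem_range] at hp hq
    have hm (x : ℕ) : (2 ^ (b + r) + x) % 2 ^ (b + r) = x % 2 ^ (b + r) := Nat.add_mod_left _ _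
    have hl (x : ℕ) : (2 ^ (b + r) + x) % 2 ^ b = x % 2 ^ b := by
      rw [pow_add, Nat.mul_add_mod]
    have hw (x y x' y' : ℕ) (h1 : x % 2 ^ (b + r) = x' % 2 ^ (b + r))
        (h2 : y % 2 ^ (b + r) = y' % 2 ^ (b + r)) : walk b (x, y) r = walk b (x', y') r :=
      walk_congr b r h1 h2
    simp only [walk, low, hl, Nat.testBit_two_pow_add_eq, Nat.testBit_lt_two_pow hp,
      Nat.testBit_lt_two_pow hq, Bool.not_false]
    rw [hw (2 ^ (b + r) + p) q p q (hm p) rfl, hw p (2 ^ (b + r) + q) p q rfl (hm q),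
      hw (2 ^ (b + r) + p) (2 ^ (b + r) + q) p q (hm p) (hm q)]
    simp only [avgStep, walkStep]
    ring

lemma mean_nonneg {b : ℕ} {F : ℕ × ℕ → ℝ} (h : ∀ v, 0 ≤ F v) : 0 ≤ mean b F :=
  div_nonneg (Finset.sum_nonneg fun _ _ => Finset.sum_nonneg fun _ _ => h _) (by positivity)

lemma mean_const (b : ℕ) (x : ℝ) : mean b (fun _ => x) = x := by
  have : (4 : ℝ) ^ b = 2 ^ b * 2 ^ b := by rw [← mul_pow]; norm_num
  simp only [mean, Finset.sum_const, Finset.card_range, nsmul_eq_mul, this]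
  push_cast
  field_simp

lemma mean_sum {ι : Type*} (s : Finset ι) (b : ℕ) (F : ι → ℕ × ℕ → ℝ) :
    mean b (fun v => ∑ i ∈ s, F i v) = ∑ i ∈ s, mean b (F i) := by
  simp only [mean]
  rw [← Finset.sum_div]
  congr 1
  simp_rw [Finset.sum_comm (s := range (2 ^ b)) (t := s)]

lemma mean_add (b : ℕ) (F G : ℕ × ℕ → ℝ) :
    mean b (fun v => F v + G v) = mean b F + mean b G := by
  simp only [mean, Finset.sum_add_distrib, add_div]

/-- The expander mixing lemma in probabilistic form: for a uniform seed, the two ends of the walk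
are nearly independent. -/
lemma abs_mean_walk_sub_le (b c : ℕ) (A F : ℕ × ℕ → ℝ) (hA0 : ∀ v, 0 ≤ A v) (hA1 : ∀ v, A v ≤ 1)
    (hF0 : ∀ v, 0 ≤ F v) (hF1 : ∀ v, F v ≤ 1) :
    |mean (b + 4608 * c) (fun w => A (low b w) * F (walk b w (4608 * c))) - mean b A * mean b F| ≤
      (1 / 2) ^ c := by
  have h := Torus.mixing (N := 2 ^ b) (fun v => A (v.1.val, v.2.val)) (fun v => F (v.1.val, v.2.val))
    (fun _ => hA0 _) (fun _ => hA1 _) (fun _ => hF0 _) (fun _ => hF1 _) c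
  have h4 : (4 : ℝ) ^ b = ((2 ^ b : ℕ) : ℝ) ^ 2 := by
    push_cast
    rw [← pow_mul, mul_comm, pow_mul]
    norm_num
  unfold mean
  rw [sum_walk, pow_add, mul_comm ((4 : ℝ) ^ b), mul_div_mul_left _ _ (by positivity),
    sum_range_eq_sum_zmod, sum_range_eq_sum_zmod, h4]
  have hpos : (0 : ℝ) < ((2 ^ b : ℕ) : ℝ) ^ 2 := by positivity
  rw [← abs_of_pos hpos] at h
  rw [mul_comm |_|, ← div_le_iff₀ (by rwa [abs_of_pos hpos])] at h
  rw [← abs_div, abs_of_pos hpos] at h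
  refine le_trans (le_of_eq ?_) h
  congr 1
  field_simp

/-! ### Pseudorandom generator for block decision trees -/

/-- The bit lengths of the seeds at the levels of the recursion. -/
def level (b₀ : ℕ) (c : ℕ → ℕ) : ℕ → ℕ
  | 0 => b₀
  | j + 1 => level b₀ c j + 4608 * c j

/-- The generator: a seed for level `j` is expanded into `2 ^ j` blocks, the `i`th of which is the
value at `i`. -/
def gen (b₀ : ℕ) (c : ℕ → ℕ) : ℕ → ℕ × ℕ → ℕ → ℕ × ℕ
  | 0, w, _ => w
  | j + 1, w, i =>
    if i < 2 ^ j then gen b₀ c j (low (level b₀ c j) w) i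
    else gen b₀ c j (walk (level b₀ c j) w (4608 * c j)) (i - 2 ^ j)

/-- Words of length `2 ^ j`. -/
def Word (σ : Type) : ℕ → Type
  | 0 => σ
  | j + 1 => Word σ j × Word σ j

instance Word.fintype (σ : Type) [Fintype σ] : (j : ℕ) → Fintype (Word σ j)
  | 0 => inferInstanceAs (Fintype σ)
  | j + 1 =>
    letI := Word.fintype σ j
    inferInstanceAs (Fintype (Word σ j × Word σ j))

lemma Word.card (σ : Type) [Fintype σ] (j : ℕ) :
    Fintype.card (Word σ j) = Fintype.card σ ^ 2 ^ j := by
  induction j with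
  | zero => simp [Word]; rfl
  | succ j ih =>
    have : Fintype.card (Word σ (j + 1)) = Fintype.card (Word σ j) * Fintype.card (Word σ j) :=
      Fintype.card_prod _ _
    rw [this, ih, ← pow_add, pow_succ, mul_two]

/-- Block decision trees of depth `2 ^ j`, which may also fail at every node. -/
def Tree (σ : Type) : ℕ → Type
  | 0 => ℕ × ℕ → Option σ
  | j + 1 => Tree σ j × (Word σ j → Tree σ j)

/-- The root of a tree of depth one. -/
def Tree.query {σ : Type} (t : Tree σ 0) : ℕ × ℕ → Option (Word σ 0) := t

/-- The upper half of a tree. -/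
def Tree.top {σ : Type} {j : ℕ} (t : Tree σ (j + 1)) : Tree σ j := Prod.fst t

/-- The lower half of a tree, below the node that is reached along `u`. -/
def Tree.below {σ : Type} {j : ℕ} (t : Tree σ (j + 1)) (u : Word σ j) : Tree σ j := Prod.snd t u

/-- Concatenation of words. -/
def Word.append {σ : Type} {j : ℕ} (u z : Word σ j) : Word σ (j + 1) := Prod.mk u z

/-- The first half of a word. -/
def Word.left {σ : Type} {j : ℕ} (u : Word σ (j + 1)) : Word σ j := Prod.fst u

/-- The second half of a word. -/
def Word.right {σ : Type} {j : ℕ} (u : Word σ (j + 1)) : Word σ j := Prod.snd u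

lemma Word.append_inj {σ : Type} {j : ℕ} {u z u' z' : Word σ j} :
    u.append z = u'.append z' ↔ u = u' ∧ z = z' := Prod.mk_inj

/-- The word that a tree returns on the pseudorandom blocks. -/
def run {σ : Type} (b₀ : ℕ) (c : ℕ → ℕ) : (j : ℕ) → Tree σ j → ℕ × ℕ → Option (Word σ j)
  | 0, t, v => t.query v
  | j + 1, t, w =>
    (run b₀ c j t.top (low (level b₀ c j) w)).bind fun u =>
      (run b₀ c j (t.below u) (walk (level b₀ c j) w (4608 * c j))).map fun z => u.append z

/-! ### Pseudorandom blocks against independent blocks -/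

/-- The probability that a tree returns `u` on the pseudorandom blocks. -/
def probGen {σ : Type} (b₀ : ℕ) (c : ℕ → ℕ) (j : ℕ) (t : Tree σ j) (u : Word σ j) : ℝ :=
  mean (level b₀ c j) fun w => ind (run b₀ c j t w = some u)

/-- The probability that a tree returns `u` on uniform independent blocks. -/
def probUnif {σ : Type} (b₀ : ℕ) : (j : ℕ) → Tree σ j → Word σ j → ℝ
  | 0, t, u => mean b₀ fun v => ind (t.query v = some u)
  | j + 1, t, u => probUnif b₀ j t.top u.left * probUnif b₀ j (t.below u.left) u.right

variable {σ : Type} (b₀ : ℕ) (c : ℕ → ℕ)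

lemma probUnif_nonneg (j : ℕ) (t : Tree σ j) (u : Word σ j) : 0 ≤ probUnif b₀ j t u := by
  induction j with
  | zero => exact mean_nonneg fun v => ind_nonneg _
  | succ j ih => exact mul_nonneg (ih _ _) (ih _ _)

lemma probGen_nonneg (j : ℕ) (t : Tree σ j) (u : Word σ j) : 0 ≤ probGen b₀ c j t u :=
  mean_nonneg fun _ => ind_nonneg _

/-- For fixed `u` and `z` the event is an intersection of an event about the start of the walk and
one about its end. Only because `u` is fixed does the second event not depend on the start, which is
why the error is later paid once per word. -/
lemma probGen_succ (j : ℕ) (t : Tree σ (j + 1)) (u z : Word σ j) :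
    |probGen b₀ c (j + 1) t (u.append z) - probGen b₀ c j t.top u * probGen b₀ c j (t.below u) z| ≤
      (1 / 2) ^ c j := by
  have h := abs_mean_walk_sub_le (level b₀ c j) (c j)
    (fun w => ind (run b₀ c j t.top w = some u))
    (fun w => ind (run b₀ c j (t.below u) w = some z))
    (fun v => ind_nonneg _) (fun v => ind_le_one _) (fun v => ind_nonneg _)
    (fun v => ind_le_one _)
  refine le_trans (le_of_eq ?_) h
  unfold probGen
  congr 3
  funext w
  rw [ind_mul]
  congr 1
  simp only [run, Option.bind_eq_some_iff, Option.map_eq_some_iff, Word.append_inj, eq_iff_iff]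
  constructor
  · rintro ⟨u', h1, z', h2, rfl, rfl⟩
    exact ⟨h1, h2⟩
  · rintro ⟨h1, h2⟩
    exact ⟨u, h1, z, h2, rfl, rfl⟩

lemma probUnif_append (j : ℕ) (t : Tree σ (j + 1)) (u z : Word σ j) :
    probUnif b₀ (j + 1) t (u.append z) = probUnif b₀ j t.top u * probUnif b₀ j (t.below u) z :=
  rfl

variable [Fintype σ]

lemma sum_mean_some {α : Type} [Fintype α] (b : ℕ) (f : ℕ × ℕ → Option α) :
    ∑ u, mean b (fun v => ind (f v = some u)) =
      1 - mean b fun v => ind (f v = none) := by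
  classical
  rw [← mean_sum, eq_sub_iff_add_eq, ← mean_add]
  refine Eq.trans ?_ (mean_const b 1)
  congr 1
  funext v
  cases h : f v <;> simp [ind]

lemma sum_probGen (j : ℕ) (t : Tree σ j) : ∑ u, probGen b₀ c j t u =
    1 - mean (level b₀ c j) fun w => ind (run b₀ c j t w = none) :=
  sum_mean_some _ _

lemma sum_probGen_le (j : ℕ) (t : Tree σ j) : ∑ u, probGen b₀ c j t u ≤ 1 := by
  rw [sum_probGen, sub_le_self_iff]
  exact mean_nonneg fun v => ind_nonneg _

lemma sum_word_succ (j : ℕ) (f : Word σ (j + 1) → ℝ) :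
    ∑ u, f u = ∑ u : Word σ j, ∑ z : Word σ j, f (u.append z) :=
  Fintype.sum_prod_type (f := f)

lemma sum_probUnif_le (j : ℕ) (t : Tree σ j) : ∑ u, probUnif b₀ j t u ≤ 1 := by
  induction j with
  | zero =>
    refine (sum_mean_some _ _).le.trans ?_
    rw [sub_le_self_iff]
    exact mean_nonneg fun v => ind_nonneg _
  | succ j ih =>
    rw [sum_word_succ]
    simp only [probUnif_append, ← Finset.mul_sum]
    calc _ ≤ ∑ u, probUnif b₀ j t.top u * 1 := Finset.sum_le_sum fun u _ =>
          mul_le_mul_of_nonneg_left (ih _) (probUnif_nonneg _ _ _ _)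
      _ ≤ 1 := by simpa using ih t.top

/-- A union bound: the failure probabilities of the two halves add up, whichever node the upper half
leads to. -/
lemma le_sum_probUnif_succ (j : ℕ) (t : Tree σ (j + 1)) (β₁ β₂ : ℝ) (hβ : 0 ≤ β₂)
    (h1 : 1 - β₁ ≤ ∑ u, probUnif b₀ j t.top u) (h2 : ∀ u, 1 - β₂ ≤ ∑ z, probUnif b₀ j (t.below u) z) :
    1 - (β₁ + β₂) ≤ ∑ u, probUnif b₀ (j + 1) t u := by
  rw [sum_word_succ]
  simp only [probUnif_append, ← Finset.mul_sum]
  have : ∑ u, probUnif b₀ j t.top u * (1 - β₂) ≤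
      ∑ u, probUnif b₀ j t.top u * ∑ z, probUnif b₀ j (t.below u) z :=
    Finset.sum_le_sum fun u _ => mul_le_mul_of_nonneg_left (h2 u) (probUnif_nonneg _ _ _ _)
  rw [← Finset.sum_mul] at this
  nlinarith [sum_probUnif_le b₀ j t.top]

/-- The error of the generator. -/
def err (a : ℕ) (c : ℕ → ℕ) : ℕ → ℝ
  | 0 => 0
  | j + 1 => 2 * err a c j + (a : ℝ) ^ 2 ^ (j + 1) * (1 / 2) ^ c j

/-- The distribution of the word that a tree returns is nearly the same for pseudorandom blocks as
for independent uniform blocks. -/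
theorem sum_abs_probGen_sub_probUnif_le (j : ℕ) (t : Tree σ j) :
    ∑ u, |probGen b₀ c j t u - probUnif b₀ j t u| ≤ err (Fintype.card σ) c j := by
  induction j with
  | zero =>
    have h0 (u : Word σ 0) : probGen b₀ c 0 t u - probUnif b₀ 0 t u = 0 := sub_self _
    simp [h0, err]
  | succ j ih =>
    rw [sum_word_succ]
    -- A hybrid argument: decouple the two halves at the price of `(1 / 2) ^ c j`, then replace the
    -- lower half and after it the upper half by independent blocks. Summed over the words, the two
    -- replacements cost one copy of the previous error each, because the remaining factors sum to
    -- at most `1`.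
    have hb (u z : Word σ j) : |probGen b₀ c (j + 1) t (u.append z) - probUnif b₀ (j + 1) t (u.append z)| ≤
        (1 / 2) ^ c j +
        (probGen b₀ c j t.top u * |probGen b₀ c j (t.below u) z - probUnif b₀ j (t.below u) z| +
        |probGen b₀ c j t.top u - probUnif b₀ j t.top u| * probUnif b₀ j (t.below u) z) := by
      have h1 := probGen_succ b₀ c j t u z
      have e : probGen b₀ c (j + 1) t (u.append z) - probUnif b₀ (j + 1) t (u.append z) =
          (probGen b₀ c (j + 1) t (u.append z) - probGen b₀ c j t.top u * probGen b₀ c j (t.below u) z) +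
          (probGen b₀ c j t.top u * (probGen b₀ c j (t.below u) z - probUnif b₀ j (t.below u) z) +
          (probGen b₀ c j t.top u - probUnif b₀ j t.top u) * probUnif b₀ j (t.below u) z) := by
        rw [probUnif_append]; ring
      rw [e]
      refine (abs_add_le _ _).trans (add_le_add h1 ((abs_add_le _ _).trans (le_of_eq ?_)))
      rw [abs_mul, abs_mul, abs_of_nonneg (probGen_nonneg _ _ _ _ _),
        abs_of_nonneg (probUnif_nonneg _ _ _ _)]
    refine (Finset.sum_le_sum fun u _ => Finset.sum_le_sum fun z _ => hb u z).trans ?_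
    simp only [Finset.sum_add_distrib, ← Finset.mul_sum, Finset.sum_const, Finset.card_univ,
      nsmul_eq_mul, Word.card]
    have h2 : ∑ u, probGen b₀ c j t.top u *
        ∑ z, |probGen b₀ c j (t.below u) z - probUnif b₀ j (t.below u) z| ≤ err (Fintype.card σ) c j := by
      have h0 : 0 ≤ err (Fintype.card σ) c j :=
        (Finset.sum_nonneg fun _ _ => abs_nonneg _).trans (ih t.top)
      calc _ ≤ ∑ u, probGen b₀ c j t.top u * err (Fintype.card σ) c j :=
            Finset.sum_le_sum fun u _ =>
              mul_le_mul_of_nonneg_left (ih _) (probGen_nonneg _ _ _ _ _)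
        _ ≤ _ := by
          rw [← Finset.sum_mul]
          exact mul_le_of_le_one_left h0 (sum_probGen_le _ _ _ _)
    have h3 : ∑ u, |probGen b₀ c j t.top u - probUnif b₀ j t.top u| * ∑ z, probUnif b₀ j (t.below u) z ≤
        err (Fintype.card σ) c j := by
      refine (Finset.sum_le_sum fun u _ => ?_).trans (ih t.top)
      exact mul_le_of_le_one_right (abs_nonneg _) (sum_probUnif_le _ _ _)
    rw [err, pow_succ 2 j, mul_two, pow_add]
    push_cast
    linarith

/-- The probability that a tree fails on pseudorandom blocks. -/
theorem mean_run_eq_none_le (j : ℕ) (t : Tree σ j) (β : ℝ)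
    (h : 1 - β ≤ ∑ u, probUnif b₀ j t u) :
    mean (level b₀ c j) (fun w => ind (run b₀ c j t w = none)) ≤
      β + err (Fintype.card σ) c j := by
  have h1 := sum_probGen b₀ c j t
  have h2 := sum_abs_probGen_sub_probUnif_le b₀ c j t
  have h3 : ∑ u, probUnif b₀ j t u - ∑ u, probGen b₀ c j t u ≤
      ∑ u, |probGen b₀ c j t u - probUnif b₀ j t u| := by
    rw [← Finset.sum_sub_distrib]
    refine Finset.sum_le_sum fun u _ => ?_
    rw [abs_sub_comm]
    exact le_abs_self _
  linarith

end Inw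

/-! ### Rounding -/

namespace Rounding

/-- The side of the grid. -/
def grid (d : ℕ) (ε : ℝ) : ℝ := (d + 1) * (4 * ε)

/-- Round down to a multiple of `g`. -/
def floorTo (g x : ℝ) : ℝ := ⌊x / g⌋ * g

/-- With the shift number `Δ`, no multiple of the side of the grid is near a coordinate of `W`. -/
def Good {d : ℕ} (ε : ℝ) (W : Vec d) (Δ : ℕ) : Prop :=
  ∀ i, ¬ floorTo (grid d ε) (W i + Δ * (4 * ε) - ε) < floorTo (grid d ε) (W i + Δ * (4 * ε) + ε)

variable {d : ℕ} {ε : ℝ}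

lemma grid_pos (hε : 0 < ε) : 0 < grid d ε := by unfold grid; positivity

lemma floorTo_mono {g x y : ℝ} (hg : 0 < g) (h : x ≤ y) : floorTo g x ≤ floorTo g y := by
  unfold floorTo
  gcongr

lemma floorTo_le {g x : ℝ} (hg : 0 < g) : floorTo g x ≤ x :=
  (le_div_iff₀ hg).1 (Int.floor_le _)

lemma lt_floorTo_add {g x : ℝ} (hg : 0 < g) : x < floorTo g x + g := by
  have := (div_lt_iff₀ hg).1 (Int.lt_floor_add_one (x / g))
  unfold floorTo
  linarith

/-- Different roundings of `x` and `y` mean that the multiple of `g` below `y` separates them. -/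
lemma lt_floorTo_of_floorTo_lt {g x y : ℝ} (hg : 0 < g) (h : floorTo g x < floorTo g y) :
    x < floorTo g y := by
  have h1 : (⌊x / g⌋ : ℝ) < ⌊y / g⌋ := lt_of_mul_lt_mul_right h hg.le
  have h2 : ⌊x / g⌋ < ⌊y / g⌋ := by exact_mod_cast h1
  exact (div_lt_iff₀ hg).1 (Int.floor_lt.1 h2)

/-- By the pigeonhole principle, if all `d + 1` shifts were bad, two of them would be bad for the
same coordinate. The grid points near the two shifted values would then differ by more than `4ε -
2ε` and by less than `4dε + 4ε`, the side of the grid, which is impossible for multiples of the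
side. -/
lemma exists_good (hε : 0 < ε) (W : Vec d) : ∃ Δ ≤ d, Good ε W Δ := by
  by_contra! hcon
  have hbad (Δ : Fin (d + 1)) : ∃ i, floorTo (grid d ε) (W i + (Δ : ℕ) * (4 * ε) - ε) <
      floorTo (grid d ε) (W i + (Δ : ℕ) * (4 * ε) + ε) := by
    have := hcon Δ (by omega)
    unfold Good at this
    push Not at this
    exact this
  choose i hi using hbad
  have hnot : ¬ Function.Injective i := fun h => by
    have := Fintype.card_le_of_injective i h
    simp at this
  have hg : 0 < grid d ε := grid_pos hε
  have key : ∀ Δ Δ' : Fin (d + 1), Δ < Δ' → i Δ = i Δ' → False := by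
    intro Δ Δ' hlt heq
    have h1 := hi Δ
    have h2 := hi Δ'
    rw [← heq] at h2
    have a1 := lt_floorTo_of_floorTo_lt hg h1
    have a2 := lt_floorTo_of_floorTo_lt hg h2
    have b1 := floorTo_le (x := W (i Δ) + (Δ : ℕ) * (4 * ε) + ε) hg
    have b2 := floorTo_le (x := W (i Δ) + (Δ' : ℕ) * (4 * ε) + ε) hg
    unfold floorTo at a1 a2 b1 b2
    generalize ⌊(W (i Δ) + (Δ : ℕ) * (4 * ε) + ε) / grid d ε⌋ = p at *
    generalize ⌊(W (i Δ) + (Δ' : ℕ) * (4 * ε) + ε) / grid d ε⌋ = q at *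
    have hΔ : ((Δ : ℕ) : ℝ) + 1 ≤ (Δ' : ℕ) := by exact_mod_cast hlt
    have hΔd : ((Δ' : ℕ) : ℝ) ≤ d := by exact_mod_cast Nat.lt_succ_iff.1 Δ'.2
    have hΔ0 : (0 : ℝ) ≤ (Δ : ℕ) := by positivity
    have c1 : 0 < ((q : ℝ) - p) * grid d ε := by nlinarith
    have c2 : ((q : ℝ) - p) * grid d ε < 1 * grid d ε := by unfold grid at *; nlinarith
    have d1 : (0 : ℝ) < (q : ℝ) - p := pos_of_mul_pos_left c1 hg.le
    have d2 : (q : ℝ) - p < 1 := lt_of_mul_lt_mul_right c2 hg.le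
    have e1 : p < q := by exact_mod_cast sub_pos.1 d1
    have e2 : q < p + 1 := by exact_mod_cast (sub_lt_iff_lt_add'.1 d2)
    omega
  apply hnot
  intro Δ Δ' h
  rcases lt_trichotomy Δ Δ' with hlt | heq | hlt
  · exact (key _ _ hlt h).elim
  · exact heq
  · exact (key _ _ hlt h.symm).elim

open Classical in
/-- The least good shift, or `0` if there is none. -/
def leastShift (ε : ℝ) (W : Vec d) : ℕ :=
  if h : ∃ Δ, Good ε W Δ then Nat.find h else 0

lemma good_leastShift (hε : 0 < ε) (W : Vec d) : Good ε W (leastShift ε W) := by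
  classical
  obtain ⟨Δ, _, h⟩ := exists_good hε W
  have h' : ∃ Δ, Good ε W Δ := ⟨Δ, h⟩
  rw [leastShift, dif_pos h']
  exact Nat.find_spec h'

lemma leastShift_le (hε : 0 < ε) (W : Vec d) : leastShift ε W ≤ d := by
  classical
  obtain ⟨Δ, hd, h⟩ := exists_good hε W
  have h' : ∃ Δ, Good ε W Δ := ⟨Δ, h⟩
  rw [leastShift, dif_pos h']
  exact (Nat.find_min' h' h).trans hd

lemma not_good_of_lt_leastShift (W : Vec d) {Δ : ℕ} (h : Δ < leastShift ε W) : ¬ Good ε W Δ := by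
  classical
  unfold leastShift at h
  split_ifs at h with h'
  · exact Nat.find_min h' h
  · omega

/-- What the steward returns on the response `W`. -/
def roundVec (ε : ℝ) (W : Vec d) : Vec d := fun i =>
  floorTo (grid d ε) (W i + leastShift ε W * (4 * ε) - ε)

/-- What the steward returns if the shift is `Δ` and the response is near `μ`. -/
def center (ε : ℝ) (μ : Vec d) (Δ : ℕ) : Vec d := fun i =>
  floorTo (grid d ε) (μ i + Δ * (4 * ε))

/-- The shifted point `μ` lies between the shifted response minus `ε` and plus `ε`, and with a good
shift these two round to the same grid point. -/
lemma roundVec_eq_center (hε : 0 < ε) {W μ : Vec d} (h : ‖W - μ‖ ≤ ε) :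
    roundVec ε W = center ε μ (leastShift ε W) := by
  have hg : 0 < grid d ε := grid_pos hε
  funext i
  have hi := (norm_le_pi_norm (W - μ) i).trans h
  rw [Pi.sub_apply, Real.norm_eq_abs, abs_le] at hi
  have h1 := floorTo_mono hg (show W i + leastShift ε W * (4 * ε) - ε ≤
    μ i + leastShift ε W * (4 * ε) by linarith)
  have h2 := floorTo_mono hg (show μ i + leastShift ε W * (4 * ε) ≤
    W i + leastShift ε W * (4 * ε) + ε by linarith)
  exact le_antisymm h1 (h2.trans (not_lt.1 (good_leastShift hε W i)))

/-- The shift raises a coordinate by at most `4dε`, and rounding lowers it by less than `4(d + 1)ε`,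
which is at most `8dε` for `d ≥ 1`. -/
lemma norm_center_sub_le (hε : 0 < ε) (μ : Vec d) {Δ : ℕ} (hΔ : Δ ≤ d) :
    ‖center ε μ Δ - μ‖ ≤ 8 * (ε * d) := by
  rcases Nat.eq_zero_or_pos d with rfl | hd
  · simp [Subsingleton.elim (center ε μ Δ - μ) 0]
  have hg : 0 < grid d ε := grid_pos hε
  have hd1 : (1 : ℝ) ≤ d := by exact_mod_cast hd
  have hΔd : (Δ : ℝ) ≤ d := by exact_mod_cast hΔ
  have hΔ0 : (0 : ℝ) ≤ Δ := by positivity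
  rw [pi_norm_le_iff_of_nonneg (by positivity)]
  intro i
  have h1 := floorTo_le (x := μ i + Δ * (4 * ε)) hg
  have h2 := lt_floorTo_add (x := μ i + Δ * (4 * ε)) hg
  rw [Pi.sub_apply, Real.norm_eq_abs, abs_le]
  unfold center
  have hge : grid d ε ≤ 8 * (ε * d) := by unfold grid; nlinarith
  constructor <;> nlinarith

end Rounding

/-! ### The steward -/

namespace Inw

open Finset

/-! ### Coins as seeds and blocks as query points -/

/-- The pair of numbers whose binary digits are interleaved in `x`. -/
def seedOf {b : ℕ} (x : Bits (2 * b)) : ℕ × ℕ :=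
  (Nat.ofBits fun t : Fin b => x ⟨2 * t, by omega⟩,
    Nat.ofBits fun t : Fin b => x ⟨2 * t + 1, by omega⟩)

/-- The interleaved binary digits of a pair of numbers. -/
def queryBits (n : ℕ) (v : ℕ × ℕ) : Bits n := fun i =>
  if (i : ℕ) % 2 = 0 then v.1.testBit (i / 2) else v.2.testBit (i / 2)

lemma seedOf_lt {b : ℕ} (x : Bits (2 * b)) : (seedOf x).1 < 2 ^ b ∧ (seedOf x).2 < 2 ^ b :=
  ⟨Nat.ofBits_lt_two_pow _, Nat.ofBits_lt_two_pow _⟩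

lemma queryBits_seedOf {n b : ℕ} (h : n ≤ 2 * b) (x : Bits (2 * b)) :
    queryBits n (seedOf x) = fun i => x (Fin.castLE h i) := by
  funext i
  have hi := i.2
  simp only [queryBits, seedOf]
  split_ifs with h2
  · rw [Nat.testBit_ofBits_lt _ _ (by omega)]
    congr 1
    ext
    simp
    omega
  · rw [Nat.testBit_ofBits_lt _ _ (by omega)]
    congr 1
    ext
    simp
    omega

lemma seedOf_queryBits {b : ℕ} {v : ℕ × ℕ} (h1 : v.1 < 2 ^ b) (h2 : v.2 < 2 ^ b) :
    seedOf (queryBits (2 * b) v) = v := by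
  ext
  · trans Nat.ofBits fun t : Fin b => v.1.testBit t
    · simp [seedOf, queryBits]
    · rw [Nat.ofBits_testBit, Nat.mod_eq_of_lt h1]
  · trans Nat.ofBits fun t : Fin b => v.2.testBit t
    · simp only [seedOf, queryBits]
      congr 1
      funext t
      rw [if_neg (by omega)]
      congr 1
      omega
    · rw [Nat.ofBits_testBit, Nat.mod_eq_of_lt h2]

lemma sum_seedOf (b : ℕ) (F : ℕ × ℕ → ℝ) :
    ∑ x : Bits (2 * b), F (seedOf x) = ∑ p ∈ range (2 ^ b), ∑ q ∈ range (2 ^ b), F (p, q) := by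
  rw [← Finset.sum_product' (f := fun p q => F (p, q))]
  refine Finset.sum_nbij' seedOf (queryBits (2 * b)) ?_ ?_ ?_ ?_ ?_
  · intro x _
    simpa using seedOf_lt x
  · simp
  · intro x _
    rw [queryBits_seedOf le_rfl]
    rfl
  · intro v hv
    simp only [mem_product, mem_range] at hv
    exact seedOf_queryBits hv.1 hv.2
  · intros; rfl

lemma uniformBits_real (n : ℕ) (p : Bits n → Prop) :
    (uniformBits n).real {x | p x} = (∑ x, ind (p x)) / 2 ^ n := by
  classical
  have : (uniformBits n) {x | p x} =
      (Fintype.card {x // p x} : ENNReal) / (Fintype.card (Bits n) : ENNReal) := by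
    rw [uniformBits, PMF.toMeasure_uniformOfFintype_apply _ (Set.toFinite _).measurableSet]
    rfl
  rw [Measure.real, this]
  simp only [ind, Finset.sum_boole, ENNReal.toReal_div, ENNReal.toReal_natCast,
    Fintype.card_subtype]
  simp

lemma uniformBits_real_seedOf (b : ℕ) (p : ℕ × ℕ → Prop) :
    (uniformBits (2 * b)).real {x | p (seedOf x)} = mean b fun v => ind (p v) := by
  rw [uniformBits_real, sum_seedOf b fun v => ind (p v), mean, pow_mul]
  norm_num

lemma sum_castLE {n M : ℕ} (h : n ≤ M) (F : Bits n → ℝ) :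
    ∑ x : Bits M, F (fun i => x (Fin.castLE h i)) = 2 ^ (M - n) * ∑ x, F x := by
  obtain ⟨l, rfl⟩ := Nat.exists_eq_add_of_le h
  rw [← Equiv.sum_comp (Fin.appendEquiv n l), Fintype.sum_prod_type, Finset.mul_sum]
  refine Finset.sum_congr rfl fun x _ => ?_
  have (y : Fin l → Bool) : (fun i => Fin.appendEquiv n l (x, y) (Fin.castLE h i)) = x := by
    funext i
    exact Fin.append_left x y i
  simp only [this]
  simp

/-- The interleaved digits of a uniform pair are `2 * b` uniform bits, and dropping the surplus ones
leaves the first `n` uniform. The surplus is needed for odd `n`. -/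
lemma mean_queryBits {n b : ℕ} (h : n ≤ 2 * b) (p : Bits n → Prop) :
    mean b (fun v => ind (p (queryBits n v))) = (uniformBits n).real {x | p x} := by
  rw [← uniformBits_real_seedOf b fun v => p (queryBits n v), uniformBits_real, uniformBits_real]
  simp only [queryBits_seedOf h]
  rw [sum_castLE h fun x => ind (p x)]
  have : (2 : ℝ) ^ (2 * b) = 2 ^ (2 * b - n) * 2 ^ n := by rw [← pow_add]; congr 1; omega
  rw [this, mul_div_mul_left _ _ (by positivity)]

/-- The steward that queries at the blocks of the generator and returns rounded responses. -/
def steward (n d b₀ : ℕ) (c : ℕ → ℕ) (J : ℕ) (ε : ℝ) :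
    OneQuerySteward n d (2 * level b₀ c J) where
  query x Ws := queryBits n (gen b₀ c J (seedOf x) Ws.length)
  output _ Ws := Rounding.roundVec ε (Ws.getLastD 0)

variable {n d : ℕ}

/-! ### The owner as a decision tree -/

/-- The list of outputs after `2 ^ j` further rounds with the given shifts. -/
def extend (O : Owner n d) (ε : ℝ) :
    (j : ℕ) → List (Vec d) → Word (Fin (d + 1)) j → List (Vec d)
  | 0, Ys, Δ => Ys ++ [Rounding.center ε (O.point Ys) (show Fin (d + 1) from Δ)]
  | j + 1, Ys, u => extend O ε j (extend O ε j Ys u.left) u.right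

open Classical in
/-- The decision tree for `2 ^ j` further rounds. It fails if one of the first `k` responses is far
from the owner's point. -/
def ownerTree (O : Owner n d) (ε : ℝ) (k : ℕ) :
    (j : ℕ) → List (Vec d) → Tree (Fin (d + 1)) j
  | 0, Ys => fun v =>
    if k ≤ Ys.length then some 0
    else if ‖O.func Ys (queryBits n v) - O.point Ys‖ ≤ ε then
      some (Fin.ofNat _ (Rounding.leastShift ε (O.func Ys (queryBits n v))))
    else none
  | j + 1, Ys => (ownerTree O ε k j Ys, fun u => ownerTree O ε k j (extend O ε j Ys u))

lemma length_extend (O : Owner n d) (ε : ℝ) (j : ℕ) (Ys : List (Vec d))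
    (u : Word (Fin (d + 1)) j) : (extend O ε j Ys u).length = Ys.length + 2 ^ j := by
  induction j generalizing Ys with
  | zero => simp [extend]
  | succ j ih => rw [extend, ih, ih, pow_succ]; omega

/-- The number of rounds below `k` among the `2 ^ j` rounds from `i` on. -/
def roundsBelow (k i j : ℕ) : ℕ := ∑ l ∈ range (2 ^ j), if i + l < k then 1 else 0

lemma roundsBelow_succ (k i j : ℕ) :
    roundsBelow k i (j + 1) = roundsBelow k i j + roundsBelow k (i + 2 ^ j) j := by
  simp only [roundsBelow]
  rw [pow_succ, mul_two, Finset.sum_range_add]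
  simp only [add_assoc]

lemma roundsBelow_zero_le (k j : ℕ) : roundsBelow k 0 j ≤ k := by
  unfold roundsBelow
  rw [Finset.sum_boole, Nat.cast_id]
  refine (Finset.card_le_card (t := range k) fun l => ?_).trans (Finset.card_range k).le
  simp

/-- Each node of the first `k` rounds fails with probability at most `δ` by concentration, later
nodes never fail. Counting with `roundsBelow` keeps the total at `k * δ` although the tree has depth
`2 ^ j`, which may exceed `k`. -/
lemma le_sum_probUnif_ownerTree {O : Owner n d} {ε δ : ℝ} (hO : O.Admissible ε δ) (hδ : 0 ≤ δ)
    {b₀ : ℕ} (hb : n ≤ 2 * b₀) (k j : ℕ) (Ys : List (Vec d)) :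
    1 - roundsBelow k Ys.length j * δ ≤ ∑ u, probUnif b₀ j (ownerTree O ε k j Ys) u := by
  induction j generalizing Ys with
  | zero =>
    refine le_trans ?_ (sum_mean_some b₀ (ownerTree O ε k 0 Ys).query).ge
    by_cases hk : k ≤ Ys.length
    · have h1 (v) : (ownerTree O ε k 0 Ys).query v ≠ none := by
        simp only [ownerTree, Tree.query, if_pos hk]
        exact Option.some_ne_none _
      simp only [h1, ind, if_false, mean_const]
      have : 0 ≤ (roundsBelow k Ys.length 0 : ℝ) * δ := by positivity
      linarith
    · have h1 (v) : (ownerTree O ε k 0 Ys).query v = none ↔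
          ε < ‖O.func Ys (queryBits n v) - O.point Ys‖ := by
        simp only [ownerTree, Tree.query, if_neg hk]
        split_ifs with h
        · simpa using h
        · exact iff_of_true rfl (not_le.1 h)
      simp only [h1]
      rw [mean_queryBits hb fun x => ε < ‖O.func Ys x - O.point Ys‖]
      have := hO Ys
      unfold Concentrated at this
      have h2 : Ys.length < k := by omega
      simp only [roundsBelow, pow_zero, range_one, sum_singleton, add_zero, if_pos h2,
        Nat.cast_one]
      linarith
  | succ j ih =>
    have := le_sum_probUnif_succ b₀ j (ownerTree O ε k (j + 1) Ys) (roundsBelow k Ys.length j * δ)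
      (roundsBelow k (Ys.length + 2 ^ j) j * δ) (by positivity) (ih Ys) (fun u => by
        have := ih (extend O ε j Ys u)
        rwa [length_extend] at this)
    rw [roundsBelow_succ]
    push_cast
    linarith

lemma length_interact_fst {m : ℕ} (S : OneQuerySteward n d m) (O : Owner n d) (x : Bits m)
    (i : ℕ) : (S.interact O x i).1.length = i := by
  induction i with
  | zero => rfl
  | succ i ih => simp [OneQuerySteward.interact, ih]

/-- As long as the tree does not fail, all responses are near, so the outputs are the centers for
the recorded shifts and the interaction follows the tree. The agreement of the output lists is
claimed only below round `k`: beyond it the tree records the dummy letter `0`. The hypothesis `hw`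
says that the blocks from round `Ys.length` on are those generated by `w`. -/
lemma interact_of_run_eq_some {b₀ : ℕ} {c : ℕ → ℕ} {J k : ℕ} {ε : ℝ} (hε : 0 < ε) (O : Owner n d)
    (x : Bits (2 * level b₀ c J)) (j : ℕ) (Ys : List (Vec d)) (w : ℕ × ℕ)
    (u : Word (Fin (d + 1)) j) (hrun : run b₀ c j (ownerTree O ε k j Ys) w = some u)
    (hY : Ys.length < k → ((steward n d b₀ c J ε).interact O x Ys.length).2 = Ys)
    (hw : ∀ l < 2 ^ j, gen b₀ c J (seedOf x) (Ys.length + l) = gen b₀ c j w l) :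
    (∀ l < 2 ^ j, Ys.length + l < k →
      ‖(steward n d b₀ c J ε).output x
          ((steward n d b₀ c J ε).interact O x (Ys.length + l + 1)).1 -
        O.point ((steward n d b₀ c J ε).interact O x (Ys.length + l)).2‖ ≤ 8 * (ε * d)) ∧
    (Ys.length + 2 ^ j < k →
      ((steward n d b₀ c J ε).interact O x (Ys.length + 2 ^ j)).2 = extend O ε j Ys u) := by
  set S := steward n d b₀ c J ε with hS
  induction j generalizing Ys w with
  | zero =>
    by_cases hk : k ≤ Ys.length
    · exact ⟨fun l _ h => by omega, fun h => by omega⟩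
    have hY' := hY (by omega)
    have hq : S.query x (S.interact O x Ys.length).1 = queryBits n w := by
      have := hw 0 (by norm_num)
      simp only [add_zero] at this
      simp only [hS, steward, length_interact_fst]
      rw [this, gen]
    set W := O.func Ys (queryBits n w) with hW
    have hstep : S.interact O x (Ys.length + 1) =
        ((S.interact O x Ys.length).1 ++ [W], Ys ++ [Rounding.roundVec ε W]) := by
      simp only [OneQuerySteward.interact, hq, hY']
      simp [hS, steward, hW]
    simp only [run, Tree.query, ownerTree, if_neg hk] at hrun
    split_ifs at hrun with hnear
    have hu : u = Fin.ofNat (d + 1) (Rounding.leastShift ε W) := (Option.some.inj hrun).symm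
    -- The reduction modulo `d + 1` is harmless because the least good shift is at most `d`.
    have huval : ((show Fin (d + 1) from u : Fin (d + 1)) : ℕ) = Rounding.leastShift ε W := by
      rw [hu]
      simp only [Fin.ofNat]
      exact Nat.mod_eq_of_lt (Nat.lt_succ_of_le (Rounding.leastShift_le hε W))
    have hround : Rounding.roundVec ε W = Rounding.center ε (O.point Ys) (Rounding.leastShift ε W) :=
      Rounding.roundVec_eq_center hε hnear
    refine ⟨fun l hl _ => ?_, fun _ => ?_⟩
    · obtain rfl : l = 0 := by simpa using hl
      simp only [add_zero]
      rw [hstep, hY']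
      have : S.output x ((S.interact O x Ys.length).1 ++ [W]) = Rounding.roundVec ε W := by
        simp [hS, steward]
      rw [this, hround]
      exact Rounding.norm_center_sub_le hε _ (Rounding.leastShift_le hε W)
    · rw [pow_zero, hstep, extend, hround, huval]
  | succ j ih =>
    simp only [run, Option.bind_eq_some_iff, Option.map_eq_some_iff] at hrun
    obtain ⟨y, hy, z, hz, rfl⟩ := hrun
    have hpow : 2 ^ (j + 1) = 2 ^ j + 2 ^ j := by rw [pow_succ, mul_two]
    have h1 := ih Ys _ y hy (fun l hl => by
      rw [hw l (by omega), gen, if_pos hl]) hY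
    have hlen := length_extend O ε j Ys y
    have h2 := ih (extend O ε j Ys y) _ z hz
      (fun l hl => by
        rw [hlen, add_assoc, hw _ (by omega), gen, if_neg (by omega), Nat.add_sub_cancel_left])
      (fun hlt => by
        rw [hlen] at hlt ⊢
        exact h1.2 hlt)
    rw [hlen] at h2
    refine ⟨fun l hl hlk => ?_, fun hlt => ?_⟩
    · by_cases hlj : l < 2 ^ j
      · exact h1.1 l hlj hlk
      · have := h2.1 (l - 2 ^ j) (by omega)
        have e : Ys.length + 2 ^ j + (l - 2 ^ j) = Ys.length + l := by omega
        rw [e] at this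
        exact this hlk
    · rw [hpow, ← add_assoc] at hlt ⊢
      exact h2.2 hlt

/-- The control length cancels the number `s ^ 2 ^ (j + 1)` of words, leaving `(1 / 2) ^ (J + L)` at
each level; the recursion `x ↦ 2 x + 1` then produces `2 ^ j - 1`. At level `J` the term `J` pays
for this factor and `L` is the final precision. -/
lemma err_le {a J L : ℕ} {s : ℕ} (hs : s ≤ 2 ^ a) (j : ℕ) :
    err s (fun j => 2 ^ (j + 1) * a + J + L) j ≤ (2 ^ j - 1) * (1 / 2) ^ (J + L) := by
  induction j with
  | zero => simp [err]
  | succ j ih =>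
    have hs' : (s : ℝ) ≤ 2 ^ a := by exact_mod_cast hs
    have h1 : (s : ℝ) ^ 2 ^ (j + 1) * (1 / 2) ^ (2 ^ (j + 1) * a + J + L) ≤
        (1 / 2) ^ (J + L) := by
      calc (s : ℝ) ^ 2 ^ (j + 1) * (1 / 2) ^ (2 ^ (j + 1) * a + J + L)
          ≤ (2 ^ a) ^ 2 ^ (j + 1) * (1 / 2) ^ (2 ^ (j + 1) * a + J + L) := by gcongr
        _ = (1 / 2) ^ (J + L) := by
          rw [add_assoc, pow_add (1 / 2 : ℝ), ← mul_assoc, ← pow_mul, mul_comm a, ← mul_pow]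
          norm_num
    simp only [err]
    have h2 : (2 : ℝ) ^ (j + 1) = 2 * 2 ^ j := pow_succ' _ _
    rw [h2]
    linarith

/-- The steward fails with small probability. -/
theorem isSteward_steward (n d b₀ a J L k : ℕ) (ε δ γ : ℝ) (hε : 0 < ε) (hδ : 0 < δ)
    (hb : n ≤ 2 * b₀) (ha : d + 1 ≤ 2 ^ a) (hJ : k ≤ 2 ^ J) (hL : 1 ≤ 2 ^ L * γ) :
    (steward n d b₀ (fun j => 2 ^ (j + 1) * a + J + L) J ε).IsSteward k ε δ
      (8 * (ε * d)) (k * δ + γ) := by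
  set c : ℕ → ℕ := fun j => 2 ^ (j + 1) * a + J + L with hc
  set S := steward n d b₀ c J ε with hS
  have herr : err (Fintype.card (Fin (d + 1))) c J ≤ γ := by
    rw [Fintype.card_fin]
    refine (err_le ha J).trans ?_
    rw [pow_add, ← mul_assoc]
    have h1 : ((2 : ℝ) ^ J - 1) * (1 / 2) ^ J ≤ 1 := by
      have : (2 : ℝ) ^ J * (1 / 2) ^ J = 1 := by rw [← mul_pow]; norm_num
      have : (0 : ℝ) ≤ (1 / 2) ^ J := by positivity
      linarith
    have h2 : ((1 : ℝ) / 2) ^ L ≤ γ := by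
      rw [one_div, inv_pow, inv_le_iff_one_le_mul₀ (by positivity), mul_comm]
      exact hL
    calc _ ≤ 1 * ((1 : ℝ) / 2) ^ L := by gcongr
      _ ≤ γ := by rw [one_mul]; exact h2
  have hdet (O : Owner n d) (hO : O.Admissible ε δ) :
      (uniformBits (2 * level b₀ c J)).real {x | S.Fails k (8 * (ε * d)) O x} ≤ k * δ + γ := by
    have h1 := mean_run_eq_none_le b₀ c J (ownerTree O ε k J []) _
      (le_sum_probUnif_ownerTree hO hδ.le hb k J [])
    rw [← uniformBits_real_seedOf _ fun w => run b₀ c J (ownerTree O ε k J []) w = none] at h1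
    have h2 : (roundsBelow k ([] : List (Vec d)).length J : ℝ) * δ ≤ k * δ := by
      gcongr
      exact roundsBelow_zero_le k J
    refine le_trans (ENNReal.toReal_mono ?_ (measure_mono ?_)) (h1.trans (by linarith))
    · have : IsProbabilityMeasure (uniformBits (2 * level b₀ c J)) :=
        PMF.toMeasure.isProbabilityMeasure _
      exact measure_ne_top _ _
    · rintro x ⟨i, hik, hi⟩
      by_contra hrun
      obtain ⟨u, hu⟩ := Option.ne_none_iff_exists'.1 hrun
      have := (interact_of_run_eq_some (J := J) hε O x J [] (seedOf x) u hu (fun _ => rfl)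
        (fun l _ => by simp)).1 i (by omega) (by simpa using hik)
      simp only [List.length_nil, zero_add] at this
      exact absurd hi (not_lt.2 this)
  intro Ω _ P _ O hO hmeas
  have : IsProbabilityMeasure (uniformBits (2 * level b₀ c J)) :=
    PMF.toMeasure.isProbabilityMeasure _
  have hγ0 : 0 ≤ (k : ℝ) * δ + γ := by
    have : 0 < γ := pos_of_mul_pos_right (lt_of_lt_of_le one_pos hL) (by positivity)
    positivity
  refine ENNReal.toReal_le_of_le_ofReal hγ0 ?_
  -- The owner's randomness is independent of the coins, so Fubini reduces to the deterministic
  -- owner of each `ω`.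
  rw [Measure.prod_apply_symm hmeas]
  calc _ ≤ ∫⁻ _ : Ω, ENNReal.ofReal (k * δ + γ) ∂P := lintegral_mono fun ω => by
        rw [← ENNReal.toReal_le_toReal (measure_ne_top _ _) ENNReal.ofReal_ne_top,
          ENNReal.toReal_ofReal hγ0]
        exact hdet (O ω) (hO ω)
    _ = _ := by simp

end Inw

/-! ### Total correctness of programs -/

/-- Started in `s`, the program halts after at most `T` steps in a state that satisfies `Q`. -/
def Wp (c : Prog) (T : ℕ) (Q : MachineState → Prop) (s : MachineState) : Prop :=
  ∃ t s', Exec c s t s' ∧ t ≤ T ∧ Q s'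

namespace Wp

variable {c c₁ c₂ : Prog} {T T₁ T₂ : ℕ} {Q Q' R : MachineState → Prop} {s : MachineState}

lemma mono (h : Wp c T Q s) (hT : T ≤ T₁) (hQ : ∀ s', Q s' → Q' s') : Wp c T₁ Q' s := by
  obtain ⟨t, s', h1, h2, h3⟩ := h
  exact ⟨t, s', h1, h2.trans hT, hQ s' h3⟩

lemma seq (h₁ : Wp c₁ T₁ R s) (h₂ : ∀ s', R s' → Wp c₂ T₂ Q s') :
    Wp (.seq c₁ c₂) (T₁ + T₂) Q s := by
  obtain ⟨t₁, s₁, e₁, l₁, r₁⟩ := h₁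
  obtain ⟨t₂, s₂, e₂, l₂, r₂⟩ := h₂ s₁ r₁
  exact ⟨_, _, .seq e₁ e₂, add_le_add l₁ l₂, r₂⟩

lemma cond {b : TestExpr} (h₁ : b.Holds s → Wp c₁ T Q s) (h₂ : ¬ b.Holds s → Wp c₂ T Q s) :
    Wp (.cond b c₁ c₂) (b.cost + T) Q s := by
  by_cases hb : b.Holds s
  · obtain ⟨t, s', e, l, r⟩ := h₁ hb
    exact ⟨_, _, .condTrue hb e, by omega, r⟩
  · obtain ⟨t, s', e, l, r⟩ := h₂ hb
    exact ⟨_, _, .condFalse hb e, by omega, r⟩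

/-- A loop that is run through exactly `N` times. -/
lemma loop {b : TestExpr} (I : ℕ → MachineState → Prop) (N : ℕ)
    (hstep : ∀ i < N, ∀ s, I i s → b.Holds s ∧ Wp c T (I (i + 1)) s)
    (hend : ∀ s, I N s → ¬ b.Holds s) (hstart : I 0 s) :
    Wp (.loop b c) ((N + 1) * (b.cost + T)) (I N) s := by
  -- Induction on the number `r` of remaining passes; the extra `b.cost` is the final failing test.
  have key : ∀ r i, i + r = N → ∀ s, I i s → Wp (.loop b c) (r * (b.cost + T) + b.cost) (I N) s := by
    intro r
    induction r with
    | zero =>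
      intro i hi s hs
      obtain rfl : i = N := hi
      exact ⟨_, _, .loopDone (hend s hs), by omega, hs⟩
    | succ r ih =>
      intro i hi s hs
      obtain ⟨hb, t₁, s₁, e₁, l₁, h₁⟩ := hstep i (by omega) s hs
      obtain ⟨t₂, s₂, e₂, l₂, h₂⟩ := ih (i + 1) (by omega) s₁ h₁
      refine ⟨_, _, .loopStep hb e₁ e₂, ?_, h₂⟩
      rw [add_mul]
      omega
  refine (key N 0 (by omega) s hstart).mono ?_ fun _ h => h
  rw [add_mul]
  omega

end Wp

/-! ### Programs without loops -/

namespace Prog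

/-- Programs without loops. -/
def LoopFree : Prog → Prop
  | skip => True
  | natSet _ _ _ => True
  | realSet _ _ _ => True
  | toss _ _ => True
  | seq c₁ c₂ => c₁.LoopFree ∧ c₂.LoopFree
  | cond _ c₁ c₂ => c₁.LoopFree ∧ c₂.LoopFree
  | loop _ _ => False

/-- A bound for the number of coins that a program without loops tosses. -/
def tosses : Prog → ℕ
  | skip => 0
  | natSet _ _ _ => 0
  | realSet _ _ _ => 0
  | toss _ _ => 1
  | seq c₁ c₂ => c₁.tosses + c₂.tosses
  | cond _ c₁ c₂ => max c₁.tosses c₂.tosses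
  | loop _ _ => 0

open Classical in
/-- The effect of a program without loops, if it does not run out of coins. -/
def act : Prog → MachineState → MachineState
  | skip, s => s
  | natSet a i e, s => s.setNat a (i.eval s) (e.eval s)
  | realSet a i r, s => s.setReal a (i.eval s) (r.eval s)
  | toss a i, s =>
    ⟨(s.setNat a (i.eval s) (s.coins.headD false).toNat).nat, s.real, s.coins.tail⟩
  | seq c₁ c₂, s => c₂.act (c₁.act s)
  | cond b c₁ c₂, s => if b.Holds s then c₁.act s else c₂.act s
  | loop _ _, s => s

/-- A bound for the running time of a program without loops. -/
def bound : Prog → ℕ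
  | skip => 1
  | natSet _ i e => i.cost + e.cost + 1
  | realSet _ i r => i.cost + r.cost + 1
  | toss _ i => i.cost + 1
  | seq c₁ c₂ => c₁.bound + c₂.bound
  | cond b c₁ c₂ => b.cost + (c₁.bound + c₂.bound)
  | loop _ _ => 0

/-- This ensures that a second program still finds its coins on the tape after the first has run. -/
lemma length_coins_act (c : Prog) (s : MachineState) :
    s.coins.length ≤ (c.act s).coins.length + c.tosses := by
  induction c generalizing s with
  | seq c₁ c₂ h₁ h₂ =>
    have := h₁ s
    have := h₂ (c₁.act s)
    simp only [act, tosses]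
    omega
  | cond b c₁ c₂ h₁ h₂ =>
    have := h₁ s
    have := h₂ s
    simp only [act, tosses]
    split_ifs <;> omega
  | toss a i => simp [act, tosses]; omega
  | _ => simp [act, MachineState.setNat, MachineState.setReal]

lemma wp_of_loopFree {c : Prog} (hc : c.LoopFree) {Q : MachineState → Prop} {s : MachineState}
    (hs : c.tosses ≤ s.coins.length) (h : Q (c.act s)) : Wp c c.bound Q s := by
  have key : ∀ (c : Prog), c.LoopFree → ∀ s, c.tosses ≤ s.coins.length →
      Wp c c.bound (· = c.act s) s := by
    intro c
    induction c with
    | skip => exact fun _ s _ => ⟨_, _, .skip s, le_rfl, rfl⟩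
    | natSet a i e => exact fun _ s _ => ⟨_, _, .natSet a i e s, le_rfl, rfl⟩
    | realSet a i r => exact fun _ s _ => ⟨_, _, .realSet a i r s, le_rfl, rfl⟩
    | toss a i =>
      intro _ s hs
      obtain ⟨b, l, hl⟩ := List.exists_cons_of_length_pos (show 0 < s.coins.length from hs)
      refine ⟨_, _, .toss a i s b l hl, le_rfl, ?_⟩
      simp [act, hl, MachineState.setNat]
    | seq c₁ c₂ h₁ h₂ =>
      intro h s hs
      have := length_coins_act c₁ s
      simp only [tosses] at hs
      refine (h₁ h.1 s (by omega)).seq fun s' hs' => ?_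
      subst hs'
      exact h₂ h.2 _ (by omega)
    | cond b c₁ c₂ h₁ h₂ =>
      intro h s hs
      simp only [tosses] at hs
      refine Wp.cond (fun hb => ?_) (fun hb => ?_)
      · exact (h₁ h.1 s (by omega)).mono (by omega) fun s' hs' => by rw [hs', act, if_pos hb]
      · exact (h₂ h.2 s (by omega)).mono (by omega) fun s' hs' => by rw [hs', act, if_neg hb]
    | loop => exact fun h => h.elim
  exact (key c hc s hs).mono le_rfl fun s' hs' => hs' ▸ h

/-- Programs without loops and coin tosses. -/
def Straight (c : Prog) : Prop := c.LoopFree ∧ c.tosses = 0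

lemma wp_of_straight {c : Prog} (hc : c.Straight) {Q : MachineState → Prop} {s : MachineState}
    (h : Q (c.act s)) : Wp c c.bound Q s :=
  wp_of_loopFree hc.1 (hc.2.trans_le (Nat.zero_le _)) h

/-- The program writes to no arrays but the given ones. -/
def Writes (as rs : List ℕ) : Prog → Prop
  | skip => True
  | natSet a _ _ => a ∈ as
  | realSet a _ _ => a ∈ rs
  | toss a _ => a ∈ as
  | seq c₁ c₂ => c₁.Writes as rs ∧ c₂.Writes as rs
  | cond _ c₁ c₂ => c₁.Writes as rs ∧ c₂.Writes as rs
  | loop _ c => c.Writes as rs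

lemma Writes.nat_act {as rs : List ℕ} {c : Prog} (hc : c.Writes as rs) (s : MachineState) {a : ℕ}
    (ha : a ∉ as) : (c.act s).nat a = s.nat a := by
  induction c generalizing s with
  | natSet a' i e =>
    have : a ≠ a' := fun h => ha (h ▸ hc)
    simp [act, MachineState.setNat, this]
  | toss a' i =>
    have : a ≠ a' := fun h => ha (h ▸ hc)
    simp [act, MachineState.setNat, this]
  | seq c₁ c₂ h₁ h₂ => exact (h₂ hc.2 _).trans (h₁ hc.1 _)
  | cond b c₁ c₂ h₁ h₂ =>
    rw [act]
    split_ifs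
    · exact h₁ hc.1 s
    · exact h₂ hc.2 s
  | _ => rfl

lemma Writes.real_act {as rs : List ℕ} {c : Prog} (hc : c.Writes as rs) (s : MachineState) {a : ℕ}
    (ha : a ∉ rs) : (c.act s).real a = s.real a := by
  induction c generalizing s with
  | realSet a' i e =>
    have : a ≠ a' := fun h => ha (h ▸ hc)
    simp [act, MachineState.setReal, this]
  | seq c₁ c₂ h₁ h₂ => exact (h₂ hc.2 _).trans (h₁ hc.1 _)
  | cond b c₁ c₂ h₁ h₂ =>
    rw [act]
    split_ifs
    · exact h₁ hc.1 s
    · exact h₂ hc.2 s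
  | _ => rfl

lemma coins_act {c : Prog} (hc : c.tosses = 0) (s : MachineState) :
    (c.act s).coins = s.coins := by
  induction c generalizing s with
  | toss => simp [tosses] at hc
  | seq c₁ c₂ h₁ h₂ =>
    simp only [tosses] at hc
    exact (h₂ (by omega) _).trans (h₁ (by omega) _)
  | cond b c₁ c₂ h₁ h₂ =>
    simp only [tosses] at hc
    rw [act]
    split_ifs
    · exact h₁ (by omega) s
    · exact h₂ (by omega) s
  | _ => rfl

end Prog

/-! ### Frame conditions -/

/-- The states differ at most in the given arrays of naturals and of reals. -/
structure Same (as rs : List ℕ) (s s' : MachineState) : Prop where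
  nat : ∀ a ∉ as, s'.nat a = s.nat a
  real : ∀ a ∉ rs, s'.real a = s.real a
  coins : s'.coins = s.coins

namespace Same

variable {as rs as' rs' : List ℕ} {s s' s'' : MachineState}

lemma refl (as rs : List ℕ) (s : MachineState) : Same as rs s s :=
  ⟨fun _ _ => rfl, fun _ _ => rfl, rfl⟩

lemma trans (h : Same as rs s s') (h' : Same as rs s' s'') : Same as rs s s'' :=
  ⟨fun a ha => (h'.nat a ha).trans (h.nat a ha), fun a ha => (h'.real a ha).trans (h.real a ha),
    h'.coins.trans h.coins⟩

lemma mono (h : Same as rs s s') (ha : as ⊆ as') (hr : rs ⊆ rs') : Same as' rs' s s' :=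
  ⟨fun a h' => h.nat a fun h'' => h' (ha h''), fun a h' => h.real a fun h'' => h' (hr h''),
    h.coins⟩

lemma act {c : Prog} (h : Same as rs s s') (hc : c.Straight) (hw : c.Writes as rs) :
    Same as rs s (c.act s') :=
  ⟨fun a ha => (hw.nat_act s' ha).trans (h.nat a ha),
    fun a ha => (hw.real_act s' ha).trans (h.real a ha),
    (Prog.coins_act hc.2 s').trans h.coins⟩

/-- A program without loops and coin tosses changes only the arrays that it writes to. -/
lemma wp {c : Prog} {Q : MachineState → Prop} (h : Same as rs s s') (hc : c.Straight)
    (hw : c.Writes as rs) (hQ : Q (c.act s')) :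
    Wp c c.bound (fun s'' => Same as rs s s'' ∧ Q s'') s' :=
  Prog.wp_of_straight hc ⟨h.act hc hw, hQ⟩

end Same

namespace MachineState

variable (s : MachineState) (a i : ℕ)

@[simp] lemma setNat_nat (v a' i' : ℕ) :
    (s.setNat a i v).nat a' i' = if a' = a ∧ i' = i then v else s.nat a' i' := by
  by_cases h : a' = a
  · subst h
    simp [setNat, Function.update_apply]
  · simp [setNat, h]

@[simp] lemma setNat_real (v : ℕ) : (s.setNat a i v).real = s.real := rfl

@[simp] lemma setNat_coins (v : ℕ) : (s.setNat a i v).coins = s.coins := rfl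

@[simp] lemma setReal_real (v : ℝ) (a' i' : ℕ) :
    (s.setReal a i v).real a' i' = if a' = a ∧ i' = i then v else s.real a' i' := by
  by_cases h : a' = a
  · subst h
    simp [setReal, Function.update_apply]
  · simp [setReal, h]

@[simp] lemma setReal_nat (v : ℝ) : (s.setReal a i v).nat = s.nat := rfl

@[simp] lemma setReal_coins (v : ℝ) : (s.setReal a i v).coins = s.coins := rfl

end MachineState

/-! ### The program -/

namespace StewardCode

open NatExpr (const cell)

/-- The scalar variable in the array `a`. -/
abbrev v (a : ℕ) : NatExpr := .cell a (.const 0)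

/-- Assign to the scalar variable in the array `a`. -/
abbrev set (a : ℕ) (e : NatExpr) : Prog := .natSet a (.const 0) e

/-- The real scalar variable in the array `a`. -/
abbrev rv (a : ℕ) : RealExpr := .cell a (.const 0)

/-- Assign to the real scalar variable in the array `a`. -/
abbrev rset (a : ℕ) (r : RealExpr) : Prog := .realSet a (.const 0) r

/-- An expression for a constant multiple. -/
def times : ℕ → NatExpr → NatExpr
  | 0, _ => .const 0
  | c + 1, e => .add (times c e) e

lemma eval_times (c : ℕ) (e : NatExpr) (s : MachineState) :
    (times c e).eval s = c * e.eval s := by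
  induction c with
  | zero => simp [times, NatExpr.eval]
  | succ c ih => simp [times, NatExpr.eval, ih, add_mul]

/-- Double the variable `5` and count the doublings in the variable `a`. -/
def doubleBody (a : ℕ) : Prog := .seq (set 5 (.add (v 5) (v 5))) (set a (.add (v a) (.const 1)))

/-- Count in the variable `a` how often `1` has to be doubled to reach `e`. -/
def clogCode (a : ℕ) (e : NatExpr) : Prog :=
  .seq (set 5 (.const 1)) (.loop (.natLt (v 5) e) (doubleBody a))

def gammaBody : Prog := .seq (rset 3 (.add (rv 3) (rv 3))) (set 4 (.add (v 4) (.const 1)))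

/-- Count in the variable `4` how often the input `γ` has to be doubled to reach `1`. -/
def gammaCode : Prog :=
  .seq (rset 3 (.cell 0 (.const 1))) (.loop (.realLt (rv 3) .one) gammaBody)

/-- Compute half the input `n`, rounded up. -/
def halfCode : Prog :=
  .loop (.natLt (.add (v 6) (v 6)) (v 0)) (set 6 (.add (v 6) (.const 1)))

/-- Before pass `j` the variable `21` holds `2 ^ j * a`, so after the doubling it is the leading
term of the control length. Array `6` collects the seed lengths and array `8` the block counts `2 ^
j`. -/
def levelBody : Prog :=
  .seq (set 21 (.add (v 21) (v 21)))
  (.seq (.natSet 6 (.add (v 15) (.const 1))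
    (.add (.cell 6 (v 15)) (times 4608 (.add (.add (v 21) (v 3)) (v 4)))))
  (.seq (.natSet 8 (.add (v 15) (.const 1)) (.add (.cell 8 (v 15)) (.cell 8 (v 15))))
  (set 15 (.add (v 15) (.const 1)))))

/-- Compute the bit lengths of the seeds. -/
def levelCode : Prog :=
  .seq (.seq (set 21 (v 2)) (.seq (set 8 (.const 1)) (set 15 (.const 0))))
    (.loop (.natLt (v 15) (v 3)) levelBody)

/-- Add the digit in the variable `20` to the number in the variable `a`. -/
def addDigit (a : ℕ) : Prog :=
  .cond (.natLt (.const 0) (v 20)) (set a (.add (v a) (.cell 7 (v 16)))) .skip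

def coinTail : Prog :=
  .seq (.natSet 7 (.add (v 16) (.const 1)) (.add (.cell 7 (v 16)) (.cell 7 (v 16))))
    (set 16 (.add (v 16) (.const 1)))

def coinBody : Prog :=
  .seq (.toss 20 (.const 0)) (.seq (addDigit 9) (.seq (.toss 20 (.const 0))
    (.seq (addDigit 10) coinTail)))

/-- Toss the coins and compute the powers of two. -/
def coinCode : Prog :=
  .seq (.seq (set 7 (.const 1)) (set 16 (.const 0)))
    (.loop (.natLt (v 16) (.cell 6 (v 3))) coinBody)

def gridBody : Prog := .seq (rset 5 (.add (rv 5) (rv 4))) (set 15 (.add (v 15) (.const 1)))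

/-- Compute the side of the grid. -/
def gridCode : Prog :=
  .seq (.seq (rset 4 (.add (.add (rv 0) (rv 0)) (.add (rv 0) (rv 0))))
    (.seq (rset 5 (rv 4)) (set 15 (.const 0))))
    (.loop (.natLt (v 15) (.cell 0 (.const 2))) gridBody)

/-- The variables `2`, `3`, `4` receive `a`, `J`, `L`; the arrays `6`, `7`, `8` become tables of
seed lengths, powers of two and block counts; the variables `9` and `10` receive the seed, and the
real variables `4` and `5` the shift unit `4ε` and the side of the grid. -/
def initMain : Prog :=
  .seq (clogCode 2 (.add (.cell 0 (.const 2)) (.const 1)))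
  (.seq (clogCode 3 (.cell 0 (.const 1)))
  (.seq gammaCode (.seq halfCode (.seq levelCode (.seq coinCode gridCode)))))

/-- Move the digit number `16` of the number in the variable `p` to the cell `i` of the
array `q`. -/
def splitDigit (p q : ℕ) (i : NatExpr) : Prog :=
  .cond (.natLt (v p) (.cell 7 (v 16))) (.natSet q i (.const 0))
    (.seq (.natSet q i (.const 1)) (set p (.sub (v p) (.cell 7 (v 16)))))

def splitBody : Prog :=
  .seq (set 16 (.sub (v 16) (.const 1))) (.seq (splitDigit 12 18 (v 16)) (splitDigit 13 19 (v 16)))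

/-- Reduce the variable `p` modulo the size of the current torus. -/
def reduceCode (p : ℕ) : Prog :=
  .cond (.natLt (v p) (.cell 7 (.cell 6 (v 15)))) .skip
    (set p (.sub (v p) (.cell 7 (.cell 6 (v 15)))))

/-- The current vertex is in the variables `12` and `13`, the control bits are in the arrays `18`
and `19`, and the variable `16` points to the current control bit. One conditional subtraction
reduces modulo the size of the torus. -/
def walkBody : Prog :=
  .seq
    (.cond (.natLt (.const 0) (.cell 18 (v 16)))
      (.cond (.natLt (.const 0) (.cell 19 (v 16)))
        (.seq (set 13 (.add (v 12) (v 13))) (reduceCode 13))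
        (.seq (set 12 (.add (v 12) (.const 1))) (reduceCode 12)))
      (.cond (.natLt (.const 0) (.cell 19 (v 16)))
        (.seq (set 12 (.add (v 12) (v 13))) (reduceCode 12))
        .skip))
    (set 16 (.add (v 16) (.const 1)))

def splitLoop : Prog := .loop (.natLt (.cell 6 (v 15)) (v 16)) splitBody

def walkLoop : Prog := .loop (.natLt (v 16) (.cell 6 (.add (v 15) (.const 1)))) walkBody

def descendHead : Prog :=
  .seq (set 15 (.sub (v 15) (.const 1))) (set 16 (.cell 6 (.add (v 15) (.const 1))))

/-- One level of the recursion of `Inw.gen`. Digits above the lower level are split off as control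
bits, which leaves the low part; if the block index in the variable `14` lies in the second half,
the index is reduced and the walk is carried out. -/
def descendBody : Prog :=
  .seq descendHead (.seq splitLoop
    (.cond (.natLt (v 14) (.cell 8 (v 15))) .skip
      (.seq (set 14 (.sub (v 14) (.cell 8 (v 15)))) walkLoop)))

def askHead : Prog :=
  .seq (set 12 (v 9)) (.seq (set 13 (v 10)) (.seq (set 14 (v 11)) (set 15 (v 3))))

def descendLoop : Prog := .loop (.natLt (.const 0) (v 15)) descendBody

def queryBody : Prog :=
  .seq (set 16 (.sub (v 16) (.const 1)))
    (.seq (splitDigit 12 1 (.add (v 16) (v 16)))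
      (splitDigit 13 1 (.add (.add (v 16) (v 16)) (.const 1))))

def queryLoop : Prog := .loop (.natLt (.const 0) (v 16)) queryBody

def askMain : Prog :=
  .seq askHead (.seq descendLoop (.seq (set 16 (v 6)) (.seq queryLoop
    (set 11 (.add (v 11) (.const 1))))))

def roundBody : Prog :=
  .seq (.realSet 2 (v 15)
    (.roundDown (.sub (.add (.cell 1 (v 15)) (rv 6)) (rv 0)) (rv 5)))
  (.seq (.cond (.realLt (.cell 2 (v 15))
      (.roundDown (.add (.add (.cell 1 (v 15)) (rv 6)) (rv 0)) (rv 5)))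
    (set 17 (.const 0)) .skip)
  (set 15 (.add (v 15) (.const 1))))

def roundLoop : Prog := .loop (.natLt (v 15) (.cell 0 (.const 2))) roundBody

def shiftHead : Prog :=
  .seq (rset 6 (.add (rv 6) (rv 4))) (.seq (set 17 (.const 1)) (set 15 (.const 0)))

def shiftBody : Prog := .seq shiftHead roundLoop

/-- The shift starts at `-4ε` and the flag in the variable `17` at `0`, so that the first pass tests
the shift `0`. The loop stops at the first shift that leaves the flag at `1`, which is the least
good one. -/
def replyMain : Prog :=
  .seq (.seq (rset 6 (.sub .zero (rv 4))) (set 17 (.const 0)))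
    (.loop (.natLt (v 17) (.const 1)) shiftBody)

/-- The test that the input `d` is positive. -/
def dimPos : TestExpr := .natLt (.const 0) (.cell 0 (.const 2))

/-- The steward as a program. -/
def program : StewardProgram where
  init := .cond (.and (.natLt (.const 0) (.cell 0 (.const 1))) dimPos) initMain .skip
  ask := .cond dimPos askMain .skip
  reply := .cond dimPos replyMain .skip

end StewardCode

/-! ### Correctness of the initialization -/

namespace StewardCode

open Inw

/-- The ceiling of the binary logarithm is the number of doublings that `1` needs to reach `N`. The
hypothesis `he` expresses that `e` is not affected by the scratch variables. -/
lemma wp_clogCode {a : ℕ} (ha : a ≠ 5) {e : NatExpr} {N : ℕ} {s : MachineState}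
    (he : ∀ s', Same [5, a] [] s s' → e.eval s' = N) (h0 : s.nat a 0 = 0) :
    Wp (clogCode a e) ((set 5 (.const 1)).bound +
        (Nat.clog 2 N + 1) * ((TestExpr.natLt (v 5) e).cost + (doubleBody a).bound))
      (fun s' => Same [5, a] [] s s' ∧ s'.nat a 0 = Nat.clog 2 N) s := by
  have hlt (i : ℕ) : 2 ^ i < N ↔ i < Nat.clog 2 N :=
    (Nat.lt_clog_iff_pow_lt one_lt_two).symm
  refine (Prog.wp_of_straight (by simp [Prog.Straight, Prog.LoopFree, Prog.tosses])
    (Q := fun s' => Same [5, a] [] s s' ∧ s'.nat a 0 = 0 ∧ s'.nat 5 0 = 2 ^ 0) ?_).seq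
    fun s₁ h₁ => ?_
  · refine ⟨(Same.refl _ _ _).act (by simp [Prog.Straight, Prog.LoopFree, Prog.tosses])
      (by simp [Prog.Writes]), ?_⟩
    simp [Prog.act, NatExpr.eval, ha, h0]
  · refine (Wp.loop (fun i s' => Same [5, a] [] s s' ∧ s'.nat a 0 = i ∧ s'.nat 5 0 = 2 ^ i)
      (Nat.clog 2 N) ?_ ?_ h₁).mono le_rfl fun s' hs' => ⟨hs'.1, hs'.2.1⟩
    · rintro i hi s' ⟨h1, h2, h3⟩
      refine ⟨by simpa [TestExpr.Holds, NatExpr.eval, h3, he s' h1] using (hlt i).2 hi,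
        Prog.wp_of_straight (by simp [doubleBody, Prog.Straight, Prog.LoopFree, Prog.tosses])
          ⟨h1.act (by simp [doubleBody, Prog.Straight, Prog.LoopFree, Prog.tosses])
            (by simp [doubleBody, Prog.Writes]), ?_⟩⟩
      simp [doubleBody, Prog.act, NatExpr.eval, ha, ha.symm, h2, h3, pow_succ, mul_two]
    · rintro s' ⟨h1, h2, h3⟩
      simp [TestExpr.Holds, NatExpr.eval, h3, he s' h1, hlt]

/-- The test `2 ^ i * γ < 1` is equivalent to `2 ^ i < ⌈1 / γ⌉₊`, so doubling a real number computes
the logarithm without any division. -/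
lemma wp_gammaCode {γ : ℝ} (hγ : 0 < γ) {s : MachineState} (h0 : s.nat 4 0 = 0)
    (h1 : s.real 0 1 = γ) :
    Wp gammaCode ((rset 3 (.cell 0 (.const 1))).bound +
        (Nat.clog 2 ⌈1 / γ⌉₊ + 1) * ((TestExpr.realLt (rv 3) .one).cost + gammaBody.bound))
      (fun s' => Same [4] [3] s s' ∧ s'.nat 4 0 = Nat.clog 2 ⌈1 / γ⌉₊) s := by
  have hlt (i : ℕ) : 2 ^ i * γ < 1 ↔ i < Nat.clog 2 ⌈1 / γ⌉₊ := by
    rw [Nat.lt_clog_iff_pow_lt one_lt_two, Nat.lt_ceil, lt_div_iff₀ hγ]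
    push_cast
    rfl
  refine (Prog.wp_of_straight (by simp [Prog.Straight, Prog.LoopFree, Prog.tosses])
    (Q := fun s' => Same [4] [3] s s' ∧ s'.nat 4 0 = 0 ∧ s'.real 3 0 = 2 ^ 0 * γ) ?_).seq
    fun s₁ h₁ => ?_
  · refine ⟨(Same.refl _ _ _).act (by simp [Prog.Straight, Prog.LoopFree, Prog.tosses])
      (by simp [Prog.Writes]), ?_⟩
    simp [Prog.act, NatExpr.eval, RealExpr.eval, h0, h1]
  · refine (Wp.loop (fun i s' => Same [4] [3] s s' ∧ s'.nat 4 0 = i ∧ s'.real 3 0 = 2 ^ i * γ)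
      (Nat.clog 2 ⌈1 / γ⌉₊) ?_ ?_ h₁).mono le_rfl fun s' hs' => ⟨hs'.1, hs'.2.1⟩
    · rintro i hi s' ⟨h1, h2, h3⟩
      refine ⟨by simpa [TestExpr.Holds, NatExpr.eval, RealExpr.eval, h3] using (hlt i).2 hi,
        Prog.wp_of_straight (by simp [gammaBody, Prog.Straight, Prog.LoopFree, Prog.tosses])
          ⟨h1.act (by simp [gammaBody, Prog.Straight, Prog.LoopFree, Prog.tosses])
            (by simp [gammaBody, Prog.Writes]), ?_⟩⟩
      simp [gammaBody, Prog.act, NatExpr.eval, RealExpr.eval, h2, h3]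
      ring
    · rintro s' ⟨h1, h2, h3⟩
      have := (hlt (Nat.clog 2 ⌈1 / γ⌉₊)).not
      simpa [TestExpr.Holds, NatExpr.eval, RealExpr.eval, h3] using this

lemma wp_halfCode {n : ℕ} {s : MachineState} (h0 : s.nat 6 0 = 0) (h1 : s.nat 0 0 = n) :
    Wp halfCode (((n + 1) / 2 + 1) * ((TestExpr.natLt (.add (v 6) (v 6)) (v 0)).cost +
        (set 6 (.add (v 6) (.const 1))).bound))
      (fun s' => Same [6] [] s s' ∧ s'.nat 6 0 = (n + 1) / 2) s := by
  refine Wp.loop (fun i s' => Same [6] [] s s' ∧ s'.nat 6 0 = i) ((n + 1) / 2) ?_ ?_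
    ⟨Same.refl _ _ _, h0⟩
  · rintro i hi s' ⟨h2, h3⟩
    refine ⟨?_, Prog.wp_of_straight (by simp [Prog.Straight, Prog.LoopFree, Prog.tosses])
      ⟨h2.act (by simp [Prog.Straight, Prog.LoopFree, Prog.tosses])
      (by simp [Prog.Writes]), ?_⟩⟩
    · simp only [TestExpr.Holds, NatExpr.eval, h3, h2.nat 0 (by simp), h1]
      omega
    · simp [Prog.act, NatExpr.eval, h3]
  · rintro s' ⟨h2, h3⟩
    simp only [TestExpr.Holds, NatExpr.eval, h3, h2.nat 0 (by simp), h1]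
    omega

/-- The control lengths. -/
def ctl (a J L : ℕ) (j : ℕ) : ℕ := 2 ^ (j + 1) * a + J + L

lemma wp_levelCode {a J L b₀ : ℕ} {s : MachineState} (h2 : s.nat 2 0 = a) (h3 : s.nat 3 0 = J)
    (h4 : s.nat 4 0 = L) (h6 : s.nat 6 0 = b₀) :
    Wp levelCode ((Prog.seq (set 21 (v 2)) (.seq (set 8 (.const 1)) (set 15 (.const 0)))).bound +
        (J + 1) * ((TestExpr.natLt (v 15) (v 3)).cost + levelBody.bound))
      (fun s' => Same [6, 8, 15, 21] [] s s' ∧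
        (∀ j ≤ J, s'.nat 6 j = level b₀ (ctl a J L) j) ∧ ∀ j ≤ J, s'.nat 8 j = 2 ^ j) s := by
  refine (Prog.wp_of_straight (by simp [Prog.Straight, Prog.LoopFree, Prog.tosses])
    (Q := fun s' => Same [6, 8, 15, 21] [] s s' ∧ s'.nat 15 0 = 0 ∧ s'.nat 21 0 = 2 ^ 0 * a ∧
      (∀ j ≤ 0, s'.nat 6 j = level b₀ (ctl a J L) j) ∧ ∀ j ≤ 0, s'.nat 8 j = 2 ^ j) ?_).seq
    fun s₁ h₁ => ?_
  · refine ⟨(Same.refl _ _ _).act (by simp [Prog.Straight, Prog.LoopFree, Prog.tosses])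
      (by simp [Prog.Writes]), ?_⟩
    simp [Prog.act, NatExpr.eval, h2, h6, level]
  · refine (Wp.loop (fun i s' => Same [6, 8, 15, 21] [] s s' ∧ s'.nat 15 0 = i ∧
      s'.nat 21 0 = 2 ^ i * a ∧
      (∀ j ≤ i, s'.nat 6 j = level b₀ (ctl a J L) j) ∧ ∀ j ≤ i, s'.nat 8 j = 2 ^ j)
      J ?_ ?_ h₁).mono le_rfl fun s' hs' => ⟨hs'.1, hs'.2.2.2⟩
    · rintro i hi s' ⟨g1, g2, g3, g4, g5⟩
      refine ⟨by simpa [TestExpr.Holds, NatExpr.eval, g2, g1.nat 3, h3] using hi,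
        Prog.wp_of_straight (by simp [levelBody, Prog.Straight, Prog.LoopFree, Prog.tosses])
          ⟨g1.act (by simp [levelBody, Prog.Straight, Prog.LoopFree, Prog.tosses])
            (by simp [levelBody, Prog.Writes]), ?_⟩⟩
      simp only [levelBody, Prog.act, NatExpr.eval, eval_times, MachineState.setNat_nat]
      simp [g2, g3, g4, g5, g1.nat 3, g1.nat 4, h3, h4]
      refine ⟨by ring, fun j hj => ?_, fun j hj => ?_⟩
      · split_ifs with h
        · subst h
          simp only [level, ctl]
          ring
        · exact g4 j (by omega)
      · split_ifs with h
        · subst h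
          ring
        · exact g5 j (by omega)
    · rintro s' ⟨g1, g2, g3, g4⟩
      simp [TestExpr.Holds, NatExpr.eval, g2, g1.nat 3, h3]

lemma mod_two_pow_succ (x i : ℕ) :
    x % 2 ^ (i + 1) = x % 2 ^ i + 2 ^ i * (x.testBit i).toNat := by
  rw [Nat.mod_pow_succ, Nat.toNat_testBit]

/-- After `i` passes `2 * i` coins are spent and the variables `9` and `10` hold the seed modulo `2
^ i`. Coins alternate between the two numbers, matching the interleaving in `seedOf`. -/
lemma wp_coinCode {J b : ℕ} {x : Bits (2 * b)} {s : MachineState} (h3 : s.nat 3 0 = J)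
    (h6 : s.nat 6 J = b) (h9 : s.nat 9 0 = 0) (h10 : s.nat 10 0 = 0)
    (hc : s.coins = List.ofFn x) :
    Wp coinCode ((Prog.seq (set 7 (.const 1)) (set 16 (.const 0))).bound +
        (b + 1) * ((TestExpr.natLt (v 16) (.cell 6 (v 3))).cost + coinBody.bound))
      (fun s' => (∀ a ∉ [7, 9, 10, 16, 20], s'.nat a = s.nat a) ∧ s'.real = s.real ∧
        s'.nat 9 0 = (seedOf x).1 ∧ s'.nat 10 0 = (seedOf x).2 ∧ ∀ t ≤ b, s'.nat 7 t = 2 ^ t)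
      s := by
  set I : ℕ → MachineState → Prop := fun i s' =>
    (∀ a ∉ [7, 9, 10, 16, 20], s'.nat a = s.nat a) ∧ s'.real = s.real ∧
        s'.nat 9 0 = (seedOf x).1 % 2 ^ i ∧ s'.nat 10 0 = (seedOf x).2 % 2 ^ i ∧
        s'.nat 16 0 = i ∧ (∀ t ≤ i, s'.nat 7 t = 2 ^ t) ∧
        s'.coins = (List.ofFn x).drop (2 * i) with hI
  refine (Prog.wp_of_straight (by simp [Prog.Straight, Prog.LoopFree, Prog.tosses])
    (Q := I 0) ?_).seq fun s₁ h₁ => ?_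
  · refine ⟨fun a ha => Prog.Writes.nat_act (rs := []) (by simp [Prog.Writes]) s ha, rfl, ?_⟩
    simp [Prog.act, NatExpr.eval, h9, h10, hc, Nat.mod_one]
  · refine (Wp.loop I b ?_ ?_ h₁).mono le_rfl fun s' hs' => ?_
    · rintro i hi s' ⟨g1, g2, g3, g4, g5, g6, g7⟩
      have e3 : s'.nat 3 = s.nat 3 := g1 3 (by simp)
      have e6 : s'.nat 6 = s.nat 6 := g1 6 (by simp)
      refine ⟨by simpa [TestExpr.Holds, NatExpr.eval, g5, e3, e6, h3, h6] using hi, ?_⟩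
      have t1 : (seedOf x).1.testBit i = x ⟨2 * i, by omega⟩ := Nat.testBit_ofBits_lt _ _ hi
      have t2 : (seedOf x).2.testBit i = x ⟨2 * i + 1, by omega⟩ := Nat.testBit_ofBits_lt _ _ hi
      have hcoins : s'.coins = x ⟨2 * i, by omega⟩ :: x ⟨2 * i + 1, by omega⟩ ::
          (List.ofFn x).drop (2 * (i + 1)) := by
        rw [g7, List.drop_eq_getElem_cons (by simp; omega),
          List.drop_eq_getElem_cons (by simp; omega)]
        simp [mul_add]
      have m1 := mod_two_pow_succ (seedOf x).1 i
      have m2 := mod_two_pow_succ (seedOf x).2 i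
      rw [t1, ← g3] at m1
      rw [t2, ← g4] at m2
      refine Prog.wp_of_loopFree
        (by simp [coinBody, addDigit, coinTail, Prog.LoopFree])
        (by simp [coinBody, addDigit, coinTail, Prog.tosses, hcoins]) ?_
      refine ⟨fun a ha => ?_, ?_, ?_⟩
      · rw [← g1 a ha]
        exact Prog.Writes.nat_act (rs := []) (by
          simp [coinBody, addDigit, coinTail, Prog.Writes]) s' ha
      · rw [← g2]
        funext a
        exact Prog.Writes.real_act (as := [7, 9, 10, 16, 20]) (rs := []) (by
          simp [coinBody, addDigit, coinTail, Prog.Writes]) s' (by simp)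
      · rw [m1, m2]
        have g6' : s'.nat 7 i = 2 ^ i := g6 i le_rfl
        cases hy : x ⟨2 * i, by omega⟩ <;> cases hz : x ⟨2 * i + 1, by omega⟩ <;>
          · simp [coinBody, addDigit, coinTail, Prog.act, NatExpr.eval, TestExpr.Holds, hcoins,
              hy, hz, g5, g6']
            intro t ht
            split_ifs with h
            · subst h; ring
            · exact g6 t (by omega)
    · rintro s' ⟨g1, g2, g3, g4, g5, g6, g7⟩
      simp [TestExpr.Holds, NatExpr.eval, g5, g1 3, g1 6, h3, h6]
    · obtain ⟨g1, g2, g3, g4, g5, g6, g7⟩ := hs'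
      rw [Nat.mod_eq_of_lt (seedOf_lt x).1] at g3
      rw [Nat.mod_eq_of_lt (seedOf_lt x).2] at g4
      exact ⟨g1, g2, g3, g4, g6⟩

lemma wp_gridCode {d : ℕ} {ε : ℝ} {s : MachineState} (h0 : s.nat 0 2 = d) (h1 : s.real 0 0 = ε) :
    Wp gridCode ((Prog.seq (rset 4 (.add (.add (rv 0) (rv 0)) (.add (rv 0) (rv 0))))
        (.seq (rset 5 (rv 4)) (set 15 (.const 0)))).bound +
        (d + 1) * ((TestExpr.natLt (v 15) (.cell 0 (.const 2))).cost + gridBody.bound))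
      (fun s' => Same [15] [4, 5] s s' ∧ s'.real 4 0 = 4 * ε ∧
        s'.real 5 0 = Rounding.grid d ε) s := by
  refine (Prog.wp_of_straight (by simp [Prog.Straight, Prog.LoopFree, Prog.tosses])
    (Q := fun s' => Same [15] [4, 5] s s' ∧ s'.nat 15 0 = 0 ∧ s'.real 4 0 = 4 * ε ∧
      s'.real 5 0 = Rounding.grid 0 ε) ?_).seq fun s₁ h₁ => ?_
  · refine ⟨(Same.refl _ _ _).act (by simp [Prog.Straight, Prog.LoopFree, Prog.tosses])
      (by simp [Prog.Writes]), ?_⟩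
    simp [Prog.act, NatExpr.eval, RealExpr.eval, h1, Rounding.grid]
    ring
  · refine (Wp.loop (fun i s' => Same [15] [4, 5] s s' ∧ s'.nat 15 0 = i ∧
      s'.real 4 0 = 4 * ε ∧ s'.real 5 0 = Rounding.grid i ε) d ?_ ?_ h₁).mono le_rfl
      fun s' hs' => ⟨hs'.1, hs'.2.2⟩
    · rintro i hi s' ⟨g1, g2, g3, g4⟩
      refine ⟨by simpa [TestExpr.Holds, NatExpr.eval, g2, g1.nat 0, h0] using hi,
        Prog.wp_of_straight (by simp [gridBody, Prog.Straight, Prog.LoopFree, Prog.tosses])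
          ⟨g1.act (by simp [gridBody, Prog.Straight, Prog.LoopFree, Prog.tosses])
            (by simp [gridBody, Prog.Writes]), ?_⟩⟩
      simp [gridBody, Prog.act, NatExpr.eval, RealExpr.eval, g2, g3, g4, Rounding.grid]
      ring
    · rintro s' ⟨g1, g2, g3⟩
      simp [TestExpr.Holds, NatExpr.eval, g2, g1.nat 0, h0]

/-- The state after the initialization and `i` rounds. -/
structure Ready (b₀ d J : ℕ) (c : ℕ → ℕ) (ε : ℝ) (w : ℕ × ℕ) (i : ℕ) (s : MachineState) :
    Prop where
  dim : s.nat 0 2 = d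
  depth : s.nat 3 0 = J
  levels : ∀ j ≤ J, s.nat 6 j = level b₀ c j
  powers : ∀ t ≤ level b₀ c J, s.nat 7 t = 2 ^ t
  sizes : ∀ j ≤ J, s.nat 8 j = 2 ^ j
  seedX : s.nat 9 0 = w.1
  seedY : s.nat 10 0 = w.2
  round : s.nat 11 0 = i
  eps : s.real 0 0 = ε
  step : s.real 4 0 = 4 * ε
  side : s.real 5 0 = Rounding.grid d ε

/-- A constant for the running time of the initialization. -/
def initConst : ℕ :=
  (set 5 (.const 1)).bound + ((TestExpr.natLt (v 5) (.add (.cell 0 (.const 2)) (.const 1))).cost +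
    (doubleBody 2).bound) +
  ((set 5 (.const 1)).bound + ((TestExpr.natLt (v 5) (.cell 0 (.const 1))).cost +
    (doubleBody 3).bound)) +
  ((rset 3 (.cell 0 (.const 1))).bound + ((TestExpr.realLt (rv 3) .one).cost + gammaBody.bound)) +
  ((TestExpr.natLt (.add (v 6) (v 6)) (v 0)).cost + (set 6 (.add (v 6) (.const 1))).bound) +
  ((Prog.seq (set 21 (v 2)) (.seq (set 8 (.const 1)) (set 15 (.const 0)))).bound +
    ((TestExpr.natLt (v 15) (v 3)).cost + levelBody.bound)) +
  ((Prog.seq (set 7 (.const 1)) (set 16 (.const 0))).bound +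
    ((TestExpr.natLt (v 16) (.cell 6 (v 3))).cost + coinBody.bound)) +
  ((Prog.seq (rset 4 (.add (.add (rv 0) (rv 0)) (.add (rv 0) (rv 0))))
    (.seq (rset 5 (rv 4)) (set 15 (.const 0)))).bound +
    ((TestExpr.natLt (v 15) (.cell 0 (.const 2))).cost + gridBody.bound))

lemma monotone_level (b₀ : ℕ) (c : ℕ → ℕ) : Monotone (level b₀ c) :=
  monotone_nat_of_le_succ fun j => by simp [level]

/-- Here `p` is a fixed cost and `q` the cost of one pass of a loop; a common bound `M` on all pass
counts lets the phases be added. -/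
lemma le_mul_of_parts {p q N M : ℕ} (h : N ≤ M) : p + (N + 1) * q ≤ (p + q) * (M + 1) := by
  nlinarith [Nat.zero_le p, Nat.zero_le q, Nat.mul_le_mul_right q h, Nat.zero_le (p * M)]

lemma wp_initMain {n k d : ℕ} {ε γ : ℝ} (hγ : 0 < γ) {a J L b₀ M : ℕ}
    (ha : a = Nat.clog 2 (d + 1)) (hJ : J = Nat.clog 2 k) (hL : L = Nat.clog 2 ⌈1 / γ⌉₊)
    (hb : b₀ = (n + 1) / 2) (x : Bits (2 * level b₀ (ctl a J L) J))
    (hM : a ≤ M ∧ J ≤ M ∧ L ≤ M ∧ b₀ ≤ M ∧ level b₀ (ctl a J L) J ≤ M ∧ d ≤ M) :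
    Wp initMain (initConst * (M + 1))
      (Ready b₀ d J (ctl a J L) ε (seedOf x) 0) (initialState n k d ε γ x) := by
  obtain ⟨m1, m2, m3, m4, m5, m6⟩ := hM
  have hT : ∀ {p₁ p₂ p₃ p₄ p₅ p₆ q₁ q₂ q₃ q₄ q₅ q₆ q₇ : ℕ},
      (p₁ + (a + 1) * q₁) + ((p₂ + (J + 1) * q₂) + ((p₃ + (L + 1) * q₃) + ((b₀ + 1) * q₄ +
        ((p₄ + (J + 1) * q₅) + ((p₅ + (level b₀ (ctl a J L) J + 1) * q₆) +
        (p₆ + (d + 1) * q₇)))))) ≤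
      (p₁ + q₁ + (p₂ + q₂) + (p₃ + q₃) + q₄ + (p₄ + q₅) + (p₅ + q₆) + (p₆ + q₇)) * (M + 1) := by
    intro p₁ p₂ p₃ p₄ p₅ p₆ q₁ q₂ q₃ q₄ q₅ q₆ q₇
    have r1 := le_mul_of_parts (p := p₁) (q := q₁) m1
    have r2 := le_mul_of_parts (p := p₂) (q := q₂) m2
    have r3 := le_mul_of_parts (p := p₃) (q := q₃) m3
    have r4 := le_mul_of_parts (p := 0) (q := q₄) m4
    have r5 := le_mul_of_parts (p := p₄) (q := q₅) m2
    have r6 := le_mul_of_parts (p := p₅) (q := q₆) m5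
    have r7 := le_mul_of_parts (p := p₆) (q := q₇) m6
    simp only [add_mul _ _ (M + 1)] at *
    omega
  set s₀ := initialState n k d ε γ x with hs₀
  refine Wp.mono ((wp_clogCode (N := d + 1) (by norm_num) ?_ rfl).seq fun s₁ h₁ =>
    (wp_clogCode (N := k) (by norm_num) ?_ ?_).seq fun s₂ h₂ =>
    (wp_gammaCode (γ := γ) hγ ?_ ?_).seq fun s₃ h₃ =>
    (wp_halfCode (n := n) ?_ ?_).seq fun s₄ h₄ =>
    (wp_levelCode (a := a) (J := J) (L := L) (b₀ := b₀) ?_ ?_ ?_ ?_).seq fun s₅ h₅ =>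
    (wp_coinCode (J := J) (x := x) ?_ ?_ ?_ ?_ ?_).seq fun s₆ h₆ =>
    (wp_gridCode (d := d) (ε := ε) ?_ ?_).mono le_rfl fun s₇ h₇ => ?_)
    (by rw [← ha, ← hJ, ← hL, ← hb]; exact hT) (fun _ h => h)
  · intro s' h
    simp [NatExpr.eval, h.nat 0, hs₀, initialState]
  · intro s' h
    simp [NatExpr.eval, h.nat 0, h₁.1.nat 0, hs₀, initialState]
  · simp [h₁.1.nat 3, hs₀, initialState]
  · simp [h₂.1.nat 4, h₁.1.nat 4, hs₀, initialState]
  · simp [h₂.1.real 0, h₁.1.real 0, hs₀, initialState]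
  · simp [h₃.1.nat 6, h₂.1.nat 6, h₁.1.nat 6, hs₀, initialState]
  · simp [h₃.1.nat 0, h₂.1.nat 0, h₁.1.nat 0, hs₀, initialState]
  · simp [h₄.1.nat 2, h₃.1.nat 2, h₂.1.nat 2, h₁.2, ha]
  · simp [h₄.1.nat 3, h₃.1.nat 3, h₂.2, hJ]
  · simp [h₄.1.nat 4, h₃.2, hL]
  · simp [h₄.2, hb]
  · simp [h₅.1.nat 3, h₄.1.nat 3, h₃.1.nat 3, h₂.2, hJ]
  · exact h₅.2.1 J le_rfl
  · simp [h₅.1.nat 9, h₄.1.nat 9, h₃.1.nat 9, h₂.1.nat 9, h₁.1.nat 9, hs₀, initialState]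
  · simp [h₅.1.nat 10, h₄.1.nat 10, h₃.1.nat 10, h₂.1.nat 10, h₁.1.nat 10, hs₀, initialState]
  · rw [h₅.1.coins, h₄.1.coins, h₃.1.coins, h₂.1.coins, h₁.1.coins, hs₀, initialState]
  · simp [h₆.1 0, h₅.1.nat 0, h₄.1.nat 0, h₃.1.nat 0, h₂.1.nat 0, h₁.1.nat 0, hs₀, initialState]
  · simp [h₆.2.1, h₅.1.real 0, h₄.1.real 0, h₃.1.real 0, h₂.1.real 0, h₁.1.real 0, hs₀,
      initialState]
  · refine ⟨?_, ?_, ?_, ?_, ?_, ?_, ?_, ?_, ?_, h₇.2.1, h₇.2.2⟩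
    · simp [h₇.1.nat 0, h₆.1 0, h₅.1.nat 0, h₄.1.nat 0, h₃.1.nat 0, h₂.1.nat 0, h₁.1.nat 0, hs₀,
        initialState]
    · simp [h₇.1.nat 3, h₆.1 3, h₅.1.nat 3, h₄.1.nat 3, h₃.1.nat 3, h₂.2, hJ]
    · intro j hj
      rw [h₇.1.nat 6 (by simp), h₆.1 6 (by simp), h₅.2.1 j hj]
    · intro t ht
      rw [h₇.1.nat 7 (by simp), h₆.2.2.2.2 t ht]
    · intro j hj
      rw [h₇.1.nat 8 (by simp), h₆.1 8 (by simp), h₅.2.2 j hj]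
    · rw [h₇.1.nat 9 (by simp), h₆.2.2.1]
    · rw [h₇.1.nat 10 (by simp), h₆.2.2.2.1]
    · simp [h₇.1.nat 11, h₆.1 11, h₅.1.nat 11, h₄.1.nat 11, h₃.1.nat 11, h₂.1.nat 11, h₁.1.nat 11,
        hs₀, initialState]
    · simp [h₇.1.real 0, h₆.2.1, h₅.1.real 0, h₄.1.real 0, h₃.1.real 0, h₂.1.real 0, h₁.1.real 0,
        hs₀, initialState]

end StewardCode

/-! ### Correctness of a query and of an output -/

namespace StewardCode

open Inw

/-- The arrays that are changed while a query point is computed. -/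
abbrev askArrays : List ℕ := [1, 12, 13, 14, 15, 16, 18, 19]

section Ask

variable {b₀ d J : ℕ} {c : ℕ → ℕ} {ε : ℝ} {w : ℕ × ℕ} {i₀ : ℕ} {s₀ : MachineState}

/-- Digits are read from the top by comparing with a power of two and subtracting it, so the
remainders in the variables `12` and `13` are always the original numbers modulo a power of two. -/
lemma wp_splitLoop (hR : Ready b₀ d J c ε w i₀ s₀) {s : MachineState}
    (hs : Same askArrays [] s₀ s) {j ii P Q : ℕ} (hj : j < J) (h14 : s.nat 14 0 = ii)
    (h15 : s.nat 15 0 = j) (h16 : s.nat 16 0 = level b₀ c (j + 1)) (h12 : s.nat 12 0 = P)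
    (h13 : s.nat 13 0 = Q) (hP : P < 2 ^ level b₀ c (j + 1)) (hQ : Q < 2 ^ level b₀ c (j + 1)) :
    Wp splitLoop ((level b₀ c J + 1) *
        ((TestExpr.natLt (.cell 6 (v 15)) (v 16)).cost + splitBody.bound))
      (fun s' => Same askArrays [] s₀ s' ∧ s'.nat 14 0 = ii ∧ s'.nat 15 0 = j ∧
        s'.nat 16 0 = level b₀ c j ∧ s'.nat 12 0 = P % 2 ^ level b₀ c j ∧
        s'.nat 13 0 = Q % 2 ^ level b₀ c j ∧
        ∀ u, level b₀ c j ≤ u → u < level b₀ c (j + 1) →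
          s'.nat 18 u = (P.testBit u).toNat ∧ s'.nat 19 u = (Q.testBit u).toNat) s := by
  have hlev : level b₀ c (j + 1) = level b₀ c j + 4608 * c j := rfl
  have hle : level b₀ c (j + 1) ≤ level b₀ c J := monotone_level b₀ c hj
  set b := level b₀ c j with hb
  set r := 4608 * c j
  refine (Wp.loop (fun e s' => Same askArrays [] s₀ s' ∧ s'.nat 14 0 = ii ∧ s'.nat 15 0 = j ∧
        s'.nat 16 0 = b + r - e ∧ s'.nat 12 0 = P % 2 ^ (b + r - e) ∧
        s'.nat 13 0 = Q % 2 ^ (b + r - e) ∧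
        ∀ u, b + r - e ≤ u → u < b + r →
          s'.nat 18 u = (P.testBit u).toNat ∧ s'.nat 19 u = (Q.testBit u).toNat)
    r ?_ ?_ ?_).mono (Nat.mul_le_mul_right _ (by omega)) fun s' hs' => ?_
  · rintro e he s' ⟨g1, g2, g3, g4, g5, g6, g7⟩
    obtain ⟨t, ht⟩ : ∃ t, b + r - e = t + 1 := ⟨b + r - e - 1, by omega⟩
    have ht' : b + r - (e + 1) = t := by omega
    rw [ht] at g4 g5 g6 g7
    have e6 : s'.nat 6 j = b := by rw [g1.nat 6 (by simp), hR.levels j hj.le]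
    have e7 : s'.nat 7 t = 2 ^ t := by rw [g1.nat 7 (by simp), hR.powers t (by omega)]
    rw [mod_two_pow_succ] at g5 g6
    have lP : P % 2 ^ t < 2 ^ t := Nat.mod_lt _ (by positivity)
    have lQ : Q % 2 ^ t < 2 ^ t := Nat.mod_lt _ (by positivity)
    refine ⟨?_, Prog.wp_of_straight
      (by simp [splitBody, splitDigit, Prog.Straight, Prog.LoopFree, Prog.tosses])
      ⟨g1.act (by simp [splitBody, splitDigit, Prog.Straight, Prog.LoopFree, Prog.tosses])
        (by simp [splitBody, splitDigit, Prog.Writes]), ?_⟩⟩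
    · simp only [TestExpr.Holds, NatExpr.eval, g3, g4, e6]
      omega
    · rw [ht']
      have hu (u : ℕ) (h1 : t ≤ u) (h2 : u < b + r) (h3 : u ≠ t) := g7 u (by omega) h2
      cases hy : P.testBit t <;> cases hz : Q.testBit t <;>
        · rw [hy] at g5
          rw [hz] at g6
          simp only [Bool.toNat_false, Bool.toNat_true, mul_zero, mul_one, add_zero] at g5 g6
          simp [splitBody, splitDigit, Prog.act, NatExpr.eval, TestExpr.Holds, g2, g3, g4, g5, g6,
            e7, lP, lQ]
          intro u h1 h2
          by_cases h3 : u = t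
          · subst h3
            simp [hy, hz]
          · simpa [h3] using hu u h1 h2 h3
  · rintro s' ⟨g1, g2, g3, g4, -⟩
    have e6 : s'.nat 6 j = b := by rw [g1.nat 6 (by simp), hR.levels j hj.le]
    simp only [TestExpr.Holds, NatExpr.eval, g3, g4, e6]
    omega
  · simp only [Nat.sub_zero]
    rw [hlev] at hP hQ
    refine ⟨hs, h14, h15, h16, ?_, ?_, fun u h1 h2 => by omega⟩
    · rw [h12, Nat.mod_eq_of_lt hP]
    · rw [h13, Nat.mod_eq_of_lt hQ]
  · simpa [hlev] using hs'

lemma mod_of_lt_two_mul {x N : ℕ} (h : x < 2 * N) : x % N = if x < N then x else x - N := by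
  split_ifs with h'
  · exact Nat.mod_eq_of_lt h'
  · rw [Nat.mod_eq_sub_mod (by omega), Nat.mod_eq_of_lt (by omega)]

lemma wp_walkLoop (hR : Ready b₀ d J c ε w i₀ s₀) {s : MachineState}
    (hs : Same askArrays [] s₀ s) {j ii : ℕ} {z : ℕ × ℕ} (hj : j < J) (h14 : s.nat 14 0 = ii)
    (h15 : s.nat 15 0 = j) (h16 : s.nat 16 0 = level b₀ c j)
    (h12 : s.nat 12 0 = z.1 % 2 ^ level b₀ c j) (h13 : s.nat 13 0 = z.2 % 2 ^ level b₀ c j)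
    (hz : ∀ u, level b₀ c j ≤ u → u < level b₀ c (j + 1) →
          s.nat 18 u = (z.1.testBit u).toNat ∧ s.nat 19 u = (z.2.testBit u).toNat) :
    Wp walkLoop ((level b₀ c J + 1) *
        ((TestExpr.natLt (v 16) (.cell 6 (.add (v 15) (.const 1)))).cost + walkBody.bound))
      (fun s' => Same askArrays [] s₀ s' ∧ s'.nat 14 0 = ii ∧ s'.nat 15 0 = j ∧
        s'.nat 12 0 = (walk (level b₀ c j) z (4608 * c j)).1 ∧
        s'.nat 13 0 = (walk (level b₀ c j) z (4608 * c j)).2) s := by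
  have hlev : level b₀ c (j + 1) = level b₀ c j + 4608 * c j := rfl
  have hle : level b₀ c (j + 1) ≤ level b₀ c J := monotone_level b₀ c hj
  have hR6 : s₀.nat 6 (j + 1) = level b₀ c (j + 1) := hR.levels (j + 1) hj
  set b := level b₀ c j with hb
  set r := 4608 * c j
  refine (Wp.loop (fun e s' => (Same askArrays [] s₀ s' ∧ s'.nat 18 = s.nat 18 ∧
        s'.nat 19 = s.nat 19) ∧ s'.nat 14 0 = ii ∧ s'.nat 15 0 = j ∧
        s'.nat 16 0 = b + e ∧ s'.nat 12 0 = (walk b z e).1 ∧ s'.nat 13 0 = (walk b z e).2)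
    r ?_ ?_ ?_).mono (Nat.mul_le_mul_right _ (by omega)) fun s' hs' => ?_
  · rintro e he s' ⟨⟨g1, g18, g19⟩, g2, g3, g4, g5, g6⟩
    have e6 : s'.nat 6 (j + 1) = b + r := by rw [g1.nat 6 (by simp), hR6, hlev]
    have e6' : s'.nat 6 j = b := by rw [g1.nat 6 (by simp), hR.levels j hj.le]
    have e7 : s'.nat 7 b = 2 ^ b := by rw [g1.nat 7 (by simp), hR.powers b (by omega)]
    have hz' := hz (b + e) (by omega) (by omega)
    rw [← g18, ← g19] at hz'
    obtain ⟨l1, l2⟩ := walk_lt b z e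
    have hst : walkBody.Straight := by
      simp [walkBody, reduceCode, Prog.Straight, Prog.LoopFree, Prog.tosses]
    have hwr : walkBody.Writes [12, 13, 16] [] := by simp [walkBody, reduceCode, Prog.Writes]
    refine ⟨?_, Prog.wp_of_straight hst
      ⟨⟨g1.trans (((Same.refl _ _ _).act hst hwr).mono (by simp) (by simp)), ?_, ?_⟩, ?_⟩⟩
    · simp only [TestExpr.Holds, NatExpr.eval, g3, g4, e6]
      omega
    · rw [hwr.nat_act s' (by simp), g18]
    · rw [hwr.nat_act s' (by simp), g19]
    · rw [walk]
      generalize walk b z e = y at *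
      -- Both coordinates are below `2 ^ b`, so every sum that occurs is below `2 * 2 ^ b` and a
      -- single subtraction reduces it.
      have m1 := mod_of_lt_two_mul (x := y.1 + 1) (N := 2 ^ b) (by omega)
      have m2 := mod_of_lt_two_mul (x := y.1 + y.2) (N := 2 ^ b) (by omega)
      cases hp : z.1.testBit (b + e) <;> cases hq : z.2.testBit (b + e) <;>
        · rw [hp, hq] at hz'
          simp only [Bool.toNat_false, Bool.toNat_true] at hz'
          simp [walkBody, reduceCode, Prog.act, NatExpr.eval, TestExpr.Holds, walkStep, g2, g3, g4,
            g5, g6, hz', e6', e7, m1, m2]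
          try (split_ifs <;> simp [*, add_assoc])
          try omega
  · rintro s' ⟨⟨g1, g18, g19⟩, g2, g3, g4, g5, g6⟩
    have e6 : s'.nat 6 (j + 1) = b + r := by rw [g1.nat 6 (by simp), hR6, hlev]
    simp [TestExpr.Holds, NatExpr.eval, g3, g4, e6]
  · exact ⟨⟨hs, rfl, rfl⟩, h14, h15, h16, h12, h13⟩
  · exact ⟨hs'.1.1, hs'.2.1, hs'.2.2.1, hs'.2.2.2.2⟩

/-- A constant for the running time of one level of the descent. -/
def descendConst : ℕ :=
  descendHead.bound + ((TestExpr.natLt (.cell 6 (v 15)) (v 16)).cost + splitBody.bound) +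
    (TestExpr.natLt (v 14) (.cell 8 (v 15))).cost + (set 14 (.sub (v 14) (.cell 8 (v 15)))).bound +
    ((TestExpr.natLt (v 16) (.cell 6 (.add (v 15) (.const 1)))).cost + walkBody.bound)

/-- The invariant is that block `14` of the current seed at level `J - e` is the requested block of
the full seed; at level `0` the seed is the block itself. -/
lemma wp_descendLoop (hR : Ready b₀ d J c ε w i₀ s₀) {s : MachineState}
    (hs : Same askArrays [] s₀ s) (h14 : s.nat 14 0 = i₀) (h15 : s.nat 15 0 = J)
    (h12 : s.nat 12 0 = w.1) (h13 : s.nat 13 0 = w.2) (hi : i₀ < 2 ^ J)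
    (hw1 : w.1 < 2 ^ level b₀ c J) (hw2 : w.2 < 2 ^ level b₀ c J) :
    Wp descendLoop ((J + 1) * ((TestExpr.natLt (.const 0) (v 15)).cost +
        descendConst * (level b₀ c J + 1)))
      (fun s' => Same askArrays [] s₀ s' ∧
        (s'.nat 12 0, s'.nat 13 0) = gen b₀ c J w i₀ ∧ s'.nat 12 0 < 2 ^ b₀ ∧
        s'.nat 13 0 < 2 ^ b₀) s := by
  refine (Wp.loop (fun e s' => Same askArrays [] s₀ s' ∧ s'.nat 15 0 = J - e ∧
      s'.nat 14 0 < 2 ^ (J - e) ∧ s'.nat 12 0 < 2 ^ level b₀ c (J - e) ∧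
      s'.nat 13 0 < 2 ^ level b₀ c (J - e) ∧
      gen b₀ c (J - e) (s'.nat 12 0, s'.nat 13 0) (s'.nat 14 0) = gen b₀ c J w i₀)
    J ?_ ?_ ?_).mono le_rfl fun s' hs' => ?_
  · rintro e he s' ⟨g1, g2, g3, g4, g5, g6⟩
    refine ⟨by simp only [TestExpr.Holds, NatExpr.eval, g2]; omega, ?_⟩
    obtain ⟨j, hj⟩ : ∃ j, J - e = j + 1 := ⟨J - e - 1, by omega⟩
    have hj' : J - (e + 1) = j := by omega
    have hjJ : j < J := by omega
    rw [hj] at g2 g3 g4 g5 g6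
    rw [hj']
    generalize hP : s'.nat 12 0 = P at *
    generalize hQ : s'.nat 13 0 = Q at *
    generalize hii : s'.nat 14 0 = ii at *
    have e6 : s'.nat 6 (j + 1) = level b₀ c (j + 1) := by
      rw [g1.nat 6 (by simp), hR.levels (j + 1) hjJ]
    have hpow : 2 ^ (j + 1) = 2 ^ j + 2 ^ j := by rw [pow_succ, mul_two]
    refine Wp.mono ((g1.wp (c := descendHead)
      (Q := fun s' => s'.nat 15 0 = j ∧ s'.nat 16 0 = level b₀ c (j + 1) ∧ s'.nat 12 0 = P ∧
        s'.nat 13 0 = Q ∧ s'.nat 14 0 = ii)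
      (by simp [descendHead, Prog.Straight, Prog.LoopFree, Prog.tosses])
      (by simp [descendHead, Prog.Writes])
      (by simp [descendHead, Prog.act, NatExpr.eval, g2, e6, hP, hQ, hii])).seq
      fun s₁ ⟨k1, k2, k3, k4, k5, k6⟩ =>
      (wp_splitLoop hR k1 hjJ k6 k2 k3 k4 k5 g4 g5).seq
      fun s₂ ⟨l1, l2, l3, l4, l5, l6, l7⟩ =>
      Wp.cond (T := (set 14 (.sub (v 14) (.cell 8 (v 15)))).bound + (level b₀ c J + 1) *
        ((TestExpr.natLt (v 16) (.cell 6 (.add (v 15) (.const 1)))).cost + walkBody.bound))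
        (fun hc => ?_) (fun hc => ?_)) ?time (fun _ h => h)
    case time =>
      unfold descendConst
      simp only [add_mul _ _ (level b₀ c J + 1)]
      have (p : ℕ) : p ≤ p * (level b₀ c J + 1) := Nat.le_mul_of_pos_right _ (by omega)
      have p1 := this descendHead.bound
      have p2 := this (TestExpr.natLt (v 14) (.cell 8 (v 15))).cost
      have p3 := this (set 14 (.sub (v 14) (.cell 8 (v 15)))).bound
      rw [mul_comm (level b₀ c J + 1), mul_comm (level b₀ c J + 1)]
      simp only [add_mul _ _ (level b₀ c J + 1)]
      omega
    · have e8 : s₂.nat 8 j = 2 ^ j := by rw [l1.nat 8 (by simp), hR.sizes j hjJ.le]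
      simp only [TestExpr.Holds, NatExpr.eval, l2, l3, e8] at hc
      refine (Prog.wp_of_straight (by simp [Prog.Straight, Prog.LoopFree, Prog.tosses])
        ⟨l1, l3, ?_⟩).mono ?_ fun _ h => h
      · simp only [Prog.bound]
        omega
      · simp only [Prog.act, l2, l5, l6]
        refine ⟨hc, Nat.mod_lt _ (by positivity), Nat.mod_lt _ (by positivity), ?_⟩
        rw [← g6, gen, if_pos hc]
        rfl
    · have e8 : s₂.nat 8 j = 2 ^ j := by rw [l1.nat 8 (by simp), hR.sizes j hjJ.le]
      simp only [TestExpr.Holds, NatExpr.eval, l2, l3, e8] at hc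
      refine (l1.wp (c := set 14 (.sub (v 14) (.cell 8 (v 15))))
        (Q := fun s' => s'.nat 14 0 = ii - 2 ^ j ∧ s'.nat 15 0 = j ∧
          s'.nat 16 0 = level b₀ c j ∧ s'.nat 12 0 = (P, Q).1 % 2 ^ level b₀ c j ∧
          s'.nat 13 0 = (P, Q).2 % 2 ^ level b₀ c j ∧
          ∀ u, level b₀ c j ≤ u → u < level b₀ c (j + 1) →
          s'.nat 18 u = ((P, Q).1.testBit u).toNat ∧ s'.nat 19 u = ((P, Q).2.testBit u).toNat)
        (by simp [Prog.Straight, Prog.LoopFree, Prog.tosses]) (by simp [Prog.Writes])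
        ?_).seq fun s₃ ⟨p1, p2, p3, p4, p5, p6, p7⟩ =>
        (wp_walkLoop (z := (P, Q)) hR p1 hjJ p2 p3 p4 p5 p6 p7).mono le_rfl
          fun s₄ ⟨q1, q2, q3, q4, q5⟩ => ?_
      · simpa [Prog.act, NatExpr.eval, l2, l3, l4, l5, l6, e8] using l7
      · have hlt := walk_lt (level b₀ c j) (P, Q) (4608 * c j)
        refine ⟨q1, q3, by omega, by omega, by omega, ?_⟩
        rw [← g6, gen, if_neg hc, q2, q4, q5]
  · rintro s' ⟨g1, g2, -⟩
    simp [TestExpr.Holds, NatExpr.eval, g2]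
  · simp only [Nat.sub_zero, h12, h13, h14, h15]
    exact ⟨hs, trivial, hi, hw1, hw2, trivial⟩
  · simp only [Nat.sub_self] at hs'
    exact ⟨hs'.1, hs'.2.2.2.2.2, hs'.2.2.2.1, hs'.2.2.2.2.1⟩

lemma wp_queryLoop (hR : Ready b₀ d J c ε w i₀ s₀) {s : MachineState}
    (hs : Same askArrays [] s₀ s) {P Q : ℕ} (h16 : s.nat 16 0 = b₀)
    (h12 : s.nat 12 0 = P) (h13 : s.nat 13 0 = Q) (hP : P < 2 ^ b₀) (hQ : Q < 2 ^ b₀) :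
    Wp queryLoop ((b₀ + 1) * ((TestExpr.natLt (.const 0) (v 16)).cost + queryBody.bound))
      (fun s' => Same askArrays [] s₀ s' ∧ ∀ u < b₀,
          s'.nat 1 (u + u) = (P.testBit u).toNat ∧
          s'.nat 1 (u + u + 1) = (Q.testBit u).toNat) s := by
  have hle : b₀ ≤ level b₀ c J := monotone_level b₀ c (Nat.zero_le J)
  refine (Wp.loop (fun e s' => Same askArrays [] s₀ s' ∧
        s'.nat 16 0 = b₀ - e ∧ s'.nat 12 0 = P % 2 ^ (b₀ - e) ∧
        s'.nat 13 0 = Q % 2 ^ (b₀ - e) ∧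
        ∀ u, b₀ - e ≤ u → u < b₀ → s'.nat 1 (u + u) = (P.testBit u).toNat ∧
          s'.nat 1 (u + u + 1) = (Q.testBit u).toNat)
    b₀ ?_ ?_ ?_).mono le_rfl fun s' hs' => ?_
  · rintro e he s' ⟨g1, g4, g5, g6, g7⟩
    obtain ⟨t, ht⟩ : ∃ t, b₀ - e = t + 1 := ⟨b₀ - e - 1, by omega⟩
    have ht' : b₀ - (e + 1) = t := by omega
    rw [ht] at g4 g5 g6 g7
    have e7 : s'.nat 7 t = 2 ^ t := by rw [g1.nat 7 (by simp), hR.powers t (by omega)]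
    rw [mod_two_pow_succ] at g5 g6
    have lP : P % 2 ^ t < 2 ^ t := Nat.mod_lt _ (by positivity)
    have lQ : Q % 2 ^ t < 2 ^ t := Nat.mod_lt _ (by positivity)
    refine ⟨?_, Prog.wp_of_straight
      (by simp [queryBody, splitDigit, Prog.Straight, Prog.LoopFree, Prog.tosses])
      ⟨g1.act (by simp [queryBody, splitDigit, Prog.Straight, Prog.LoopFree, Prog.tosses])
        (by simp [queryBody, splitDigit, Prog.Writes]), ?_⟩⟩
    · simp only [TestExpr.Holds, NatExpr.eval, g4]
      omega
    · rw [ht']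
      have hu (u : ℕ) (h1 : t ≤ u) (h2 : u < b₀) (h3 : u ≠ t) := g7 u (by omega) h2
      cases hy : P.testBit t <;> cases hz : Q.testBit t <;>
        · rw [hy] at g5
          rw [hz] at g6
          simp only [Bool.toNat_false, Bool.toNat_true, mul_zero, mul_one, add_zero] at g5 g6
          simp [queryBody, splitDigit, Prog.act, NatExpr.eval, TestExpr.Holds, g4, g5, g6,
            e7, lP, lQ]
          intro u h1 h2
          have n2 : ¬ u + u = t + t + 1 := by omega
          have n3 : ¬ u + u + 1 = t + t := by omega
          by_cases h3 : u = t
          · subst h3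
            simp [hy, hz]
          · have n1 : ¬ u + u = t + t := by omega
            simpa [n1, n2, n3] using hu u h1 h2 h3
  · rintro s' ⟨g1, g4, -⟩
    simp [TestExpr.Holds, NatExpr.eval, g4]
  · simp only [Nat.sub_zero]
    refine ⟨hs, h16, ?_, ?_, fun u h1 h2 => by omega⟩
    · rw [h12, Nat.mod_eq_of_lt hP]
    · rw [h13, Nat.mod_eq_of_lt hQ]
  · exact ⟨hs'.1, fun u hu => hs'.2.2.2.2 u (by omega) hu⟩

/-- The tables, the seed and the real constants are never overwritten, so only the round counter has
to be checked anew. -/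
lemma Ready.of_same {as rs : List ℕ} {s : MachineState} {i : ℕ} (hR : Ready b₀ d J c ε w i₀ s₀)
    (hs : Same as rs s₀ s) (ha : ∀ a ∈ as, a ∉ [0, 3, 6, 7, 8, 9, 10])
    (hr : ∀ a ∈ rs, a ∉ [0, 4, 5]) (hi : s.nat 11 0 = i) : Ready b₀ d J c ε w i s := by
  have hn (a : ℕ) (h : a ∈ [0, 3, 6, 7, 8, 9, 10]) : s.nat a = s₀.nat a :=
    hs.nat a fun h' => ha a h' h
  have hr (a : ℕ) (h : a ∈ [0, 4, 5]) : s.real a = s₀.real a :=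
    hs.real a fun h' => hr a h' h
  refine ⟨?_, ?_, ?_, ?_, ?_, ?_, ?_, hi, ?_, ?_, ?_⟩
  · rw [hn 0 (by simp), hR.dim]
  · rw [hn 3 (by simp), hR.depth]
  · rw [hn 6 (by simp)]; exact hR.levels
  · rw [hn 7 (by simp)]; exact hR.powers
  · rw [hn 8 (by simp)]; exact hR.sizes
  · rw [hn 9 (by simp), hR.seedX]
  · rw [hn 10 (by simp), hR.seedY]
  · rw [hr 0 (by simp), hR.eps]
  · rw [hr 4 (by simp), hR.step]
  · rw [hr 5 (by simp), hR.side]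

/-- A constant for the running time of the computation of a query point. -/
def askConst : ℕ :=
  askHead.bound + ((TestExpr.natLt (.const 0) (v 15)).cost + descendConst) +
    (set 16 (v 6)).bound + ((TestExpr.natLt (.const 0) (v 16)).cost + queryBody.bound) +
    (set 11 (.add (v 11) (.const 1))).bound

lemma wp_askMain (hR : Ready b₀ d J c ε w i₀ s₀) (hi : i₀ < 2 ^ J)
    (hw1 : w.1 < 2 ^ level b₀ c J) (hw2 : w.2 < 2 ^ level b₀ c J) {n : ℕ} (hn : n ≤ 2 * b₀)
    {M : ℕ} (hJM : J ≤ M) (hM : level b₀ c J ≤ M) :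
    Wp askMain (askConst * (M + 1) ^ 2)
      (fun s' => Ready b₀ d J c ε w (i₀ + 1) s' ∧
        s'.queryPoint n = queryBits n (gen b₀ c J w i₀)) s₀ := by
  have hbM : b₀ ≤ M := (monotone_level b₀ c (Nat.zero_le J)).trans hM
  refine Wp.mono (((Same.refl askArrays [] s₀).wp (c := askHead)
    (Q := fun s' => s'.nat 14 0 = i₀ ∧ s'.nat 15 0 = J ∧ s'.nat 12 0 = w.1 ∧ s'.nat 13 0 = w.2)
    (by simp [askHead, Prog.Straight, Prog.LoopFree, Prog.tosses])
    (by simp [askHead, Prog.Writes])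
    (by simp [askHead, Prog.act, NatExpr.eval, hR.round, hR.depth, hR.seedX, hR.seedY])).seq
    fun s₁ ⟨g1, g2, g3, g4, g5⟩ =>
    (wp_descendLoop hR g1 g2 g3 g4 g5 hi hw1 hw2).seq fun s₂ ⟨k1, k2, k3, k4⟩ =>
    (k1.wp (c := set 16 (v 6))
      (Q := fun s' => s'.nat 16 0 = b₀ ∧ s'.nat 12 0 = (gen b₀ c J w i₀).1 ∧
        s'.nat 13 0 = (gen b₀ c J w i₀).2)
      (by simp [Prog.Straight, Prog.LoopFree, Prog.tosses]) (by simp [Prog.Writes]) ?_).seq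
    fun s₃ ⟨l1, l2, l3, l4⟩ =>
    (wp_queryLoop hR l1 l2 l3 l4 (by rw [← k2]; exact k3) (by rw [← k2]; exact k4)).seq
    fun s₄ ⟨p1, p2⟩ => Prog.wp_of_straight
      (by simp [Prog.Straight, Prog.LoopFree, Prog.tosses]) ⟨?_, ?_⟩) ?time (fun _ h => h)
  case time =>
    unfold askConst
    set N := M + 1 with hN
    have q1 (p : ℕ) : p ≤ p * N ^ 2 := Nat.le_mul_of_pos_right _ (by positivity)
    have q2 (p : ℕ) : (b₀ + 1) * p ≤ p * N ^ 2 := by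
      rw [mul_comm]
      exact Nat.mul_le_mul_left _ (by nlinarith)
    have q3 (p q : ℕ) : (J + 1) * (p + q * (level b₀ c J + 1)) ≤ (p + q) * N ^ 2 := by
      calc (J + 1) * (p + q * (level b₀ c J + 1)) ≤ N * (p * N + q * N) := by
            gcongr
            · omega
            · exact Nat.le_mul_of_pos_right _ (by omega)
            · omega
        _ = (p + q) * N ^ 2 := by ring
    have r1 := q1 askHead.bound
    have r2 := q3 (TestExpr.natLt (.const 0) (v 15)).cost descendConst
    have r3 := q1 (set 16 (v 6)).bound
    have r4 := q2 ((TestExpr.natLt (.const 0) (v 16)).cost + queryBody.bound)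
    have r5 := q1 (set 11 (.add (v 11) (.const 1))).bound
    rw [add_mul _ _ (N ^ 2), add_mul _ _ (N ^ 2), add_mul _ _ (N ^ 2), add_mul _ _ (N ^ 2)]
    linarith
  · have e6 : s₂.nat 6 0 = b₀ := by rw [k1.nat 6 (by simp), hR.levels 0 (by omega)]; rfl
    simp [Prog.act, NatExpr.eval, e6, ← k2]
  · refine (hR.of_same p1 (by simp) (by simp) rfl).of_same
      ((Same.refl [11] [] s₄).act (by simp [Prog.Straight, Prog.LoopFree, Prog.tosses])
        (by simp [Prog.Writes])) (by simp) (by simp) ?_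
    simp [Prog.act, NatExpr.eval, p1.nat 11, hR.round]
  · funext t
    have ht := t.2
    have e1 : (Prog.act (set 11 (.add (v 11) (.const 1))) s₄).nat 1 = s₄.nat 1 :=
      Prog.Writes.nat_act (as := [11]) (rs := []) (by simp [Prog.Writes]) s₄ (by simp)
    have hb (b : Bool) : decide (b.toNat ≠ 0) = b := by cases b <;> rfl
    simp only [MachineState.queryPoint, queryBits, e1]
    have hu := p2 (t / 2) (by omega)
    split_ifs with h
    · have e : (t : ℕ) = t / 2 + t / 2 := by omega
      rw [← hb (Nat.testBit _ _), ← hu.1, ← e]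
    · have e : (t : ℕ) = t / 2 + t / 2 + 1 := by omega
      rw [← hb (Nat.testBit _ _), ← hu.2, ← e]

end Ask

section Reply

variable {b₀ d J : ℕ} {c : ℕ → ℕ} {ε : ℝ} {w : ℕ × ℕ} {i₀ : ℕ} {s₀ : MachineState}

/-- The flag drops to `0` at the first coordinate that the shift spoils. The candidate output is
written regardless, since a later pass overwrites it if the shift is rejected. -/
lemma wp_roundLoop (hR : Ready b₀ d J c ε w i₀ s₀) {s : MachineState}
    (hs : Same [15, 17] [2, 6] s₀ s) {W : Vec d} (hW : ∀ j : Fin d, s₀.real 1 j = W j) (Δ : ℕ)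
    (h6 : s.real 6 0 = Δ * (4 * ε)) (h17 : s.nat 17 0 = 1) (h15 : s.nat 15 0 = 0) :
    Wp roundLoop ((d + 1) * ((TestExpr.natLt (v 15) (.cell 0 (.const 2))).cost + roundBody.bound))
      (fun s' => Same [15, 17] [2, 6] s₀ s' ∧ s'.real 6 0 = Δ * (4 * ε) ∧
        (s'.nat 17 0 < 1 ↔ ¬ Rounding.Good ε W Δ) ∧
        ∀ j : Fin d, s'.real 2 j = Rounding.floorTo (Rounding.grid d ε) (W j + Δ * (4 * ε) - ε))
      s := by
  refine (Wp.loop (fun i s' => Same [15, 17] [2, 6] s₀ s' ∧ s'.real 6 0 = Δ * (4 * ε) ∧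
      s'.nat 15 0 = i ∧
      (s'.nat 17 0 < 1 ↔ ∃ j : Fin d, (j : ℕ) < i ∧
        Rounding.floorTo (Rounding.grid d ε) (W j + Δ * (4 * ε) - ε) <
          Rounding.floorTo (Rounding.grid d ε) (W j + Δ * (4 * ε) + ε)) ∧
      ∀ j : Fin d, (j : ℕ) < i →
        s'.real 2 j = Rounding.floorTo (Rounding.grid d ε) (W j + Δ * (4 * ε) - ε))
    d ?_ ?_ ?_).mono le_rfl fun s' hs' => ?_
  · rintro i hi s' ⟨g1, g2, g3, g4, g5⟩
    have e0 : s'.nat 0 2 = d := by rw [g1.nat 0 (by simp), hR.dim]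
    have e1 : s'.real 1 i = W ⟨i, hi⟩ := by rw [g1.real 1 (by simp), ← hW]
    have e2 : s'.real 0 0 = ε := by rw [g1.real 0 (by simp), hR.eps]
    have e3 : s'.real 5 0 = Rounding.grid d ε := by rw [g1.real 5 (by simp), hR.side]
    refine ⟨by simpa [TestExpr.Holds, NatExpr.eval, g3, e0] using hi, Prog.wp_of_straight
      (by simp [roundBody, Prog.Straight, Prog.LoopFree, Prog.tosses])
      ⟨g1.act (by simp [roundBody, Prog.Straight, Prog.LoopFree, Prog.tosses])
        (by simp [roundBody, Prog.Writes]), ?_⟩⟩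
    have hex : (∃ j : Fin d, (j : ℕ) < i + 1 ∧
        Rounding.floorTo (Rounding.grid d ε) (W j + Δ * (4 * ε) - ε) <
          Rounding.floorTo (Rounding.grid d ε) (W j + Δ * (4 * ε) + ε)) ↔
        s'.nat 17 0 < 1 ∨ Rounding.floorTo (Rounding.grid d ε) (W ⟨i, hi⟩ + Δ * (4 * ε) - ε) <
          Rounding.floorTo (Rounding.grid d ε) (W ⟨i, hi⟩ + Δ * (4 * ε) + ε) := by
      rw [g4]
      constructor
      · rintro ⟨j, hj, h⟩
        rcases Nat.lt_succ_iff_lt_or_eq.1 hj with hj | hj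
        · exact Or.inl ⟨j, hj, h⟩
        · obtain rfl : j = ⟨i, hi⟩ := Fin.ext hj
          exact Or.inr h
      · rintro (⟨j, hj, h⟩ | h)
        · exact ⟨j, by omega, h⟩
        · exact ⟨⟨i, hi⟩, Nat.lt_succ_self i, h⟩
    rw [hex]
    have hreal (j : Fin d) (hj : (j : ℕ) < i + 1) (hne : (j : ℕ) ≠ i) := g5 j (by omega)
    unfold Rounding.floorTo at *
    by_cases hbad : (⌊(W ⟨i, hi⟩ + Δ * (4 * ε) - ε) / Rounding.grid d ε⌋ : ℝ) * Rounding.grid d ε <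
        ⌊(W ⟨i, hi⟩ + Δ * (4 * ε) + ε) / Rounding.grid d ε⌋ * Rounding.grid d ε
    all_goals
      simp [roundBody, Prog.act, NatExpr.eval, RealExpr.eval, TestExpr.Holds, e1, e2, e3, g2, g3,
        hbad, -mul_lt_mul_iff_left₀]
      intro j hj
      split_ifs with h
      · obtain rfl : j = ⟨i, hi⟩ := Fin.ext h
        rfl
      · exact hreal j (Nat.lt_succ_of_le hj) h
  · rintro s' ⟨g1, g2, g3, -⟩
    have e0 : s'.nat 0 2 = d := by rw [g1.nat 0 (by simp), hR.dim]
    simp [TestExpr.Holds, NatExpr.eval, g3, e0]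
  · refine ⟨hs, h6, h15, ?_, fun j hj => by omega⟩
    simp [h17]
  · refine ⟨hs'.1, hs'.2.1, ?_, fun j => hs'.2.2.2.2 j j.2⟩
    rw [hs'.2.2.2.1]
    simp [Rounding.Good]

/-- A constant for the running time of the computation of an output. -/
def replyConst : ℕ :=
  (Prog.seq (rset 6 (.sub .zero (rv 4))) (set 17 (.const 0))).bound +
    ((TestExpr.natLt (v 17) (.const 1)).cost + (shiftHead.bound +
      ((TestExpr.natLt (v 15) (.cell 0 (.const 2))).cost + roundBody.bound)))

lemma wp_replyMain (hε : 0 < ε) (hR : Ready b₀ d J c ε w i₀ s₀) {W : Vec d}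
    (hW : ∀ j : Fin d, s₀.real 1 j = W j) :
    Wp replyMain (replyConst * (d + 2) ^ 2)
      (fun s' => Ready b₀ d J c ε w i₀ s' ∧ s'.outputVec d = Rounding.roundVec ε W) s₀ := by
  set m := Rounding.leastShift ε W with hm
  have hmd : m ≤ d := Rounding.leastShift_le hε W
  refine Wp.mono (((Same.refl [15, 17] [2, 6] s₀).wp
    (c := Prog.seq (rset 6 (.sub .zero (rv 4))) (set 17 (.const 0)))
    -- The shift is one step behind the pass counter: before pass `i` it is `i - 1`, and exactly `m
    -- + 1` passes test the shifts from `0` to `m`.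
    (Q := fun s' => s'.real 6 0 = ((0 : ℕ) - 1) * (4 * ε) ∧ (s'.nat 17 0 < 1 ↔ 0 < m + 1) ∧
      (0 = m + 1 → s'.outputVec d = Rounding.roundVec ε W))
    (by simp [Prog.Straight, Prog.LoopFree, Prog.tosses]) (by simp [Prog.Writes])
    (by simp [Prog.act, NatExpr.eval, RealExpr.eval, hR.step])).seq fun s₁ h₁ =>
    (Wp.loop (T := shiftHead.bound + (d + 1) *
        ((TestExpr.natLt (v 15) (.cell 0 (.const 2))).cost + roundBody.bound))
      (fun i s' => Same [15, 17] [2, 6] s₀ s' ∧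
        s'.real 6 0 = ((i : ℕ) - 1) * (4 * ε) ∧ (s'.nat 17 0 < 1 ↔ i < m + 1) ∧
        (i = m + 1 → s'.outputVec d = Rounding.roundVec ε W)) (m + 1) ?_ ?_ h₁).mono le_rfl
      fun s' hs' => ⟨?_, hs'.2.2.2 rfl⟩) ?time (fun _ h => h)
  case time =>
    unfold replyConst
    generalize (Prog.seq (rset 6 (.sub .zero (rv 4))) (set 17 (.const 0))).bound = p
    generalize (TestExpr.natLt (v 17) (.const 1)).cost = q
    generalize shiftHead.bound = r
    generalize (TestExpr.natLt (v 15) (.cell 0 (.const 2))).cost + roundBody.bound = t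
    have h1 : p ≤ p * (d + 2) ^ 2 := Nat.le_mul_of_pos_right _ (by positivity)
    have h2 : (m + 1 + 1) * (q + (r + (d + 1) * t)) ≤ (d + 2) * (q * (d + 2) + (r * (d + 2) +
        (d + 2) * t)) := by
      refine Nat.mul_le_mul (by omega) (add_le_add ?_ (add_le_add ?_ ?_))
      · exact Nat.le_mul_of_pos_right _ (by omega)
      · exact Nat.le_mul_of_pos_right _ (by omega)
      · exact Nat.mul_le_mul_right _ (by omega)
    calc _ ≤ p * (d + 2) ^ 2 + (d + 2) * (q * (d + 2) + (r * (d + 2) + (d + 2) * t)) :=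
          add_le_add h1 h2
      _ = _ := by ring
  · rintro i hi s' ⟨g1, g2, g3, -⟩
    refine ⟨by simpa [TestExpr.Holds, NatExpr.eval] using g3.2 hi, ?_⟩
    have e4 : s'.real 4 0 = 4 * ε := by rw [g1.real 4 (by simp), hR.step]
    refine (g1.wp (c := shiftHead) (Q := fun s' => s'.real 6 0 = i * (4 * ε) ∧ s'.nat 17 0 = 1 ∧
      s'.nat 15 0 = 0) (by simp [shiftHead, Prog.Straight, Prog.LoopFree, Prog.tosses])
      (by simp [shiftHead, Prog.Writes]) ?_).seq fun s₂ ⟨k1, k2, k3, k4⟩ =>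
      (wp_roundLoop hR k1 hW i k2 k3 k4).mono le_rfl fun s₃ ⟨l1, l2, l3, l4⟩ => ?_
    · simp [shiftHead, Prog.act, NatExpr.eval, RealExpr.eval, e4, g2]
      ring
    · refine ⟨l1, by rw [l2]; push_cast; ring, ?_, ?_⟩
      · rw [l3]
        constructor
        · intro hbad
          by_contra hcon
          obtain rfl : i = m := by omega
          exact hbad (Rounding.good_leastShift hε W)
        · intro hlt
          exact Rounding.not_good_of_lt_leastShift W (by omega)
      · intro him
        obtain rfl : i = m := by omega
        funext j
        exact l4 j
  · rintro s' ⟨g1, g2, g3, -⟩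
    simpa [TestExpr.Holds, NatExpr.eval] using g3
  · exact hR.of_same hs'.1 (by simp) (by simp) (by rw [hs'.1.nat 11 (by simp), hR.round])

end Reply

end StewardCode

namespace StewardCode

open Inw

/-! ### The rounds -/

lemma holds_dimPos {s : MachineState} : dimPos.Holds s ↔ 0 < s.nat 0 2 := Iff.rfl

lemma same_receive {d : ℕ} (s : MachineState) (W : Vec d) : Same [] [1] s (s.receive W) := by
  refine ⟨fun _ _ => rfl, fun a ha => ?_, rfl⟩
  have : a ≠ 1 := by simpa using ha
  simp [MachineState.receive, this]

/-- The steps for a single round. -/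
def roundCost (n d M : ℕ) : ℕ :=
  dimPos.cost + askConst * (M + 1) ^ 2 + (n + d) + (dimPos.cost + replyConst * (d + 2) ^ 2) + d

/-- Round `i` reads block `i` of the generator, of which there are `2 ^ J`. `Ready` does not mention
the response or output arrays, so it carries over from round to round whatever the responses are. -/
lemma exists_rounds {n d b₀ J M : ℕ} {c : ℕ → ℕ} {ε : ℝ} {w : ℕ × ℕ} (hε : 0 < ε) (hd : 0 < d)
    (hn : n ≤ 2 * b₀) (hw1 : w.1 < 2 ^ level b₀ c J) (hw2 : w.2 < 2 ^ level b₀ c J) (hJM : J ≤ M)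
    (hM : level b₀ c J ≤ M) (Ws : List (Vec d)) :
    ∀ (i : ℕ) (s : MachineState), Ready b₀ d J c ε w i s → i + Ws.length ≤ 2 ^ J →
      ∃ (out : List (Bits n × Vec d)) (t : ℕ), Rounds program s Ws out t ∧
        t ≤ Ws.length * roundCost n d M ∧
        ∀ l < Ws.length, out[l]? =
          some (queryBits n (gen b₀ c J w (i + l)), Rounding.roundVec ε (Ws.getD l 0)) := by
  induction Ws with
  | nil => exact fun i s _ _ => ⟨[], 0, .nil s, by simp, by simp⟩
  | cons W Ws ih =>
    intro i s hR hi
    rw [List.length_cons] at hi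
    obtain ⟨t₁, s₁, e₁, l₁, hR₁, hq⟩ := Wp.cond (b := dimPos) (c₂ := .skip)
      (fun _ => wp_askMain hR (by omega) hw1 hw2 hn hJM hM)
      (fun h => absurd (by rw [holds_dimPos, hR.dim]; exact hd) h)
    have hR₁' : Ready b₀ d J c ε w (i + 1) (s₁.receive W) :=
      hR₁.of_same (same_receive s₁ W) (by simp) (by simp) hR₁.round
    obtain ⟨t₂, s₂, e₂, l₂, hR₂, ho⟩ := Wp.cond (b := dimPos) (c₂ := .skip)
      (fun _ => wp_replyMain (W := W) hε hR₁' (fun j => by simp [MachineState.receive]))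
      (fun h => absurd (by rw [holds_dimPos, hR₁'.dim]; exact hd) h)
    obtain ⟨out, t, hr, ht, hout⟩ := ih (i + 1) s₂ hR₂ (by omega)
    refine ⟨_, _, .cons e₁ e₂ hr, ?_, ?_⟩
    · rw [List.length_cons, add_mul, one_mul]
      unfold roundCost at *
      omega
    · rintro (_ | l) hl
      · simp [hq, ho]
      · rw [List.length_cons] at hl
        have := hout l (by omega)
        simpa [add_assoc, add_comm 1 l] using this

/-- The steps for all rounds and the initialization. -/
def totalCost (n k d M : ℕ) : ℕ :=
  program.init.bound + initConst * (M + 1) + k * (roundCost n d M + 2)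

lemma implements_steward {n k d : ℕ} {ε γ : ℝ} (hε : 0 < ε) (hγ : 0 < γ) (hk : 0 < k) (hd : 0 < d)
    {a J L b₀ M : ℕ} (ha : a = Nat.clog 2 (d + 1)) (hJ : J = Nat.clog 2 k)
    (hL : L = Nat.clog 2 ⌈1 / γ⌉₊) (hb : b₀ = (n + 1) / 2)
    (hM : a ≤ M ∧ J ≤ M ∧ L ≤ M ∧ b₀ ≤ M ∧ level b₀ (ctl a J L) J ≤ M ∧ d ≤ M) {T : ℝ}
    (hT : (totalCost n k d M : ℝ) ≤ T) :
    program.Implements k ε γ (steward n d b₀ (ctl a J L) J ε) T := by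
  intro x Ws hWs
  obtain ⟨t₀, s, e₀, l₀, hR⟩ := Wp.cond
    (b := .and (.natLt (.const 0) (.cell 0 (.const 1))) dimPos) (c₂ := .skip)
    (fun _ => wp_initMain (n := n) (k := k) (ε := ε) hγ ha hJ hL hb x hM)
    (fun h => absurd ⟨by simpa [TestExpr.Holds, NatExpr.eval, initialState] using hk,
      by simpa [holds_dimPos, initialState] using hd⟩ h)
  obtain ⟨out, t, hr, ht, hout⟩ := exists_rounds (n := n) (M := M) hε hd (by omega)
    (seedOf_lt x).1 (seedOf_lt x).2 hM.2.1 hM.2.2.2.2.1 Ws 0 s hR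
    (by rw [hWs, zero_add, hJ]; exact Nat.le_pow_clog one_lt_two k)
  refine ⟨s, t₀, t, out, e₀, hr, fun i hi => ?_, le_trans ?_ hT⟩
  · rw [hout i (by omega)]
    have h1 : (Ws.take i).length = i := by rw [List.length_take]; omega
    have h2 : (Ws.take (i + 1)).getLastD 0 = Ws.getD i 0 := by
      have h3 : Ws.take (i + 1) = Ws.take i ++ [Ws[i]] := by
        rw [List.take_add_one, List.getElem?_eq_getElem (by omega)]
        rfl
      have h4 (l : List (Vec d)) (y : Vec d) : (l ++ [y]).getLastD 0 = y := by simp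
      rw [h3, h4, List.getD_eq_getElem _ _ (by omega)]
    simp only [steward, h1, h2, zero_add]
  · have : t₀ + t ≤ totalCost n k d M := by
      unfold totalCost
      rw [hWs] at ht
      have hbd : program.init.bound = (TestExpr.and (.natLt (.const 0) (.cell 0 (.const 1)))
        dimPos).cost + (initMain.bound + 1) := rfl
      rw [mul_add k]
      omega
    exact_mod_cast this

/-- The steward without coins for the degenerate parameters. -/
def trivialSteward (n d : ℕ) : OneQuerySteward n d 0 where
  query _ _ := fun _ => false
  output _ _ := 0

/-- Without rounds nothing can fail, and in dimension zero all vectors coincide. -/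
lemma isSteward_trivialSteward {n k d : ℕ} (h : ¬ (0 < k ∧ 0 < d)) {ε δ γ : ℝ} (hδ : 0 < δ)
    (hγ : 0 < γ) : (trivialSteward n d).IsSteward k ε δ (8 * (ε * d)) (k * δ + γ) := by
  intro Ω _ P _ O _ _
  have hempty : {p : Bits 0 × Ω | (trivialSteward n d).Fails k (8 * (ε * d)) (O p.2) p.1} = ∅ := by
    ext p
    simp only [Set.mem_ofPred_eq, Set.mem_empty_iff_false, iff_false]
    rintro ⟨i, hi, hlt⟩
    obtain rfl : d = 0 := by
      by_contra hd
      exact h ⟨by omega, Nat.pos_of_ne_zero hd⟩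
    have h0 (v : Vec 0) : ‖v‖ = 0 := by rw [Subsingleton.elim v 0, norm_zero]
    rw [h0] at hlt
    simp at hlt
  rw [hempty, measureReal_empty]
  positivity

lemma exists_rounds_trivial {n : ℕ} {s : MachineState} (h0 : s.nat 0 2 = 0)
    (h1 : ∀ i, s.nat 1 i = 0) (M : ℕ) (Ws : List (Vec 0)) :
    ∃ (out : List (Bits n × Vec 0)) (t : ℕ), Rounds program s Ws out t ∧
      t ≤ Ws.length * (roundCost n 0 M + 2) ∧
      ∀ l < Ws.length, out[l]? = some (fun _ => false, 0) := by
  induction Ws generalizing s with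
  | nil => exact ⟨[], 0, .nil s, by simp, by simp⟩
  | cons W Ws ih =>
    have hdim (s' : MachineState) (h : s'.nat 0 2 = 0) : ¬ dimPos.Holds s' := by
      rw [holds_dimPos, h]
      exact lt_irrefl 0
    obtain ⟨out, t, hr, ht, hout⟩ := ih (s := s.receive W) h0 h1
    refine ⟨_, _, .cons (Exec.condFalse (hdim s h0) (.skip s))
      (Exec.condFalse (hdim (s.receive W) h0) (.skip _)) hr, ?_, ?_⟩
    · rw [List.length_cons, add_mul, one_mul]
      unfold roundCost at *
      omega
    · rintro (_ | l) hl
      · simp only [List.getElem?_cons_zero, Option.some.injEq, Prod.mk.injEq]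
        refine ⟨?_, Subsingleton.elim _ _⟩
        funext j
        simp [MachineState.queryPoint, h1]
      · rw [List.length_cons] at hl
        simpa using hout l (by omega)

lemma implements_trivialSteward {n k d : ℕ} (h : ¬ (0 < k ∧ 0 < d)) {ε γ : ℝ} (M : ℕ) {T : ℝ}
    (hT : (totalCost n k d M : ℝ) ≤ T) :
    program.Implements k ε γ (trivialSteward n d) T := by
  intro x Ws hWs
  obtain ⟨t₀, s, e₀, l₀, rfl⟩ : ∃ t₀ s, Exec program.init (initialState n k d ε γ x) t₀ s ∧
      t₀ ≤ program.init.bound ∧ s = initialState n k d ε γ x := by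
    refine ⟨_, _, Exec.condFalse (fun hh => h ?_) (.skip _), ?_, rfl⟩
    · simpa [TestExpr.Holds, NatExpr.eval, dimPos, initialState] using hh
    · exact Nat.add_le_add_left (Nat.le_add_left 1 _) _
  generalize hB : program.init.bound = B at l₀
  rcases Nat.eq_zero_or_pos k with rfl | hk
  · obtain rfl : Ws = [] := List.length_eq_zero_iff.1 hWs
    refine ⟨_, t₀, 0, [], e₀, .nil _, by simp, le_trans ?_ hT⟩
    have : t₀ + 0 ≤ totalCost n 0 d M := by
      unfold totalCost
      rw [hB]
      omega
    exact_mod_cast this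
  · obtain rfl : d = 0 := by
      by_contra hd
      exact h ⟨hk, Nat.pos_of_ne_zero hd⟩
    obtain ⟨out, t, hr, ht, hout⟩ := exists_rounds_trivial (n := n)
      (s := initialState n k 0 ε γ x) (by simp [initialState]) (by simp [initialState]) M Ws
    refine ⟨_, t₀, t, out, e₀, hr, fun i hi => ?_, le_trans ?_ hT⟩
    · rw [hout i (by omega)]
      rfl
    · rw [hWs] at ht
      have : t₀ + t ≤ totalCost n k 0 M := by
        unfold totalCost
        rw [hB]
        omega
      exact_mod_cast this

/-! ### The bounds -/

/-! ### Seed length and running time -/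

lemma level_ctl_le (b₀ a J L j : ℕ) :
    level b₀ (ctl a J L) j ≤ b₀ + 4608 * (2 ^ (j + 1) * a + j * (J + L)) := by
  induction j with
  | zero => simp [level]
  | succ j ih =>
    have e1 : 2 ^ (j + 1 + 1) * a = 2 ^ (j + 1) * a + 2 ^ (j + 1) * a := by ring
    have e2 : (j + 1) * (J + L) = j * (J + L) + (J + L) := by ring
    simp only [level, ctl]
    rw [e1, e2]
    omega

/-- The power of two with exponent one less than the rounded logarithm is still below `N`. Stating
the hypothesis on powers of two covers both an integer `N = y` and the rounded value `N = ⌈y⌉₊`. -/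
lemma clog_sub_one_mul_log_le {N : ℕ} {y : ℝ} (hN : ∀ i : ℕ, 2 ^ i < N → (2 : ℝ) ^ i ≤ y)
    (hy : 0 ≤ Real.log y) : ((Nat.clog 2 N : ℝ) - 1) * Real.log 2 ≤ Real.log y := by
  have hlog : 0 < Real.log 2 := Real.log_pos one_lt_two
  rcases Nat.eq_zero_or_pos (Nat.clog 2 N) with h | h
  · rw [h]
    push_cast
    linarith
  · obtain ⟨i, hi⟩ : ∃ i, Nat.clog 2 N = i + 1 := ⟨Nat.clog 2 N - 1, by omega⟩
    have := hN i ((Nat.lt_clog_iff_pow_lt one_lt_two).1 (by omega))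
    have := Real.log_le_log (by positivity) this
    rw [Real.log_pow] at this
    rw [hi]
    push_cast
    linarith

/-- Used to absorb the term `J ^ 2`, which has no counterpart in the bound on the coins, into `2 ^ J
≤ 2 * k`. -/
lemma sq_le_two_mul_two_pow (J : ℕ) : J ^ 2 ≤ 2 * 2 ^ J := by
  rcases lt_or_ge J 4 with h | h
  · interval_cases J <;> norm_num
  · induction J, h using Nat.le_induction with
    | base => norm_num
    | succ J hJ ih =>
      have : 2 ^ (J + 1) = 2 * 2 ^ J := pow_succ' _ _
      rw [this]
      nlinarith

lemma two_pow_clog_le {k : ℕ} (hk : 0 < k) : 2 ^ Nat.clog 2 k ≤ 2 * k := by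
  rcases Nat.eq_zero_or_pos (Nat.clog 2 k) with h | h
  · rw [h]
    omega
  · obtain ⟨i, hi⟩ : ∃ i, Nat.clog 2 k = i + 1 := ⟨Nat.clog 2 k - 1, by omega⟩
    have : 2 ^ i < k := (Nat.lt_clog_iff_pow_lt one_lt_two).1 (by omega)
    rw [hi, pow_succ]
    omega

lemma clog_ceil_le {γ : ℝ} (hγ : 0 < γ) :
    (Nat.clog 2 ⌈1 / γ⌉₊ : ℝ) ≤ 1 + 2 * Real.posLog (1 / γ) := by
  have h2 : 1 / 2 ≤ Real.log 2 := by linarith [Real.log_two_gt_d9]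
  have h0 : 0 ≤ Real.posLog (1 / γ) := Real.posLog_nonneg
  rcases le_total 1 γ with h | h
  · have : ⌈1 / γ⌉₊ ≤ 1 := Nat.ceil_le.2 (by rw [Nat.cast_one, div_le_one hγ]; exact h)
    rw [Nat.clog_of_right_le_one this]
    push_cast
    linarith
  · have hl : 0 ≤ Real.log (1 / γ) := Real.log_nonneg (by rw [le_div_iff₀ hγ]; linarith)
    have := clog_sub_one_mul_log_le (N := ⌈1 / γ⌉₊) (y := 1 / γ)
      (fun i hi => by
        have := (Nat.lt_ceil).1 hi
        push_cast at this
        exact this.le) hl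
    have hp : Real.log (1 / γ) ≤ Real.posLog (1 / γ) := le_max_right _ _
    rcases le_total ((Nat.clog 2 ⌈1 / γ⌉₊ : ℝ)) 1 with h1 | h1
    · linarith
    · nlinarith

lemma one_le_two_pow_clog_ceil_mul {γ : ℝ} (hγ : 0 < γ) :
    1 ≤ (2 : ℝ) ^ Nat.clog 2 ⌈1 / γ⌉₊ * γ := by
  have h := Nat.le_pow_clog one_lt_two ⌈1 / γ⌉₊
  have h' : 1 / γ ≤ (2 : ℝ) ^ Nat.clog 2 ⌈1 / γ⌉₊ := by
    refine (Nat.le_ceil _).trans ?_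
    exact_mod_cast h
  rwa [div_le_iff₀ hγ] at h'

/-- Since `k` and `d` are positive, `k * log (d + 1)` is at least `k / 2`. This pays for the coin
lost by rounding `n` up to an even number and for the terms `J` and `J ^ 2`; together with the main
term they amount to at most `9216 * (16 + 8 + 4) + 2` times `k * log (d + 1)`. -/
lemma coins_le {n k d : ℕ} {γ : ℝ} (hk : 0 < k) (hd : 0 < d) (hγ : 0 < γ) :
    ((2 * level ((n + 1) / 2) (ctl (Nat.clog 2 (d + 1)) (Nat.clog 2 k) (Nat.clog 2 ⌈1 / γ⌉₊))
      (Nat.clog 2 k) : ℕ) : ℝ) ≤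
      n + 300000 * (k * Real.log (d + 1) + Real.log k * Real.posLog (1 / γ)) := by
  have hlev := level_ctl_le ((n + 1) / 2) (Nat.clog 2 (d + 1)) (Nat.clog 2 k)
    (Nat.clog 2 ⌈1 / γ⌉₊) (Nat.clog 2 k)
  have hL := clog_ceil_le hγ
  have hpow := two_pow_clog_le hk
  have hsq := sq_le_two_mul_two_pow (Nat.clog 2 k)
  have hJpow : Nat.clog 2 k ≤ 2 ^ Nat.clog 2 k := (Nat.lt_two_pow_self).le
  have h2 : 1 / 2 ≤ Real.log 2 := by linarith [Real.log_two_gt_d9]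
  have hk1 : (1 : ℝ) ≤ k := by exact_mod_cast hk
  have hd1 : (1 : ℝ) ≤ d := by exact_mod_cast hd
  have hpl : 0 ≤ Real.posLog (1 / γ) := Real.posLog_nonneg
  have hlogd : Real.log 2 ≤ Real.log (d + 1) := Real.log_le_log two_pos (by linarith)
  have hlogk : 0 ≤ Real.log k := Real.log_nonneg hk1
  have ha := clog_sub_one_mul_log_le (N := d + 1) (y := d + 1)
    (fun i hi => by exact_mod_cast hi.le) (by linarith)
  have hJ := clog_sub_one_mul_log_le (N := k) (y := k)
    (fun i hi => by exact_mod_cast hi.le) hlogk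
  have hJ0 : Nat.clog 2 k = 0 ∨ Real.log 2 ≤ Real.log k := by
    rcases Nat.lt_or_ge k 2 with h | h
    · exact Or.inl (Nat.clog_of_right_le_one (by omega) 2)
    · exact Or.inr (Real.log_le_log two_pos (by exact_mod_cast h))
  set a := Nat.clog 2 (d + 1)
  set J := Nat.clog 2 k
  set L := Nat.clog 2 ⌈1 / γ⌉₊
  set ℓ := Real.log (d + 1)
  set pl := Real.posLog (1 / γ)
  have haℓ : (a : ℝ) ≤ 4 * ℓ := by nlinarith
  have hJk : (J : ℝ) ≤ 4 * Real.log k := by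
    rcases hJ0 with h | h
    · rw [h]
      push_cast
      linarith
    · nlinarith
  have hb : 2 * ((n + 1) / 2) ≤ n + 1 := by omega
  have hm : 2 * level ((n + 1) / 2) (ctl a J L) J ≤
      n + 1 + 9216 * (2 ^ (J + 1) * a + J * (J + L)) := by omega
  have hm' : ((2 * level ((n + 1) / 2) (ctl a J L) J : ℕ) : ℝ) ≤
      n + 1 + 9216 * (2 ^ (J + 1) * a + J * (J + L)) := by exact_mod_cast hm
  have hpow' : (2 : ℝ) ^ J ≤ 2 * k := by exact_mod_cast hpow
  have hsq' : (J : ℝ) ^ 2 ≤ 2 * 2 ^ J := by exact_mod_cast hsq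
  have hJpow' : (J : ℝ) ≤ 2 ^ J := by exact_mod_cast hJpow
  have hJnn : (0 : ℝ) ≤ J := by positivity
  have hkℓ : (k : ℝ) ≤ 2 * (k * ℓ) := by nlinarith
  have t1 : (2 : ℝ) ^ (J + 1) * a ≤ 16 * (k * ℓ) := by
    rw [pow_succ]
    have : (2 : ℝ) ^ J * a ≤ (2 * k) * (4 * ℓ) := mul_le_mul hpow' haℓ (by positivity) (by positivity)
    linarith
  have t2 : (J : ℝ) * L ≤ J + 8 * (Real.log k * pl) := by
    have h3 : (J : ℝ) * L ≤ J * (1 + 2 * pl) := mul_le_mul_of_nonneg_left hL hJnn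
    have h4 : (J : ℝ) * pl ≤ 4 * Real.log k * pl := mul_le_mul_of_nonneg_right hJk hpl
    linarith
  have t3 : (J : ℝ) * (J + L) = J ^ 2 + J * L := by ring
  have t4 : 0 ≤ Real.log k * pl := mul_nonneg hlogk hpl
  rw [t3] at hm'
  linarith

/-- The constant in the bound for the running time. -/
def timeConst : ℕ :=
  program.init.bound + initConst * 30001 +
    (2 * dimPos.cost + askConst * 30001 ^ 2 + replyConst * 4 + 4)

/-- A query costs on the order of `M ^ 2`, hence of `N ^ 4`, and there are `k ≤ N` rounds. -/
lemma totalCost_le {n k d M N : ℕ} (hN : n + k + d + 1 ≤ N) (hM : M ≤ 30000 * N ^ 2) :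
    totalCost n k d M ≤ timeConst * N ^ 5 := by
  have hN1 : 1 ≤ N := by omega
  have hpow (i j : ℕ) (h : i ≤ j) : N ^ i ≤ N ^ j := Nat.pow_le_pow_right hN1 h
  have hM1 : M + 1 ≤ 30001 * N ^ 2 := by
    have : 1 ≤ N ^ 2 := Nat.one_le_pow _ _ hN1
    omega
  have h1 : program.init.bound ≤ program.init.bound * N ^ 5 :=
    Nat.le_mul_of_pos_right _ (by positivity)
  have h2 : initConst * (M + 1) ≤ initConst * 30001 * N ^ 5 := by
    rw [mul_assoc]
    exact Nat.mul_le_mul_left _ (hM1.trans (Nat.mul_le_mul_left _ (hpow 2 5 (by norm_num))))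
  have hr : roundCost n d M + 2 ≤
      (2 * dimPos.cost + askConst * 30001 ^ 2 + replyConst * 4 + 4) * N ^ 4 := by
    unfold roundCost
    have a1 : dimPos.cost ≤ dimPos.cost * N ^ 4 := Nat.le_mul_of_pos_right _ (by positivity)
    have a2 : askConst * (M + 1) ^ 2 ≤ askConst * 30001 ^ 2 * N ^ 4 := by
      rw [mul_assoc]
      refine Nat.mul_le_mul_left _ ((Nat.pow_le_pow_left hM1 2).trans (le_of_eq ?_))
      ring
    have a3 : replyConst * (d + 2) ^ 2 ≤ replyConst * 4 * N ^ 4 := by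
      rw [mul_assoc]
      refine Nat.mul_le_mul_left _ ?_
      calc (d + 2) ^ 2 ≤ (2 * N) ^ 2 := Nat.pow_le_pow_left (by omega) 2
        _ = 4 * N ^ 2 := by ring
        _ ≤ 4 * N ^ 4 := Nat.mul_le_mul_left _ (hpow 2 4 (by norm_num))
    have a4 : N ≤ N ^ 4 := by simpa using hpow 1 4 (by norm_num)
    simp only [add_mul]
    have a5 : 2 * dimPos.cost * N ^ 4 = dimPos.cost * N ^ 4 + dimPos.cost * N ^ 4 := by ring
    rw [a5]
    omega
  have h3 : k * (roundCost n d M + 2) ≤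
      (2 * dimPos.cost + askConst * 30001 ^ 2 + replyConst * 4 + 4) * N ^ 5 := by
    calc k * (roundCost n d M + 2) ≤ N * ((2 * dimPos.cost + askConst * 30001 ^ 2 +
          replyConst * 4 + 4) * N ^ 4) := Nat.mul_le_mul (by omega) hr
      _ = _ := by ring
  unfold totalCost timeConst
  rw [add_mul, add_mul]
  omega

/-- The longest seed dominates: it has at most `N + 4608 * (4 + 1) * N ^ 2` bits in each number,
from `2 ^ (J + 1) ≤ 4 * k` and `a ≤ d`. -/
lemma sizes_le {n k d L N : ℕ} (hk : 0 < k) (hN : N = n + k + d + L + 1) :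
    Nat.clog 2 (d + 1) ≤ 30000 * N ^ 2 ∧ Nat.clog 2 k ≤ 30000 * N ^ 2 ∧ L ≤ 30000 * N ^ 2 ∧
      (n + 1) / 2 ≤ 30000 * N ^ 2 ∧
      level ((n + 1) / 2) (ctl (Nat.clog 2 (d + 1)) (Nat.clog 2 k) L) (Nat.clog 2 k) ≤
        30000 * N ^ 2 ∧ d ≤ 30000 * N ^ 2 := by
  have hlev := level_ctl_le ((n + 1) / 2) (Nat.clog 2 (d + 1)) (Nat.clog 2 k) L (Nat.clog 2 k)
  have hpow := two_pow_clog_le hk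
  have ha : Nat.clog 2 (d + 1) ≤ d := Nat.clog_le_of_le_pow Nat.lt_two_pow_self
  have hJ : Nat.clog 2 k ≤ k := Nat.clog_le_of_le_pow Nat.lt_two_pow_self.le
  have hNsq : N ≤ N ^ 2 := Nat.le_self_pow two_ne_zero N
  have t1 : 2 ^ (Nat.clog 2 k + 1) * Nat.clog 2 (d + 1) ≤ 4 * N ^ 2 := by
    calc 2 ^ (Nat.clog 2 k + 1) * Nat.clog 2 (d + 1) ≤ (4 * N) * N :=
          Nat.mul_le_mul (by rw [pow_succ]; omega) (by omega)
      _ = 4 * N ^ 2 := by ring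
  have t2 : Nat.clog 2 k * (Nat.clog 2 k + L) ≤ N ^ 2 := by
    rw [sq]
    exact Nat.mul_le_mul (by omega) (by omega)
  refine ⟨?_, ?_, ?_, ?_, ?_, ?_⟩ <;> omega

end StewardCode

open StewardCode in
theorem theorem1 :
    ∃ (P : StewardProgram) (cErr cRand cTime : ℝ) (e : ℕ),
      ∀ (n k d : ℕ) (ε δ γ : ℝ), 0 < ε → 0 < δ → 0 < γ →
        ∃ (m : ℕ) (S : OneQuerySteward n d m),
          S.IsSteward k ε δ (cErr * (ε * d)) (k * δ + γ) ∧
          (m : ℝ) ≤ n + cRand *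
            (k * Real.log (d + 1) + Real.log k * Real.posLog (1 / γ)) ∧
          P.Implements k ε γ S
            (cTime * (n + k + d + Real.posLog (1 / ε) + Real.posLog (1 / γ) + 1) ^ e) := by
  obtain ⟨C, hC⟩ : ∃ C : ℕ, ∀ n k d M N : ℕ, n + k + d + 1 ≤ N → M ≤ 30000 * N ^ 2 →
      totalCost n k d M ≤ C * N ^ 5 := ⟨timeConst, fun _ _ _ _ _ => totalCost_le⟩
  refine ⟨program, 8, 300000, C * 32, 5, fun n k d ε δ γ hε hδ hγ => ?_⟩
  have hpε : 0 ≤ Real.posLog (1 / ε) := Real.posLog_nonneg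
  have hpγ : 0 ≤ Real.posLog (1 / γ) := Real.posLog_nonneg
  obtain ⟨L, hL⟩ : ∃ L, L = Nat.clog 2 ⌈1 / γ⌉₊ := ⟨_, rfl⟩
  obtain ⟨N, hN⟩ : ∃ N, N = n + k + d + L + 1 := ⟨_, rfl⟩
  have hLγ := clog_ceil_le hγ
  rw [← hL] at hLγ
  have hT : (totalCost n k d (30000 * N ^ 2) : ℝ) ≤ C * 32 *
      (n + k + d + Real.posLog (1 / ε) + Real.posLog (1 / γ) + 1) ^ 5 := by
    have h1 : (totalCost n k d (30000 * N ^ 2) : ℝ) ≤ C * (N : ℝ) ^ 5 := by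
      exact_mod_cast hC n k d _ N (by omega) le_rfl
    have h2 : (N : ℝ) ≤ 2 * (n + k + d + Real.posLog (1 / ε) + Real.posLog (1 / γ) + 1) := by
      rw [hN]
      push_cast
      have : (0 : ℝ) ≤ n := by positivity
      have : (0 : ℝ) ≤ k := by positivity
      have : (0 : ℝ) ≤ d := by positivity
      linarith
    calc _ ≤ C * (N : ℝ) ^ 5 := h1
      _ ≤ C *
          (2 * (n + k + d + Real.posLog (1 / ε) + Real.posLog (1 / γ) + 1)) ^ 5 := by gcongr
      _ = _ := by ring
  -- In the degenerate cases the coin bound can shrink to `n`, leaving no room for rounding an odd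
  -- `n` up; there a steward without coins suffices.
  by_cases h : 0 < k ∧ 0 < d
  · obtain ⟨hk, hd⟩ := h
    refine ⟨_, Inw.steward n d ((n + 1) / 2)
      (ctl (Nat.clog 2 (d + 1)) (Nat.clog 2 k) L) (Nat.clog 2 k) ε, ?_, ?_, ?_⟩
    · exact Inw.isSteward_steward n d _ _ _ _ k ε δ γ hε hδ (by omega)
        (Nat.le_pow_clog one_lt_two _) (Nat.le_pow_clog one_lt_two _)
        (hL ▸ one_le_two_pow_clog_ceil_mul hγ)
    · rw [hL]
      exact coins_le hk hd hγ
    · exact implements_steward hε hγ hk hd rfl rfl hL rfl (sizes_le hk hN) hT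
  · refine ⟨0, trivialSteward n d, isSteward_trivialSteward h hδ hγ, ?_,
      implements_trivialSteward h _ hT⟩
    have h1 : 0 ≤ Real.log ((d : ℝ) + 1) := Real.log_nonneg (by linarith [Nat.cast_nonneg (α := ℝ) d])
    have h2 : 0 ≤ Real.log (k : ℝ) := Real.log_natCast_nonneg k
    push_cast
    positivity
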